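/- Let $d\ge 0$. A staircase is $\gamma\in\mathbb Z^d$ with $\gamma_1\ge\dots\ge\gamma_d$, and $\mathcal Q_\gamma$ denotes the irreducible unitary representation of $U(d)$ with highest weight $\gamma$, with action $r_\gamma$. Fix an arbitrary orthonormal basis in every $\mathcal Q_\gamma$; transposes and complex conjugates are taken in these bases, and in the standard bases of the spaces $\mathbb C^c$. Let $\overline{\mathcal Q_\gamma}$ be the dual representation, i.e. the same space with action $g\mapsto\overline{r_\gamma(g)}$. For $R,S$ each of the form $\mathcal Q_\nu$ or $\overline{\mathcal Q_\nu}$ let $c_{R,S}^{\gamma}$ be the multiplicity of $\mathcal Q_\gamma$ in $R\otimes S$ (as representations of $U(d)$). A Clebsch–Gordan transform of $R\otimes S$ is a unitary $$U:\ R\otimes S\longrightarrow\bigoplus_{\gamma:\,c_{R,S}^\gamma\ge 1}\mathcal Q_\gamma\otimes\mathbb C^{c_{R,S}^\gamma}$$ commuting with the action of $SU(d)$; for $\psi\in\mathbb C^{c_{R,S}^\gamma}$ put $\iota_U^{\gamma,\psi}:\mathcal Q_\gamma\to R\otimes S$, $\iota_U^{\gamma,\psi}(q)=U^*(q\otimes\psi)$.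 We write $\overline\lambda,\overline\gamma$ in indices for $\overline{\mathcal Q_\lambda},\overline{\mathcal Q_\gamma}$, and $\overline\lambda+_d\mu=\{\gamma: c_{\overline\lambda,\mu}^\gamma\ge1\}$. Let $\lambda,\mu$ be staircases, and let $\mathcal C_u(\mathcal Q_\lambda,\mathcal Q_\mu)$ be the convex set of completely positive trace-preserving linear maps $\Phi:\mathcal B(\mathcal Q_\lambda)\to\mathcal B(\mathcal Q_\mu)$ with $\Phi(r_\lambda(g)Ar_\lambda(g)^*)=r_\mu(g)\Phi(A)r_\mu(g)^*$ for all $g\in SU(d)$ and all $A$. Clebsch–Gordan transforms of $\overline{\mathcal Q_\lambda}\otimes\mathcal Q_\mu$ exist. Let $U$ be any of them. For $\gamma\in\overline\lambda+_d\mu$ and a unit vector $\psi\in\mathbb C^{c_{\overline\lambda,\mu}^\gamma}$ let $\Phi_{\lambda,\mu}^{\gamma,\psi}$ be the linear map with Choi matrix $$\sum_{i,j}|i\rangle\langle j|\otimes\Phi_{\lambda,\mu}^{\gamma,\psi}(|i\rangle\langle j|)=\frac{\dim\mathcal Q_\lambda}{\dim\mathcal Q_\gamma}\,U^*\bigl(1_{\mathcal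 Q_\gamma}\otimes|\psi\rangle\langle\psi|\bigr)U .$$ **Theorem.** (a) The set of extreme points of $\mathcal C_u(\mathcal Q_\lambda,\mathcal Q_\mu)$ is exactly the set of all maps $\Phi_{\lambda,\mu}^{\gamma,\psi}$ with $\gamma\in\overline\lambda+_d\mu$ and $\psi\in\mathbb C^{c_{\overline\lambda,\mu}^\gamma}$ a unit vector. (b) For every $\gamma\in\overline\lambda+_d\mu$ one has $c_{\overline\lambda,\mu}^\gamma=c_{\mu,\overline\gamma}^\lambda=c_{\lambda,\gamma}^\mu=:c$, and there are Clebsch–Gordan transforms $V$ of $\mathcal Q_\mu\otimes\overline{\mathcal Q_\gamma}$ and $W$ of $\mathcal Q_\lambda\otimes\mathcal Q_\gamma$ such that for all unit vectors $\psi\in\mathbb C^c$ and all $A\in\mathcal B(\mathcal Q_\lambda)$ $$\Phi_{\lambda,\mu}^{\gamma,\psi}(A)=\frac{\dim\mathcal Q_\lambda}{\dim\mathcal Q_\gamma}\operatorname{tr}_{\overline{\mathcal Q_\lambda}}\Bigl[\iota_U^{\gamma,\psi}(\iota_U^{\gamma,\psi})^*(A^T\otimes 1_{\mathcal Q_\mu})\Bigr],$$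 $$\Phi_{\lambda,\mu}^{\gamma,\psi}(A)=\operatorname{tr}_{\overline{\mathcal Q_\gamma}}\Bigl[\iota_V^{\lambda,\psi}A(\iota_V^{\lambda,\psi})^*\Bigr],$$ $$\Phi_{\lambda,\mu}^{\gamma,\psi}(A)=\frac{\dim\mathcal Q_\lambda}{\dim\mathcal Q_\mu}(\iota_W^{\mu,\overline\psi})^*(A\otimes 1_{\mathcal Q_\gamma})\,\iota_W^{\mu,\overline\psi},$$ where $\overline\psi$ is the entrywise complex conjugate of $\psi$. -/

import Mathlib

open scoped Matrix Kronecker ComplexOrder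

noncomputable section

namespace EquivChannel

/-! ### The unitary groups -/

/-- The unitary group `U(d)`. -/
abbrev U (d : ℕ) : Type := Matrix.unitaryGroup (Fin d) ℂ

/-- The special unitary group `SU(d)`. -/
abbrev SU (d : ℕ) : Type := Matrix.specialUnitaryGroup (Fin d) ℂ

/-- The inclusion `SU(d) → U(d)`. -/
def SU.incl {d : ℕ} : SU d →* U d :=
  Submonoid.inclusion Matrix.specialUnitaryGroup_le_unitaryGroup

/-! ### Staircases and the irreducible representations they label -/

/-- A staircase: integers `γ₁ ≥ γ₂ ≥ ⋯ ≥ γ_d`. -/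
abbrev Staircase (d : ℕ) : Type := {γ : Fin d → ℤ // Antitone γ}

variable {d : ℕ}

/-- The last entry `γ_d` (and `0` if `d = 0`). -/
def Staircase.last (γ : Staircase d) : ℤ :=
  if h : 0 < d then γ.1 ⟨d - 1, by omega⟩ else 0

/-- The `i`-th row length of the partition `γ - (γ_d, …, γ_d)`. -/
def Staircase.rowLen (γ : Staircase d) (i : Fin d) : ℕ := (γ.1 i - γ.last).toNat

/-- The boxes (row, column) of the Young diagram of the partition `γ - (γ_d, …, γ_d)`. -/
abbrev Box (γ : Staircase d) : Type := Σ i : Fin d, Fin (γ.rowLen i)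

/-- The tensor power `(ℂ^d)^{⊗ m}`, with one tensor factor for each of the `m` boxes of
`γ - (γ_d, …, γ_d)`, with its standard inner product and product basis. -/
abbrev Tensor (γ : Staircase d) : Type := EuclideanSpace ℂ (Box γ → Fin d)

/-- The action `g ↦ det(g)^{γ_d} · g^{⊗ m}` of `U(d)` on the tensor power, as matrices. -/
def tensorMat (γ : Staircase d) : U d →* Matrix (Box γ → Fin d) (Box γ → Fin d) ℂ where
  toFun g := Matrix.of fun f f' =>
    (g : Matrix (Fin d) (Fin d) ℂ).det ^ γ.last *
      ∏ x, (g : Matrix (Fin d) (Fin d) ℂ) (f x) (f' x)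
  map_one' := by
    ext f f'
    simp only [OneMemClass.coe_one, Matrix.det_one, one_zpow, one_mul, Matrix.of_apply,
      Matrix.one_apply]
    by_cases h : f = f'
    · simp [h]
    · rw [if_neg h]
      obtain ⟨x, hx⟩ := Function.ne_iff.1 h
      exact Finset.prod_eq_zero (Finset.mem_univ x) (if_neg hx)
  map_mul' g h := by
    ext f f'
    simp only [Matrix.of_apply, Submonoid.coe_mul, Matrix.det_mul, Matrix.mul_apply, mul_zpow,
      Finset.prod_univ_sum, Fintype.piFinset_univ, Finset.mul_sum, Finset.prod_mul_distrib]
    refine Finset.sum_congr rfl fun k _ => ?_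
    ring

/-- The action of `U(d)` on the tensor power, as a representation. -/
def tensorRep (γ : Staircase d) : Representation ℂ (U d) (Tensor γ) where
  toFun g := Matrix.toLpLin 2 2 (tensorMat γ g)
  map_one' := by
    rw [map_one]; exact Matrix.toLpLin_one 2
  map_mul' g h := by
    rw [map_mul]; exact Matrix.toLpLin_mul_same 2 _ _

/-- The highest weight vector: the row tensor `⊗_{x} e_{row x}` antisymmetrized along the columns
of the diagram, i.e. `∑_σ sgn(σ) ⊗_x e_{row (σ x)}`, the sum being over the permutations of the
boxes that preserve every column (the determinant below is this signed sum, read off at the basis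
tensor `⊗_x e_{f x}`). -/
def hwVec (γ : Staircase d) : Tensor γ :=
  WithLp.toLp 2 fun f => Matrix.det (Matrix.of fun x y : Box γ =>
    if (x.2 : ℕ) = (y.2 : ℕ) ∧ f x = y.1 then (1 : ℂ) else 0)

/-- The irreducible representation `Q_γ` with highest weight `γ`: the subspace of the tensor power
generated by the highest weight vector under `U(d)`. -/
def Q (γ : Staircase d) : Submodule ℂ (Tensor γ) :=
  Submodule.span ℂ (Set.range fun g : U d => tensorRep γ g (hwVec γ))

theorem tensorRep_mem_Q (γ : Staircase d) (g : U d) :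
    ∀ v ∈ Q γ, tensorRep γ g v ∈ Q γ := by
  intro v hv
  have : Q γ ≤ (Q γ).comap (tensorRep γ g) := by
    refine Submodule.span_le.2 ?_
    rintro _ ⟨h, rfl⟩
    refine Submodule.subset_span ⟨g * h, ?_⟩
    simp [map_mul]
  exact this hv

/-- The action of `U(d)` on `Q_γ`. -/
def irrep (γ : Staircase d) : Representation ℂ (U d) (Q γ) where
  toFun g := (tensorRep γ g).restrict (tensorRep_mem_Q γ g)
  map_one' := by
    ext v : 2
    simp
  map_mul' g h := by
    ext v : 2
    simp [map_mul]

/-- `dim Q_γ`. -/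
def dimQ (γ : Staircase d) : ℕ := Module.finrank ℂ (Q γ)

/-- A choice of an orthonormal basis in every `Q_γ`. Transposes and complex conjugates are taken
in these bases, and operators are written as matrices in them. -/
abbrev Bases (d : ℕ) : Type :=
  ∀ γ : Staircase d, OrthonormalBasis (Fin (dimQ γ)) ℂ (Q γ)

/-! ### Matrix representations -/

/-- A representation of `U(d)` by matrices. -/
abbrev MatRep (d : ℕ) (n : Type) [Fintype n] [DecidableEq n] : Type :=
  U d →* Matrix n n ℂ

/-- `Q_γ` written in the chosen basis. -/
def rep (b : Bases d) (γ : Staircase d) : MatRep d (Fin (dimQ γ)) where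
  toFun g := LinearMap.toMatrix (b γ).toBasis (b γ).toBasis (irrep γ g)
  map_one' := by rw [map_one]; exact LinearMap.toMatrix_one _
  map_mul' g h := by rw [map_mul]; exact LinearMap.toMatrix_mul _ _ _

variable {m n : Type} [Fintype m] [DecidableEq m] [Fintype n] [DecidableEq n]

/-- The dual (complex conjugate) representation `g ↦ conj (r g)`. -/
def conjRep (R : MatRep d m) : MatRep d m where
  toFun g := (R g).map star
  map_one' := by rw [map_one]; exact Matrix.map_one _ (star_zero ℂ) (star_one ℂ)
  map_mul' g h := by
    rw [map_mul]
    ext i j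
    simp [Matrix.mul_apply]

/-- The tensor product of two representations. -/
def tensor (R : MatRep d m) (S : MatRep d n) : MatRep d (m × n) where
  toFun g := R g ⊗ₖ S g
  map_one' := by rw [map_one, map_one]; exact Matrix.one_kronecker_one
  map_mul' g h := by rw [map_mul, map_mul]; exact Matrix.mul_kronecker_mul _ _ _ _

/-- The space of operators from `R` to `S` that commute with the action of `U(d)`. -/
def intertwiners (R : MatRep d m) (S : MatRep d n) : Submodule ℂ (Matrix n m ℂ) where
  carrier := {M | ∀ g, S g * M = M * R g}
  add_mem' := by
    intro A B hA hB g
    rw [Matrix.mul_add, Matrix.add_mul, hA g, hB g]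
  zero_mem' := by intro g; simp
  smul_mem' := by
    intro c A hA g
    rw [Matrix.mul_smul, Matrix.smul_mul, hA g]

/-- The multiplicity of `Q_γ` in `R ⊗ S`. For `R`, `S` irreducible this is the
Littlewood-Richardson coefficient. Using `U(d)` rather than `SU(d)` here separates the labels `γ`
and `γ + (k, …, k)`, which give isomorphic representations of `SU(d)`. -/
def mult (b : Bases d) (R : MatRep d m) (S : MatRep d n) (γ : Staircase d) : ℕ :=
  Module.finrank ℂ (intertwiners (rep b γ) (tensor R S))

/-- The set of labels `γ` for which `Q_γ` occurs in `R ⊗ S`. -/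
def labels (b : Bases d) (R : MatRep d m) (S : MatRep d n) : Set (Staircase d) :=
  {γ | 1 ≤ mult b R S γ}

/-! ### Clebsch-Gordan transforms -/

/-- A Clebsch-Gordan transform: a unitary
`R ⊗ S → ⨁_γ Q_γ ⊗ ℂ^{c_γ}` commuting with the action of `SU(d)`, where `γ` runs over the (finite)
set `support` of all labels that occur in `R ⊗ S`, and `c_γ` is the multiplicity of `Q_γ`. -/
structure CGTransform (b : Bases d) (R : MatRep d m) (S : MatRep d n) where
  support : Finset (Staircase d)
  mem_support : ∀ γ, γ ∈ support ↔ γ ∈ labels b R S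
  mat : Matrix (Σ γ : support, Fin (dimQ γ.1) × Fin (mult b R S γ.1)) (m × n) ℂ
  mul_conjTranspose : mat * matᴴ = 1
  conjTranspose_mul : matᴴ * mat = 1
  commutes : ∀ g : SU d,
    mat * tensor R S (SU.incl g) =
      Matrix.blockDiagonal' (fun γ : support =>
        rep b γ.1 (SU.incl g) ⊗ₖ (1 : Matrix (Fin (mult b R S γ.1)) (Fin (mult b R S γ.1)) ℂ))
        * mat

/-- The embedding `ι^{γ,ψ} : Q_γ → R ⊗ S`, `q ↦ U_CG^* (q ⊗ ψ)`. -/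
def CGTransform.embed {b : Bases d} {R : MatRep d m} {S : MatRep d n} (T : CGTransform b R S)
    (γ : Staircase d) (ψ : Fin (mult b R S γ) → ℂ) : Matrix (m × n) (Fin (dimQ γ)) ℂ :=
  Matrix.of fun x q => ∑ k, T.matᴴ x ⟨⟨γ, (T.mem_support γ).2 k.pos⟩, (q, k)⟩ * ψ k

/-- The operator `1_{Q_γ} ⊗ |ψ⟩⟨ψ|` on `⨁_γ' Q_γ' ⊗ ℂ^{c_γ'}`, zero on the summands
`γ' ≠ γ`. -/
def CGTransform.block {b : Bases d} {R : MatRep d m} {S : MatRep d n} (T : CGTransform b R S)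
    (γ : Staircase d) (hγ : γ ∈ labels b R S) (ψ : Fin (mult b R S γ) → ℂ) :
    Matrix (Σ γ : T.support, Fin (dimQ γ.1) × Fin (mult b R S γ.1))
      (Σ γ : T.support, Fin (dimQ γ.1) × Fin (mult b R S γ.1)) ℂ :=
  Matrix.blockDiagonal' (Pi.single
    (M := fun γ' : T.support => Matrix (Fin (dimQ γ'.1) × Fin (mult b R S γ'.1))
      (Fin (dimQ γ'.1) × Fin (mult b R S γ'.1)) ℂ)
    ⟨γ, (T.mem_support γ).2 hγ⟩
    ((1 : Matrix (Fin (dimQ γ)) (Fin (dimQ γ)) ℂ) ⊗ₖ Matrix.vecMulVec ψ (star ψ)))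

/-! ### Quantum channels -/

/-- The partial trace over the first tensor factor. -/
def traceFst (X : Matrix (m × n) (m × n) ℂ) : Matrix n n ℂ :=
  Matrix.of fun a a' => ∑ i, X (i, a) (i, a')

/-- The partial trace over the second tensor factor. -/
def traceSnd (X : Matrix (m × n) (m × n) ℂ) : Matrix m m ℂ :=
  Matrix.of fun i i' => ∑ a, X (i, a) (i', a)

/-- Complete positivity: `id_k ⊗ Φ` maps positive operators to positive operators, for all `k`. -/
def IsCP (Φ : Matrix m m ℂ →ₗ[ℂ] Matrix n n ℂ) : Prop :=
  ∀ (k : ℕ) (X : Matrix (Fin k × m) (Fin k × m) ℂ), X.PosSemidef →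
    (Matrix.of fun p q : Fin k × n =>
      Φ (Matrix.of fun i j => X (p.1, i) (q.1, j)) p.2 q.2).PosSemidef

/-- A quantum channel: completely positive and trace preserving. -/
def IsChannel (Φ : Matrix m m ℂ →ₗ[ℂ] Matrix n n ℂ) : Prop :=
  IsCP Φ ∧ ∀ A, (Φ A).trace = A.trace

/-- The set of `SU(d)`-equivariant quantum channels from `R` to `S`. -/
def equivariantChannels (R : MatRep d m) (S : MatRep d n) :
    Set (Matrix m m ℂ →ₗ[ℂ] Matrix n n ℂ) :=
  {Φ | IsChannel Φ ∧ ∀ (g : SU d) (A : Matrix m m ℂ),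
    Φ (R (SU.incl g) * A * (R (SU.incl g))ᴴ) = S (SU.incl g) * Φ A * (S (SU.incl g))ᴴ}

/-- The Choi matrix `∑_{ij} |i⟩⟨j| ⊗ Φ(|i⟩⟨j|)`. -/
def choi (Φ : Matrix m m ℂ →ₗ[ℂ] Matrix n n ℂ) : Matrix (m × n) (m × n) ℂ :=
  ∑ i, ∑ j, Matrix.single i j (1 : ℂ) ⊗ₖ Φ (Matrix.single i j 1)

/-- The linear map with a given Choi matrix. -/
def ofChoi (C : Matrix (m × n) (m × n) ℂ) : Matrix m m ℂ →ₗ[ℂ] Matrix n n ℂ where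
  toFun A := Matrix.of fun a a' => ∑ i, ∑ j, A i j * C (i, a) (j, a')
  map_add' A B := by
    ext a a'
    simp [add_mul, Finset.sum_add_distrib]
  map_smul' c A := by
    ext a a'
    simp [mul_assoc, Finset.mul_sum]

theorem choi_ofChoi (C : Matrix (m × n) (m × n) ℂ) : choi (ofChoi C) = C := by
  ext ⟨i, a⟩ ⟨j, a'⟩
  simp [choi, ofChoi, Matrix.sum_apply, Matrix.single_apply, ite_and]

theorem ofChoi_choi (Φ : Matrix m m ℂ →ₗ[ℂ] Matrix n n ℂ) : ofChoi (choi Φ) = Φ := by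
  refine Matrix.ext_linearMap _ fun i j => ?_
  ext a a'
  simp [choi, ofChoi, Matrix.sum_apply, Matrix.single_apply, ite_and]

/-- The map `Φ_{λ,μ}^{γ,ψ}`, defined through its Choi matrix
`(dim Q_λ / dim Q_γ) · U_CG^* (1_{Q_γ} ⊗ |ψ⟩⟨ψ|) U_CG`, where `U_CG = T` is a Clebsch-Gordan
transform of `conj Q_λ ⊗ Q_μ`. -/
def extremalMap {b : Bases d} {lam mu : Staircase d}
    (T : CGTransform b (conjRep (rep b lam)) (rep b mu))
    (γ : Staircase d) (hγ : γ ∈ labels b (conjRep (rep b lam)) (rep b mu))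
    (ψ : Fin (mult b (conjRep (rep b lam)) (rep b mu) γ) → ℂ) :
    Matrix (Fin (dimQ lam)) (Fin (dimQ lam)) ℂ →ₗ[ℂ] Matrix (Fin (dimQ mu)) (Fin (dimQ mu)) ℂ :=
  ofChoi (((dimQ lam : ℂ) / (dimQ γ : ℂ)) • (T.matᴴ * T.block γ hγ ψ * T.mat))

end EquivChannel

end

open scoped Matrix Kronecker ComplexOrder

noncomputable section

set_option linter.unusedSectionVars false

namespace EquivChannel

variable {d : ℕ} {m n : Type} [Fintype m] [DecidableEq m] [Fintype n] [DecidableEq n]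

/-! ### One-parameter subgroups and differentiated representations -/

/-- The one-parameter subgroup `t ↦ exp (t X)` of `U(d)` with skew-Hermitian generator `X`. -/
def oneParam (X : Matrix (Fin d) (Fin d) ℂ) (hX : Xᴴ = -X) (t : ℝ) : U d :=
  ⟨NormedSpace.exp (t • X), by
    have hc : Commute (t • X) (-(t • X)) := (Commute.refl _).neg_right
    rw [Matrix.mem_unitaryGroup_iff, Matrix.star_eq_conjTranspose, ← Matrix.exp_conjTranspose,
      Matrix.conjTranspose_smul, hX, star_trivial, smul_neg,
      ← Matrix.exp_add_of_commute _ _ hc, add_neg_cancel, NormedSpace.exp_zero]⟩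

theorem oneParam_coe (X : Matrix (Fin d) (Fin d) ℂ) (hX : Xᴴ = -X) (t : ℝ) :
    (oneParam X hX t : Matrix (Fin d) (Fin d) ℂ) = NormedSpace.exp (t • X) := rfl

theorem oneParam_add (X : Matrix (Fin d) (Fin d) ℂ) (hX : Xᴴ = -X) (s t : ℝ) :
    oneParam X hX (s + t) = oneParam X hX s * oneParam X hX t := by
  apply Subtype.ext
  rw [Submonoid.coe_mul, oneParam_coe, oneParam_coe, oneParam_coe, add_smul]
  exact Matrix.exp_add_of_commute _ _ (((Commute.refl X).smul_left s).smul_right t)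

theorem oneParam_zero (X : Matrix (Fin d) (Fin d) ℂ) (hX : Xᴴ = -X) :
    oneParam X hX 0 = 1 := by
  apply Subtype.ext
  rw [oneParam_coe, zero_smul, NormedSpace.exp_zero]; rfl

open scoped Matrix.Norms.Operator in
theorem hasDerivAt_exp_smul_apply (A : Matrix n n ℂ) (t : ℝ) (i j : n) :
    HasDerivAt (fun t : ℝ => NormedSpace.exp (t • A) i j)
      ((A * NormedSpace.exp (t • A)) i j) t := by
  have h := hasDerivAt_exp_smul_const' (𝕂 := ℝ) A t
  let L : Matrix n n ℂ →L[ℝ] ℂ := LinearMap.toContinuousLinearMap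
    { toFun := fun M => M i j, map_add' := fun _ _ => rfl, map_smul' := fun _ _ => rfl }
  exact L.hasFDerivAt.comp_hasDerivAt t h

theorem hasDerivAt_mul_apply {l p q : Type} [Fintype p] {A : ℝ → Matrix l p ℂ}
    {B : ℝ → Matrix p q ℂ} {A' : Matrix l p ℂ} {B' : Matrix p q ℂ} {t : ℝ}
    (hA : ∀ i j, HasDerivAt (fun s => A s i j) (A' i j) t)
    (hB : ∀ i j, HasDerivAt (fun s => B s i j) (B' i j) t) (i : l) (j : q) :
    HasDerivAt (fun s => (A s * B s) i j) ((A' * B t + A t * B') i j) t := by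
  have h : HasDerivAt (fun s => ∑ k, A s i k * B s k j)
      (∑ k, (A' i k * B t k j + A t i k * B' k j)) t :=
    HasDerivAt.fun_sum fun k _ => (hA i k).mul (hB k j)
  rw [Finset.sum_add_distrib, ← Matrix.mul_apply, ← Matrix.mul_apply, ← Matrix.add_apply] at h
  exact h.congr_of_eventuallyEq (Filter.Eventually.of_forall fun s => Matrix.mul_apply)

theorem hasDerivAt_linearMap_comp {p q : Type} [Fintype p] [Fintype q] [DecidableEq p]
    [DecidableEq q] (L : Matrix p q ℂ →ₗ[ℂ] ℂ) {A : ℝ → Matrix p q ℂ} {A' : Matrix p q ℂ} {t : ℝ}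
    (hA : ∀ i j, HasDerivAt (fun s => A s i j) (A' i j) t) :
    HasDerivAt (fun s => L (A s)) (L A') t := by
  have e : ∀ M : Matrix p q ℂ, L M = ∑ i, ∑ j, M i j * L (Matrix.single i j 1) := by
    intro M
    conv_lhs => rw [Matrix.matrix_eq_sum_single M]
    simp only [map_sum]
    refine Finset.sum_congr rfl fun i _ => Finset.sum_congr rfl fun j _ => ?_
    rw [← smul_eq_mul, ← map_smul, Matrix.smul_single, smul_eq_mul, mul_one]
  rw [e A', show (fun s => L (A s)) = _ from funext fun s => e (A s)]
  exact HasDerivAt.fun_sum fun i _ => HasDerivAt.fun_sum fun j _ => (hA i j).mul_const _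

open scoped Matrix.Norms.L2Operator in
theorem exists_exp_eq_of_unitary (g : U d) :
    ∃ X : Matrix (Fin d) (Fin d) ℂ, Xᴴ = -X ∧ NormedSpace.exp X = g := by
  have hn : IsStarNormal (g : Matrix (Fin d) (Fin d) ℂ) := by
    constructor
    rw [Commute, SemiconjBy, Matrix.mem_unitaryGroup_iff.1 g.2, Matrix.mem_unitaryGroup_iff'.1 g.2]
  have hfin : (spectrum ℂ (g : Matrix (Fin d) (Fin d) ℂ)).Finite := Matrix.finite_spectrum _
  have hc : ∀ f : ℂ → ℂ, ContinuousOn f (spectrum ℂ (g : Matrix (Fin d) (Fin d) ℂ)) :=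
    fun f => hfin.continuousOn f
  refine ⟨cfc (fun z : ℂ => (z.arg : ℂ) * Complex.I) (g : Matrix (Fin d) (Fin d) ℂ), ?_, ?_⟩
  · rw [← Matrix.star_eq_conjTranspose, ← cfc_star, ← cfc_neg]
    congr 1
    funext z
    simp
  · rw [← CFC.complex_exp_eq_normedSpace_exp,
      ← cfc_comp' Complex.exp _ _ Complex.continuous_exp.continuousOn (hc _)]
    conv_rhs => rw [← cfc_id' ℂ (g : Matrix (Fin d) (Fin d) ℂ)]
    refine cfc_congr fun z hz => ?_
    have hz1 : ‖z‖ = 1 := by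
      have := Unitary.spectrum_subset_circle (𝕜 := ℂ) g hz
      simpa using this
    have := Complex.norm_mul_exp_arg_mul_I z
    rw [hz1] at this
    simpa using this

/-- Every unitary matrix is the exponential of a skew-Hermitian matrix. -/
theorem exists_oneParam_eq (g : U d) :
    ∃ (X : Matrix (Fin d) (Fin d) ℂ) (hX : Xᴴ = -X), oneParam X hX 1 = g := by
  obtain ⟨X, hX, h⟩ := exists_exp_eq_of_unitary g
  exact ⟨X, hX, Subtype.ext (by rw [oneParam_coe, one_smul, h])⟩

open scoped Matrix.Norms.Operator in
theorem hasSum_exp_mulVec (A : Matrix n n ℂ) (v : n → ℂ) :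
    HasSum (fun k : ℕ => ((k.factorial : ℂ)⁻¹) • ((A ^ k) *ᵥ v)) (NormedSpace.exp A *ᵥ v) := by
  have h := NormedSpace.exp_series_hasSum_exp' (𝕂 := ℂ) A
  let L : Matrix n n ℂ →L[ℂ] (n → ℂ) := LinearMap.toContinuousLinearMap
    { toFun := fun M => M *ᵥ v, map_add' := fun _ _ => Matrix.add_mulVec _ _ _,
      map_smul' := fun _ _ => Matrix.smul_mulVec _ _ _ }
  have h2 := L.hasSum h
  have e : ∀ k : ℕ, L (((k.factorial : ℂ)⁻¹) • (A ^ k)) =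
    ((k.factorial : ℂ)⁻¹) • ((A ^ k) *ᵥ v) := fun k => Matrix.smul_mulVec _ _ _
  simp only [e] at h2
  exact h2

theorem exp_mulVec_mem {V : Submodule ℂ (n → ℂ)} {A : Matrix n n ℂ}
    (hA : ∀ v ∈ V, A *ᵥ v ∈ V) {v : n → ℂ} (hv : v ∈ V) : NormedSpace.exp A *ᵥ v ∈ V := by
  have hp : ∀ k : ℕ, A ^ k *ᵥ v ∈ V := by
    intro k
    induction k with
    | zero => simpa using hv
    | succ k ih => rw [pow_succ', ← Matrix.mulVec_mulVec]; exact hA _ ih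
  have hcl : IsClosed (V : Set (n → ℂ)) := V.closed_of_finiteDimensional
  exact hcl.mem_of_tendsto (hasSum_exp_mulVec A v)
    (Filter.Eventually.of_forall fun s => V.sum_mem fun k _ => V.smul_mem _ (hp k))

theorem exp_mulVec_of_eigenvector {A : Matrix n n ℂ} {v : n → ℂ} {a : ℂ}
    (hv : A *ᵥ v = a • v) : NormedSpace.exp A *ᵥ v = Complex.exp a • v := by
  have hp : ∀ k : ℕ, A ^ k *ᵥ v = a ^ k • v := by
    intro k
    induction k with
    | zero => simp
    | succ k ih =>
      rw [pow_succ, ← Matrix.mulVec_mulVec, hv, Matrix.mulVec_smul, ih, smul_smul, pow_succ']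
  have h1 := hasSum_exp_mulVec A v
  simp only [hp, smul_smul] at h1
  have h2 : HasSum (fun k : ℕ => ((k.factorial : ℂ)⁻¹ * a ^ k)) (Complex.exp a) := by
    have := NormedSpace.exp_series_hasSum_exp' (𝕂 := ℂ) a
    rw [← Complex.exp_eq_exp_ℂ] at this
    simpa using this
  exact h1.unique (h2.smul_const v)

/-- `D` is the derivative at the identity, extended complex linearly, of the unitary
representation `R`. -/
structure Differentiates (R : MatRep d n)
    (D : Matrix (Fin d) (Fin d) ℂ →ₗ[ℂ] Matrix n n ℂ) : Prop where
  unitary : ∀ g, (R g)ᴴ * R g = 1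
  hasDerivAt : ∀ (X : Matrix (Fin d) (Fin d) ℂ) (hX : Xᴴ = -X) (i j : n),
    HasDerivAt (fun t : ℝ => R (oneParam X hX t) i j) (D X i j) 0

theorem exists_skew_decomposition (Y : Matrix (Fin d) (Fin d) ℂ) :
    ∃ A B : Matrix (Fin d) (Fin d) ℂ, Aᴴ = -A ∧ Bᴴ = -B ∧ Y = A + Complex.I • B := by
  refine ⟨(1 / 2 : ℂ) • (Y - Yᴴ), (-(Complex.I / 2)) • (Y + Yᴴ), ?_, ?_, ?_⟩
  · ext i j; simp; ring
  · ext i j; simp; ring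
  · ext i j
    simp only [Matrix.add_apply, Matrix.smul_apply, Matrix.sub_apply, smul_eq_mul]
    ring_nf
    simp only [Complex.I_sq]
    ring

namespace Differentiates

variable {R : MatRep d n} {D : Matrix (Fin d) (Fin d) ℂ →ₗ[ℂ] Matrix n n ℂ}

theorem hasDerivAt_at (h : Differentiates R D) (X : Matrix (Fin d) (Fin d) ℂ) (hX : Xᴴ = -X)
    (t : ℝ) (i j : n) :
    HasDerivAt (fun t : ℝ => R (oneParam X hX t) i j) ((R (oneParam X hX t) * D X) i j) t := by
  have h1 : HasDerivAt (fun s : ℝ => ∑ k, R (oneParam X hX t) i k * R (oneParam X hX s) k j)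
      (∑ k, R (oneParam X hX t) i k * D X k j) 0 :=
    HasDerivAt.fun_sum fun k _ => (h.hasDerivAt X hX k j).const_mul _
  have h2 : HasDerivAt (fun s : ℝ => s - t) 1 t := (hasDerivAt_id t).sub_const t
  have h3 := HasDerivAt.scomp_of_eq t h1 h2 (sub_self t).symm
  rw [one_smul] at h3
  refine h3.congr_of_eventuallyEq (Filter.Eventually.of_forall fun s => ?_)
  have : s = t + (s - t) := by ring
  simp only [Function.comp]
  conv_lhs => rw [this, oneParam_add, map_mul, Matrix.mul_apply]

theorem map_oneParam (h : Differentiates R D) (X : Matrix (Fin d) (Fin d) ℂ) (hX : Xᴴ = -X)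
    (t : ℝ) : R (oneParam X hX t) = NormedSpace.exp (t • D X) := by
  have key : ∀ t : ℝ, R (oneParam X hX t) * NormedSpace.exp (t • (-D X)) = 1 := by
    intro t
    ext i j
    have hd : ∀ s : ℝ, HasDerivAt
        (fun s : ℝ => (R (oneParam X hX s) * NormedSpace.exp (s • (-D X))) i j) 0 s := by
      intro s
      have h1 : HasDerivAt
          (fun s : ℝ => ∑ k, R (oneParam X hX s) i k * NormedSpace.exp (s • (-D X)) k j)
          (∑ k, ((R (oneParam X hX s) * D X) i k * NormedSpace.exp (s • (-D X)) k j +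
            R (oneParam X hX s) i k * ((-D X) * NormedSpace.exp (s • (-D X))) k j)) s :=
        HasDerivAt.fun_sum fun k _ =>
          (h.hasDerivAt_at X hX s i k).mul (hasDerivAt_exp_smul_apply (-D X) s k j)
      have h2 : (∑ k, ((R (oneParam X hX s) * D X) i k * NormedSpace.exp (s • (-D X)) k j +
            R (oneParam X hX s) i k * ((-D X) * NormedSpace.exp (s • (-D X))) k j)) = 0 := by
        rw [Finset.sum_add_distrib, ← Matrix.mul_apply, ← Matrix.mul_apply, ← Matrix.add_apply]
        simp [Matrix.mul_assoc]
      rw [h2] at h1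
      exact h1.congr_of_eventuallyEq (Filter.Eventually.of_forall fun s => Matrix.mul_apply)
    have hc := is_const_of_deriv_eq_zero (fun s => (hd s).differentiableAt)
      (fun s => (hd s).deriv) t 0
    rw [hc]
    simp [oneParam_zero]
  have h1 := key t
  have h2 : NormedSpace.exp (t • (-D X)) * NormedSpace.exp (t • D X) = 1 := by
    rw [← Matrix.exp_add_of_commute, smul_neg, neg_add_cancel, NormedSpace.exp_zero]
    exact ((Commute.neg_left (Commute.refl _)).smul_left t).smul_right t
  calc R (oneParam X hX t)
      = R (oneParam X hX t) * (NormedSpace.exp (t • (-D X)) * NormedSpace.exp (t • D X)) := by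
        rw [h2, mul_one]
    _ = _ := by rw [← mul_assoc, h1, one_mul]

theorem map_conjTranspose (h : Differentiates R D) (Y : Matrix (Fin d) (Fin d) ℂ) :
    D Yᴴ = (D Y)ᴴ := by
  have skew : ∀ X : Matrix (Fin d) (Fin d) ℂ, Xᴴ = -X → (D X)ᴴ = -D X := by
    intro X hX
    ext i j
    have h1 : HasDerivAt (fun t : ℝ => star (R (oneParam X hX t) j i)) (star (D X j i)) 0 :=
      (h.hasDerivAt X hX j i).star
    have h2 : HasDerivAt (fun t : ℝ => R (oneParam X hX (-t)) i j) ((-1 : ℝ) • D X i j) 0 :=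
      HasDerivAt.scomp_of_eq (0 : ℝ) (h.hasDerivAt X hX i j) (hasDerivAt_neg 0) neg_zero.symm
    have h3 : (fun t : ℝ => star (R (oneParam X hX t) j i)) =
        fun t : ℝ => R (oneParam X hX (-t)) i j := by
      funext t
      have e : R (oneParam X hX (-t)) = (R (oneParam X hX t))ᴴ := by
        have e1 : R (oneParam X hX t) * R (oneParam X hX (-t)) = 1 := by
          rw [← map_mul, ← oneParam_add, add_neg_cancel, oneParam_zero, map_one]
        calc _ = (R (oneParam X hX t))ᴴ * R (oneParam X hX t) * R (oneParam X hX (-t)) := by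
              rw [h.unitary, one_mul]
          _ = _ := by rw [mul_assoc, e1, mul_one]
      rw [e]; rfl
    rw [h3] at h1
    have := h1.unique h2
    simpa using this
  obtain ⟨A, B, hA, hB, rfl⟩ := exists_skew_decomposition Y
  simp only [Matrix.conjTranspose_add, Matrix.conjTranspose_smul, hA, hB, map_add, map_smul,
    map_neg, skew A hA, skew B hB]

theorem map_conj (h : Differentiates R D) (g : U d) (Y : Matrix (Fin d) (Fin d) ℂ)
    (hY : Yᴴ = -Y) :
    D ((g : Matrix (Fin d) (Fin d) ℂ) * Y * ((g⁻¹ : U d) : Matrix (Fin d) (Fin d) ℂ)) =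
      R g * D Y * R g⁻¹ := by
  have hgi : ((g⁻¹ : U d) : Matrix (Fin d) (Fin d) ℂ) = (g : Matrix (Fin d) (Fin d) ℂ)ᴴ := rfl
  have hg1 : (g : Matrix (Fin d) (Fin d) ℂ)ᴴ * (g : Matrix (Fin d) (Fin d) ℂ) = 1 :=
    Matrix.mem_unitaryGroup_iff'.1 g.2
  have hg2 : (g : Matrix (Fin d) (Fin d) ℂ) * (g : Matrix (Fin d) (Fin d) ℂ)ᴴ = 1 :=
    Matrix.mem_unitaryGroup_iff.1 g.2
  have hZ : ((g : Matrix (Fin d) (Fin d) ℂ) * Y * ((g⁻¹ : U d) : Matrix (Fin d) (Fin d) ℂ))ᴴ =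
      -((g : Matrix (Fin d) (Fin d) ℂ) * Y * ((g⁻¹ : U d) : Matrix (Fin d) (Fin d) ℂ)) := by
    rw [hgi]
    simp [Matrix.conjTranspose_mul, hY, mul_assoc]
  have e : ∀ t, oneParam _ hZ t = g * oneParam Y hY t * g⁻¹ := by
    intro t
    apply Subtype.ext
    rw [oneParam_coe, Submonoid.coe_mul, Submonoid.coe_mul, oneParam_coe, hgi]
    have hinv : (g : Matrix (Fin d) (Fin d) ℂ)⁻¹ = (g : Matrix (Fin d) (Fin d) ℂ)ᴴ :=
      Matrix.inv_eq_right_inv hg2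
    rw [← hinv, ← Matrix.exp_conj _ _ (IsUnit.of_mul_eq_one _ hg2)]
    simp
  ext i j
  have h1 := h.hasDerivAt _ hZ i j
  simp only [e, map_mul] at h1
  refine h1.unique ?_
  have h2 : HasDerivAt (fun t : ℝ => ∑ l, (∑ k, R g i k * R (oneParam Y hY t) k l) * R g⁻¹ l j)
      (∑ l, (∑ k, R g i k * D Y k l) * R g⁻¹ l j) 0 :=
    HasDerivAt.fun_sum fun l _ => (HasDerivAt.fun_sum fun k _ =>
      (h.hasDerivAt Y hY k l).const_mul _).mul_const _
  simpa only [← Matrix.mul_apply] using h2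

theorem map_commutator (h : Differentiates R D) (X Y : Matrix (Fin d) (Fin d) ℂ) :
    D (X * Y - Y * X) = D X * D Y - D Y * D X := by
  have skew : ∀ X Y : Matrix (Fin d) (Fin d) ℂ, Xᴴ = -X → Yᴴ = -Y →
      D (X * Y - Y * X) = D X * D Y - D Y * D X := by
    intro X Y hX hY
    have hinv : ∀ t, (oneParam X hX t)⁻¹ = oneParam X hX (-t) := by
      intro t
      rw [inv_eq_iff_mul_eq_one, ← oneParam_add, add_neg_cancel, oneParam_zero]
    have d1 : ∀ i j, HasDerivAt
        (fun t : ℝ => (oneParam X hX t : Matrix (Fin d) (Fin d) ℂ) i j) (X i j) 0 := by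
      intro i j
      have := hasDerivAt_exp_smul_apply X 0 i j
      rwa [zero_smul, NormedSpace.exp_zero, mul_one] at this
    have d2 : ∀ i j, HasDerivAt
        (fun t : ℝ => (oneParam X hX (-t) : Matrix (Fin d) (Fin d) ℂ) i j) ((-X) i j) 0 := by
      intro i j
      have := HasDerivAt.scomp_of_eq (0 : ℝ) (d1 i j) (hasDerivAt_neg 0) neg_zero.symm
      rw [neg_one_smul] at this
      exact this
    have d3 : ∀ i j, HasDerivAt
        (fun t : ℝ => R (oneParam X hX (-t)) i j) ((-D X) i j) 0 := by
      intro i j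
      have := HasDerivAt.scomp_of_eq (0 : ℝ) (h.hasDerivAt X hX i j) (hasDerivAt_neg 0)
        neg_zero.symm
      rw [neg_one_smul] at this
      exact this
    have d4 := hasDerivAt_mul_apply (hasDerivAt_mul_apply d1
      (B := fun _ => Y) (B' := 0) fun i j => hasDerivAt_const _ _) d2
    have d5 := hasDerivAt_mul_apply (hasDerivAt_mul_apply (h.hasDerivAt X hX)
      (B := fun _ => D Y) (B' := 0) fun i j => hasDerivAt_const _ _) d3
    ext i j
    have d6 := hasDerivAt_linearMap_comp (Matrix.entryLinearMap ℂ ℂ i j ∘ₗ D) d4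
    have d7 := d5 i j
    have e : (fun s => (Matrix.entryLinearMap ℂ ℂ i j ∘ₗ D)
        ((oneParam X hX s : Matrix (Fin d) (Fin d) ℂ) * Y * (oneParam X hX (-s)))) =
        fun s => (R (oneParam X hX s) * D Y * R (oneParam X hX (-s))) i j := by
      funext s
      rw [← hinv, ← h.map_conj _ Y hY]
      rfl
    rw [e] at d6
    have := d6.unique d7
    simpa [oneParam_zero, ← sub_eq_add_neg] using this
  obtain ⟨A, B, hA, hB, rfl⟩ := exists_skew_decomposition X
  obtain ⟨A', B', hA', hB', rfl⟩ := exists_skew_decomposition Y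
  have e : ∀ {l : Type} [Fintype l] (P Q S T : Matrix l l ℂ),
      (P + Complex.I • Q) * (S + Complex.I • T) - (S + Complex.I • T) * (P + Complex.I • Q) =
      (P * S - S * P) + Complex.I • (P * T - T * P) + Complex.I • (Q * S - S * Q) -
        (Q * T - T * Q) := by
    intro l _ P Q S T
    simp only [Matrix.add_mul, Matrix.mul_add, Matrix.smul_mul, Matrix.mul_smul, smul_add, smul_sub,
      smul_smul, Complex.I_mul_I, neg_smul, one_smul]
    abel
  rw [e]
  simp only [map_add, map_sub, map_smul]
  rw [e]
  simp only [← map_sub, skew A A' hA hA', skew A B' hA hB', skew B A' hB hA', skew B B' hB hB']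

theorem intertwines {R' : MatRep d m} {D' : Matrix (Fin d) (Fin d) ℂ →ₗ[ℂ] Matrix m m ℂ}
    (h : Differentiates R D) (h' : Differentiates R' D') {M : Matrix m n ℂ}
    (hM : M ∈ intertwiners R R') (X : Matrix (Fin d) (Fin d) ℂ) : D' X * M = M * D X := by
  have skew : ∀ X : Matrix (Fin d) (Fin d) ℂ, Xᴴ = -X → D' X * M = M * D X := by
    intro X hX
    have d1 := hasDerivAt_mul_apply (h'.hasDerivAt X hX) (B := fun _ => M) (B' := 0)
      fun i j => hasDerivAt_const _ _
    have d2 := hasDerivAt_mul_apply (A := fun _ : ℝ => M) (A' := 0)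
      (fun i j => hasDerivAt_const _ _) (h.hasDerivAt X hX)
    ext i j
    have d3 := d1 i j
    simp only [hM _] at d3
    simpa using d3.unique (d2 i j)
  obtain ⟨A, B, hA, hB, rfl⟩ := exists_skew_decomposition X
  simp only [map_add, map_smul, Matrix.add_mul, Matrix.mul_add, Matrix.smul_mul, Matrix.mul_smul,
    skew A hA, skew B hB]

theorem stable_of_forall_deriv (h : Differentiates R D) {V : Submodule ℂ (n → ℂ)}
    (hV : ∀ X, ∀ v ∈ V, D X *ᵥ v ∈ V) (g : U d) : ∀ v ∈ V, R g *ᵥ v ∈ V := by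
  obtain ⟨X, hX, rfl⟩ := exists_oneParam_eq g
  rw [h.map_oneParam, one_smul]
  exact fun v hv => exp_mulVec_mem (hV X) hv

theorem deriv_stable (h : Differentiates R D) {V : Submodule ℂ (n → ℂ)}
    (hV : ∀ g, ∀ v ∈ V, R g *ᵥ v ∈ V) (X : Matrix (Fin d) (Fin d) ℂ) :
    ∀ v ∈ V, D X *ᵥ v ∈ V := by
  have skew : ∀ X : Matrix (Fin d) (Fin d) ℂ, Xᴴ = -X → ∀ v ∈ V, D X *ᵥ v ∈ V := by
    intro X hX v hv
    by_contra hn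
    obtain ⟨f, hf, hle⟩ := Submodule.exists_le_ker_of_notMem hn
    let L : Matrix n n ℂ →ₗ[ℂ] ℂ := f ∘ₗ
      { toFun := fun M => M *ᵥ v, map_add' := fun _ _ => Matrix.add_mulVec _ _ _,
        map_smul' := fun _ _ => Matrix.smul_mulVec _ _ _ }
    have d1 := hasDerivAt_linearMap_comp L (h.hasDerivAt X hX)
    have e : (fun s : ℝ => L (R (oneParam X hX s))) = fun _ => 0 :=
      funext fun s => hle (hV _ v hv)
    rw [e] at d1
    exact hf (d1.unique (hasDerivAt_const _ _))
  intro v hv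
  obtain ⟨A, B, hA, hB, rfl⟩ := exists_skew_decomposition X
  rw [map_add, map_smul, Matrix.add_mulVec, Matrix.smul_mulVec]
  exact V.add_mem (skew A hA v hv) (V.smul_mem _ (skew B hB v hv))

end Differentiates

/-! ### The differentiated tensor representation and its highest weight vector -/

/-- The derivative of `tensorMat γ`. -/
def tensorDeriv (γ : Staircase d) :
    Matrix (Fin d) (Fin d) ℂ →ₗ[ℂ] Matrix (Box γ → Fin d) (Box γ → Fin d) ℂ where
  toFun X := Matrix.of fun f f' => (if f = f' then (γ.last : ℂ) * X.trace else 0) +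
    ∑ x, ∑ k, if f' = Function.update f x k then X (f x) k else 0
  map_add' X Y := by
    ext f f'
    simp only [Matrix.of_apply, Matrix.add_apply, Matrix.trace_add]
    rw [add_add_add_comm, ← Finset.sum_add_distrib]
    congr 1
    · split_ifs <;> ring
    · refine Finset.sum_congr rfl fun x _ => ?_
      rw [← Finset.sum_add_distrib]
      refine Finset.sum_congr rfl fun k _ => ?_
      split_ifs <;> simp
  map_smul' c X := by
    ext f f'
    simp only [Matrix.of_apply, Matrix.smul_apply, Matrix.trace_smul, smul_eq_mul,
      RingHom.id_apply, mul_add, Finset.mul_sum, mul_ite, mul_zero, mul_left_comm c]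

theorem hasDerivAt_det_oneParam (X : Matrix (Fin d) (Fin d) ℂ) (hX : Xᴴ = -X) :
    HasDerivAt (fun t : ℝ => (oneParam X hX t : Matrix (Fin d) (Fin d) ℂ).det) X.trace 0 := by
  have d1 : ∀ i j, HasDerivAt
      (fun t : ℝ => (oneParam X hX t : Matrix (Fin d) (Fin d) ℂ) i j) (X i j) 0 := by
    intro i j
    have := hasDerivAt_exp_smul_apply X 0 i j
    rwa [zero_smul, NormedSpace.exp_zero, mul_one] at this
  simp only [Matrix.det_apply']
  have h : HasDerivAt (fun t : ℝ => ∑ σ : Equiv.Perm (Fin d), ((Equiv.Perm.sign σ : ℤ) : ℂ) *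
      ∏ i, (oneParam X hX t : Matrix (Fin d) (Fin d) ℂ) (σ i) i)
      (∑ σ : Equiv.Perm (Fin d), ((Equiv.Perm.sign σ : ℤ) : ℂ) *
      ∑ i, (∏ j ∈ Finset.univ.erase i,
        (oneParam X hX 0 : Matrix (Fin d) (Fin d) ℂ) (σ j) j) • X (σ i) i) 0 :=
    HasDerivAt.fun_sum fun σ _ =>
      (HasDerivAt.fun_finsetProd fun i _ => d1 (σ i) i).const_mul _
  convert h using 1
  rw [Finset.sum_eq_single 1]
  · simp [oneParam_zero, Matrix.trace]
  · intro σ _ hσ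
    refine mul_eq_zero_of_right _ (Finset.sum_eq_zero fun i _ => ?_)
    have : ∃ j, j ≠ i ∧ σ j ≠ j := by
      by_contra hn
      push Not at hn
      refine hσ (Equiv.ext fun k => ?_)
      by_cases hk : k = i
      · subst hk
        by_contra hne
        exact hne (σ.injective (hn (σ k) hne))
      · exact hn k hk
    obtain ⟨j, hj, hσj⟩ := this
    rw [Finset.prod_eq_zero (i := j) (by simpa using hj)
      (by simp [oneParam_zero, Matrix.one_apply_ne hσj]), zero_smul]
  · simp

theorem tensorMat_unitary (γ : Staircase d) (g : U d) :
    (tensorMat γ g)ᴴ * tensorMat γ g = 1 := by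
  have e : (tensorMat γ g)ᴴ = tensorMat γ g⁻¹ := by
    ext f f'
    have hgi : ((g⁻¹ : U d) : Matrix (Fin d) (Fin d) ℂ) = (g : Matrix (Fin d) (Fin d) ℂ)ᴴ := rfl
    simp [tensorMat, hgi, Matrix.det_conjTranspose]
  rw [e, ← map_mul, inv_mul_cancel, map_one]

theorem differentiates_tensorMat (γ : Staircase d) :
    Differentiates (tensorMat γ) (tensorDeriv γ) where
  unitary := tensorMat_unitary γ
  hasDerivAt X hX f f' := by
    have d1 : ∀ i j, HasDerivAt
        (fun t : ℝ => (oneParam X hX t : Matrix (Fin d) (Fin d) ℂ) i j) (X i j) 0 := by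
      intro i j
      have := hasDerivAt_exp_smul_apply X 0 i j
      rwa [zero_smul, NormedSpace.exp_zero, mul_one] at this
    have d2 : HasDerivAt (fun t : ℝ => (oneParam X hX t : Matrix (Fin d) (Fin d) ℂ).det ^ γ.last)
        ((γ.last : ℂ) * X.trace) 0 := by
      have h0 : (oneParam X hX 0 : Matrix (Fin d) (Fin d) ℂ).det = 1 := by
        simp [oneParam_zero]
      have := HasDerivAt.comp_of_eq (0 : ℝ) (hasDerivAt_zpow γ.last (1 : ℂ) (Or.inl one_ne_zero))
        (hasDerivAt_det_oneParam X hX) h0.symm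
      rw [one_zpow, mul_one] at this
      exact this
    have d3 : HasDerivAt (fun t : ℝ => ∏ x, (oneParam X hX t : Matrix (Fin d) (Fin d) ℂ)
        (f x) (f' x)) (∑ x, (∏ y ∈ Finset.univ.erase x,
        (oneParam X hX 0 : Matrix (Fin d) (Fin d) ℂ) (f y) (f' y)) • X (f x) (f' x)) 0 :=
      HasDerivAt.fun_finsetProd fun x _ => d1 (f x) (f' x)
    refine (d2.mul d3).congr_deriv ?_
    symm
    have hp : ∀ s : Finset (Box γ), ∏ y ∈ s,
        (oneParam X hX 0 : Matrix (Fin d) (Fin d) ℂ) (f y) (f' y) =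
        if ∀ y ∈ s, f y = f' y then 1 else 0 := by
      intro s
      rw [oneParam_zero]
      split_ifs with h
      · exact Finset.prod_eq_one fun y hy => by simp [h y hy]
      · push Not at h
        obtain ⟨y, hy, hne⟩ := h
        exact Finset.prod_eq_zero hy (by simp [Matrix.one_apply_ne hne])
    simp only [hp]
    have h0 : (oneParam X hX 0 : Matrix (Fin d) (Fin d) ℂ).det = 1 := by
      simp [oneParam_zero]
    simp only [tensorDeriv, LinearMap.coe_mk, AddHom.coe_mk, Matrix.of_apply, h0, one_zpow, one_mul]
    congr 1
    · simp [funext_iff]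
    · refine Finset.sum_congr rfl fun x _ => ?_
      rw [Finset.sum_eq_single (f' x)]
      · have : f' = Function.update f x (f' x) ↔ ∀ y ∈ Finset.univ.erase x, f y = f' y := by
          rw [Function.eq_update_iff]
          simp [eq_comm]
        simp [this]
      · intro k _ hk
        rw [if_neg]
        rintro h
        exact hk (by rw [h]; simp)
      · simp

theorem tensorDeriv_single_mulVec (γ : Staircase d) (i j : Fin d) (v : (Box γ → Fin d) → ℂ)
    (f : Box γ → Fin d) :
    (tensorDeriv γ (Matrix.single i j 1) *ᵥ v) f =
      (if i = j then (γ.last : ℂ) * v f else 0) +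
        ∑ x, if f x = i then v (Function.update f x j) else 0 := by
  simp only [Matrix.mulVec, dotProduct, tensorDeriv, LinearMap.coe_mk, AddHom.coe_mk,
    Matrix.of_apply, add_mul, Finset.sum_add_distrib, Finset.sum_mul]
  congr 1
  · simp only [ite_mul, zero_mul, Finset.sum_ite_eq, Finset.mem_univ, if_true]
    split_ifs with h
    · subst h; simp
    · simp [Matrix.trace_single_eq_of_ne _ _ _ h]
  · rw [Finset.sum_comm]
    refine Finset.sum_congr rfl fun x _ => ?_
    rw [Finset.sum_comm]
    simp only [ite_mul, zero_mul, Finset.sum_ite_eq', Finset.mem_univ, if_true]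
    simp [Matrix.single_apply, ite_and, eq_comm]

theorem sum_det_updateRow_mul {ι : Type} [Fintype ι] [DecidableEq ι] (M N : Matrix ι ι ℂ) :
    ∑ x, (M.updateRow x ((M * N) x)).det = N.trace * M.det := by
  have h : ∀ x, (M.updateRow x ((M * N) x)).det = (M * N * M.adjugate) x x := by
    intro x
    rw [← Matrix.cramer_transpose_apply, Matrix.cramer_eq_adjugate_mulVec,
      ← Matrix.adjugate_transpose, Matrix.mul_apply, Matrix.mulVec, dotProduct]
    exact Finset.sum_congr rfl fun k _ => mul_comm _ _
  simp only [h]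
  change (M * N * M.adjugate).trace = _
  rw [Matrix.trace_mul_comm, ← Matrix.mul_assoc, Matrix.adjugate_mul, Matrix.smul_mul,
    Matrix.one_mul, Matrix.trace_smul, smul_eq_mul, mul_comm]

theorem Staircase.rowLen_antitone (γ : Staircase d) {i j : Fin d} (h : i ≤ j) :
    γ.rowLen j ≤ γ.rowLen i := by
  have := γ.2 h
  simp only [Staircase.rowLen]
  omega

theorem Staircase.rowLen_add_last (γ : Staircase d) (i : Fin d) :
    (γ.rowLen i : ℤ) + γ.last = γ.1 i := by
  have hd : 0 < d := i.pos
  have : γ.1 ⟨d - 1, by omega⟩ ≤ γ.1 i := γ.2 (Fin.le_def.2 (by simp; omega))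
  simp only [Staircase.rowLen, Staircase.last, hd, dif_pos]
  omega

/-- The highest weight vector is annihilated by the raising operators and has weight `γ`. -/
theorem tensorDeriv_single_hwVec (γ : Staircase d) {i j : Fin d} (hij : i ≤ j) :
    tensorDeriv γ (Matrix.single i j 1) *ᵥ (hwVec γ).ofLp =
      (if i = j then (γ.1 i : ℂ) else 0) • (hwVec γ).ofLp := by
  funext f
  rw [tensorDeriv_single_mulVec]
  set M : Matrix (Box γ) (Box γ) ℂ := Matrix.of fun x y : Box γ =>
    if (x.2 : ℕ) = (y.2 : ℕ) ∧ f x = y.1 then (1 : ℂ) else 0 with hM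
  set N : Matrix (Box γ) (Box γ) ℂ := Matrix.of fun y' y : Box γ =>
    if (y'.2 : ℕ) = (y.2 : ℕ) ∧ y'.1 = i ∧ y.1 = j then (1 : ℂ) else 0 with hN
  have hv : (hwVec γ).ofLp f = M.det := rfl
  have hrow : ∀ x y, (M * N) x y =
      if f x = i ∧ (x.2 : ℕ) = (y.2 : ℕ) ∧ y.1 = j then 1 else 0 := by
    intro x y
    simp only [Matrix.mul_apply, hM, hN, Matrix.of_apply, mul_ite, mul_one, mul_zero]
    by_cases hc : f x = i ∧ (x.2 : ℕ) = (y.2 : ℕ) ∧ y.1 = j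
    · obtain ⟨h1, h2, h3⟩ := hc
      have hlt : (x.2 : ℕ) < γ.rowLen i := by
        rw [h2]
        exact lt_of_lt_of_le y.2.2 (by rw [h3]; exact γ.rowLen_antitone hij)
      rw [Finset.sum_eq_single (⟨i, ⟨x.2, hlt⟩⟩ : Box γ)]
      · simp [h1, h2, h3]
      · rintro ⟨a, c⟩ _ hne
        split_ifs with h4 h5
        · exfalso
          obtain ⟨_, ha, _⟩ := h4
          dsimp only at ha h5
          subst ha
          exact hne (by congr 1; exact Fin.ext h5.1.symm)
        · rfl
        · rfl
      · simp
    · rw [if_neg hc]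
      refine Finset.sum_eq_zero fun y' _ => ?_
      split_ifs with h4 h5
      · exact absurd ⟨h5.2.trans h4.2.1, h5.1.trans h4.1, h4.2.2⟩ hc
      · rfl
      · rfl
  have hterm : ∀ x, (if f x = i then (hwVec γ).ofLp (Function.update f x j) else 0) =
      (M.updateRow x ((M * N) x)).det := by
    intro x
    split_ifs with h
    · change Matrix.det (Matrix.of fun x' y : Box γ =>
        if (x'.2 : ℕ) = (y.2 : ℕ) ∧ Function.update f x j x' = y.1 then (1 : ℂ) else 0) = _
      congr 1
      ext x' y
      by_cases hx : x' = x
      · subst hx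
        rw [Matrix.updateRow_self, hrow]
        simp [h, eq_comm]
      · rw [Matrix.updateRow_ne hx]
        simp [hM, Function.update_of_ne hx]
    · symm
      refine Matrix.det_eq_zero_of_row_eq_zero x fun y => ?_
      rw [Matrix.updateRow_self, hrow, if_neg]
      exact fun hc => h hc.1
  simp only [hterm, sum_det_updateRow_mul, hv, Pi.smul_apply, smul_eq_mul]
  split_ifs with h
  · subst h
    have ht : N.trace = (γ.rowLen i : ℂ) := by
      simp only [Matrix.trace, Matrix.diag_apply, hN, Matrix.of_apply, true_and, and_self]
      rw [Fintype.sum_sigma, Finset.sum_eq_single i]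
      · simp
      · intro a _ ha; simp [ha]
      · simp
    rw [ht, ← γ.rowLen_add_last i]
    push_cast
    ring
  · have ht : N.trace = 0 := by
      simp only [Matrix.trace, Matrix.diag_apply, hN, Matrix.of_apply, true_and]
      refine Finset.sum_eq_zero fun x _ => if_neg ?_
      rintro ⟨h1, h2⟩
      exact h (h1.symm.trans h2)
    rw [ht]; simp

theorem hwVec_ne_zero (γ : Staircase d) : hwVec γ ≠ 0 := by
  intro h
  have h1 : (hwVec γ).ofLp (fun x => x.1) = 1 := by
    change Matrix.det (Matrix.of fun x y : Box γ =>
        if (x.2 : ℕ) = (y.2 : ℕ) ∧ x.1 = y.1 then (1 : ℂ) else 0) = 1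
    refine Eq.trans (congrArg Matrix.det ?_) (Matrix.det_one (n := Box γ))
    ext ⟨a, c⟩ ⟨a', c'⟩
    rw [Matrix.of_apply, Matrix.one_apply]
    congr 1
    apply propext
    constructor
    · rintro ⟨h1, h2⟩
      dsimp only at h1 h2
      subst h2
      congr 1
      exact Fin.ext h1
    · rintro h
      cases h
      exact ⟨rfl, rfl⟩
  rw [h] at h1
  simp at h1

/-! ### Constructions on differentiable representations -/

/-- A unitary representation that has a derivative. -/
def IsSmooth (R : MatRep d n) : Prop := ∃ D, Differentiates R D

theorem Differentiates.of_isometry {R : MatRep d m} {S : MatRep d n}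
    {D : Matrix (Fin d) (Fin d) ℂ →ₗ[ℂ] Matrix n n ℂ} (h : Differentiates S D)
    {B : Matrix n m ℂ} (hB : Bᴴ * B = 1) (hI : ∀ g, S g * B = B * R g) :
    Differentiates R (LinearMap.mk (AddHom.mk (fun X => Bᴴ * D X * B)
      (fun X Y => by rw [map_add, Matrix.mul_add, Matrix.add_mul]))
      (fun c X => by simp)) where
  unitary g := by
    calc (R g)ᴴ * R g = (B * R g)ᴴ * (B * R g) := by
          rw [Matrix.conjTranspose_mul, Matrix.mul_assoc, ← Matrix.mul_assoc Bᴴ, hB, Matrix.one_mul]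
      _ = 1 := by
          rw [← hI, Matrix.conjTranspose_mul, Matrix.mul_assoc, ← Matrix.mul_assoc _ (S g),
            h.unitary, Matrix.one_mul, hB]
  hasDerivAt X hX := by
    have d1 := hasDerivAt_mul_apply (hasDerivAt_mul_apply (A := fun _ : ℝ => Bᴴ) (A' := 0)
      (fun i j => hasDerivAt_const _ _) (h.hasDerivAt X hX)) (B := fun _ => B) (B' := 0)
      fun i j => hasDerivAt_const _ _
    have e : ∀ g, Bᴴ * S g * B = R g := fun g => by
      rw [Matrix.mul_assoc, hI, ← Matrix.mul_assoc, hB, Matrix.one_mul]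
    intro i j
    have := d1 i j
    simpa [e] using this

theorem Differentiates.conjRep {R : MatRep d n}
    {D : Matrix (Fin d) (Fin d) ℂ →ₗ[ℂ] Matrix n n ℂ} (h : Differentiates R D) :
    Differentiates (conjRep R) (LinearMap.mk (AddHom.mk (fun X => -(D X)ᵀ)
      (fun X Y => by rw [map_add, Matrix.transpose_add, neg_add]))
      (fun c X => by simp)) where
  unitary g := by
    have h1 := congrArg (fun M : Matrix n n ℂ => M.map star) (h.unitary g)
    have e : (EquivChannel.conjRep R g) = (R g).map star := rfl
    rw [e]
    ext i j
    have := congrFun (congrFun h1 i) j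
    simp only [Matrix.map_apply, Matrix.mul_apply, Matrix.conjTranspose_apply, star_sum,
      star_mul'] at this ⊢
    rw [this]
    simp [Matrix.one_apply, apply_ite]
  hasDerivAt X hX i j := by
    have h1 : HasDerivAt (fun t : ℝ => star (R (oneParam X hX t) i j)) (star (D X i j)) 0 :=
      (h.hasDerivAt X hX i j).star
    have h2 : star (D X i j) = -(D X j i) := by
      have := congrFun (congrFun (h.map_conjTranspose X) j) i
      rw [hX, map_neg] at this
      exact this.symm
    rw [h2] at h1
    exact h1

theorem Differentiates.tensor {R : MatRep d m} {S : MatRep d n}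
    {D : Matrix (Fin d) (Fin d) ℂ →ₗ[ℂ] Matrix m m ℂ}
    {D' : Matrix (Fin d) (Fin d) ℂ →ₗ[ℂ] Matrix n n ℂ} (h : Differentiates R D)
    (h' : Differentiates S D') :
    Differentiates (tensor R S) (LinearMap.mk (AddHom.mk (fun X => D X ⊗ₖ 1 + 1 ⊗ₖ D' X)
      (fun X Y => by
        rw [map_add, map_add, Matrix.add_kronecker, Matrix.kronecker_add, add_add_add_comm]))
      (fun c X => by simp [Matrix.smul_kronecker, Matrix.kronecker_smul])) where
  unitary g := by
    change (R g ⊗ₖ S g)ᴴ * (R g ⊗ₖ S g) = 1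
    rw [Matrix.conjTranspose_kronecker, ← Matrix.mul_kronecker_mul, h.unitary, h'.unitary,
      Matrix.one_kronecker_one]
  hasDerivAt X hX i j := by
    have h1 := (h.hasDerivAt X hX i.1 j.1).mul (h'.hasDerivAt X hX i.2 j.2)
    simp only [oneParam_zero, map_one] at h1
    exact h1

/-- The direct sum of two representations. -/
def directSum (R : MatRep d m) (S : MatRep d n) : MatRep d (m ⊕ n) where
  toFun g := Matrix.fromBlocks (R g) 0 0 (S g)
  map_one' := by rw [map_one, map_one]; exact Matrix.fromBlocks_one
  map_mul' g h := by simp [Matrix.fromBlocks_multiply]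

theorem Differentiates.directSum {R : MatRep d m} {S : MatRep d n}
    {D : Matrix (Fin d) (Fin d) ℂ →ₗ[ℂ] Matrix m m ℂ}
    {D' : Matrix (Fin d) (Fin d) ℂ →ₗ[ℂ] Matrix n n ℂ} (h : Differentiates R D)
    (h' : Differentiates S D') :
    Differentiates (directSum R S)
      (LinearMap.mk (AddHom.mk (fun X => Matrix.fromBlocks (D X) 0 0 (D' X))
      (fun X Y => by rw [map_add, map_add, Matrix.fromBlocks_add, add_zero, add_zero]))
      (fun c X => by simp [Matrix.fromBlocks_smul])) where
  unitary g := by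
    change (Matrix.fromBlocks (R g) 0 0 (S g))ᴴ * (Matrix.fromBlocks (R g) 0 0 (S g)) = 1
    rw [Matrix.fromBlocks_conjTranspose, Matrix.fromBlocks_multiply]
    simp [h.unitary, h'.unitary]
  hasDerivAt X hX i j := by
    rcases i with i | i <;> rcases j with j | j
    · exact h.hasDerivAt X hX i j
    · exact hasDerivAt_const _ _
    · exact hasDerivAt_const _ _
    · exact h'.hasDerivAt X hX i j

theorem IsSmooth.conjRep {R : MatRep d n} : IsSmooth R → IsSmooth (conjRep R) :=
  fun ⟨_, h⟩ => ⟨_, h.conjRep⟩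

theorem IsSmooth.tensor {R : MatRep d m} {S : MatRep d n} :
    IsSmooth R → IsSmooth S → IsSmooth (tensor R S) :=
  fun ⟨_, h⟩ ⟨_, h'⟩ => ⟨_, h.tensor h'⟩

/-! ### The representations `Q_γ` in coordinates -/

/-- The matrix whose columns are the basis vectors of `Q_γ`. -/
def basisMat (b : Bases d) (γ : Staircase d) : Matrix (Box γ → Fin d) (Fin (dimQ γ)) ℂ :=
  Matrix.of fun f q => (b γ q : Tensor γ).ofLp f

theorem basisMat_isometry (b : Bases d) (γ : Staircase d) :
    (basisMat b γ)ᴴ * basisMat b γ = 1 := by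
  ext p q
  have h := orthonormal_iff_ite.1 (b γ).orthonormal p q
  rw [Submodule.coe_inner, EuclideanSpace.inner_eq_star_dotProduct] at h
  rw [Matrix.mul_apply, Matrix.one_apply, ← h, dotProduct]
  exact Finset.sum_congr rfl fun f _ => mul_comm _ _

theorem basisMat_mulVec (b : Bases d) (γ : Staircase d) (x : Fin (dimQ γ) → ℂ) :
    basisMat b γ *ᵥ x = ((∑ q, x q • b γ q : Q γ) : Tensor γ).ofLp := by
  funext f
  simp [Matrix.mulVec, dotProduct, basisMat, mul_comm]

theorem basisMat_mul_conjTranspose_mulVec (b : Bases d) (γ : Staircase d) {v : Tensor γ}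
    (hv : v ∈ Q γ) : basisMat b γ *ᵥ ((basisMat b γ)ᴴ *ᵥ v.ofLp) = v.ofLp := by
  have h := (b γ).sum_repr ⟨v, hv⟩
  have h2 : v.ofLp = basisMat b γ *ᵥ ((b γ).repr ⟨v, hv⟩).ofLp := by
    rw [basisMat_mulVec, h]
  rw [h2, Matrix.mulVec_mulVec _ (basisMat b γ)ᴴ, basisMat_isometry, Matrix.one_mulVec]

theorem tensorMat_mul_basisMat (b : Bases d) (γ : Staircase d) (g : U d) :
    tensorMat γ g * basisMat b γ = basisMat b γ * rep b γ g := by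
  ext f q
  have h1 : (irrep γ g (b γ q) : Q γ) = ∑ p, rep b γ g p q • b γ p := by
    have := (b γ).sum_repr (irrep γ g (b γ q))
    rw [← this]
    refine Finset.sum_congr rfl fun p _ => ?_
    congr 1
    simp [rep, LinearMap.toMatrix_apply]
  have h2 := congrArg (fun v : Q γ => (v : Tensor γ).ofLp f) h1
  have h3 : ((irrep γ g (b γ q) : Q γ) : Tensor γ).ofLp f = (tensorMat γ g * basisMat b γ) f q :=
    rfl
  rw [← h3]
  refine h2.trans ?_
  simp [Matrix.mul_apply, basisMat, mul_comm]

/-- The highest weight vector of `Q_γ` in coordinates. -/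
def hwCoord (b : Bases d) (γ : Staircase d) : Fin (dimQ γ) → ℂ :=
  (basisMat b γ)ᴴ *ᵥ (hwVec γ).ofLp

theorem hwVec_mem_Q (γ : Staircase d) : hwVec γ ∈ Q γ :=
  Submodule.subset_span ⟨1, by simp⟩

theorem basisMat_mulVec_hwCoord (b : Bases d) (γ : Staircase d) :
    basisMat b γ *ᵥ hwCoord b γ = (hwVec γ).ofLp :=
  basisMat_mul_conjTranspose_mulVec b γ (hwVec_mem_Q γ)

theorem hwCoord_ne_zero (b : Bases d) (γ : Staircase d) : hwCoord b γ ≠ 0 := by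
  intro h
  have := basisMat_mulVec_hwCoord b γ
  rw [h, Matrix.mulVec_zero] at this
  exact hwVec_ne_zero γ (WithLp.ofLp_injective 2 this.symm)

theorem dimQ_pos (γ : Staircase d) : 0 < dimQ γ := by
  have : Nontrivial (Q γ) := ⟨⟨⟨hwVec γ, hwVec_mem_Q γ⟩, 0, fun h => hwVec_ne_zero γ
    (congrArg Subtype.val h)⟩⟩
  exact Module.finrank_pos

/-- A vector annihilated by the raising operators. -/
def IsRaisingKilled (D : Matrix (Fin d) (Fin d) ℂ →ₗ[ℂ] Matrix n n ℂ) (v : n → ℂ) : Prop :=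
  ∀ i j, i < j → D (Matrix.single i j 1) *ᵥ v = 0

/-- A vector of weight `γ`. -/
def HasWeight (D : Matrix (Fin d) (Fin d) ℂ →ₗ[ℂ] Matrix n n ℂ) (γ : Fin d → ℤ)
    (v : n → ℂ) : Prop :=
  ∀ i, D (Matrix.single i i 1) *ᵥ v = (γ i : ℂ) • v

theorem exists_differentiates_rep (b : Bases d) (γ : Staircase d) :
    ∃ D, Differentiates (rep b γ) D ∧ IsRaisingKilled D (hwCoord b γ) ∧
      HasWeight D γ.1 (hwCoord b γ) := by
  refine ⟨_, (differentiates_tensorMat γ).of_isometry (basisMat_isometry b γ)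
    (tensorMat_mul_basisMat b γ), fun i j hij => ?_, fun i => ?_⟩
  · change ((basisMat b γ)ᴴ * tensorDeriv γ (Matrix.single i j 1) * basisMat b γ) *ᵥ
      hwCoord b γ = 0
    rw [← Matrix.mulVec_mulVec, ← Matrix.mulVec_mulVec, basisMat_mulVec_hwCoord,
      tensorDeriv_single_hwVec γ hij.le, if_neg hij.ne, zero_smul, Matrix.mulVec_zero]
  · change ((basisMat b γ)ᴴ * tensorDeriv γ (Matrix.single i i 1) * basisMat b γ) *ᵥ
      hwCoord b γ = _
    rw [← Matrix.mulVec_mulVec, ← Matrix.mulVec_mulVec, basisMat_mulVec_hwCoord,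
      tensorDeriv_single_hwVec γ le_rfl, if_pos rfl, Matrix.mulVec_smul]
    rfl

theorem isSmooth_rep (b : Bases d) (γ : Staircase d) : IsSmooth (rep b γ) :=
  let ⟨D, h, _⟩ := exists_differentiates_rep b γ
  ⟨D, h⟩

/-- The highest weight vector generates `Q_γ`. -/
theorem span_rep_hwCoord (b : Bases d) (γ : Staircase d) :
    Submodule.span ℂ (Set.range fun g : U d => rep b γ g *ᵥ hwCoord b γ) = ⊤ := by
  rw [eq_top_iff]
  intro x _
  have key : ∀ v ∈ Q γ, (basisMat b γ)ᴴ *ᵥ v.ofLp ∈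
      Submodule.span ℂ (Set.range fun g : U d => rep b γ g *ᵥ hwCoord b γ) := by
    intro v hv
    induction hv using Submodule.span_induction with
    | mem v hv =>
      obtain ⟨g, rfl⟩ := hv
      refine Submodule.subset_span ⟨g, ?_⟩
      change rep b γ g *ᵥ hwCoord b γ = (basisMat b γ)ᴴ *ᵥ (tensorMat γ g *ᵥ (hwVec γ).ofLp)
      rw [← basisMat_mulVec_hwCoord b γ, Matrix.mulVec_mulVec, Matrix.mulVec_mulVec,
        Matrix.mul_assoc, tensorMat_mul_basisMat, ← Matrix.mul_assoc, basisMat_isometry,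
        Matrix.one_mul]
    | zero => simp
    | add v w _ _ hv hw => rw [WithLp.ofLp_add, Matrix.mulVec_add]; exact Submodule.add_mem _ hv hw
    | smul c v _ hv => rw [WithLp.ofLp_smul, Matrix.mulVec_smul]; exact Submodule.smul_mem _ c hv
  have h := key _ (∑ q, x q • b γ q : Q γ).2
  rwa [← basisMat_mulVec, Matrix.mulVec_mulVec, basisMat_isometry, Matrix.one_mulVec] at h

/-! ### Highest weight theory -/

theorem star_dotProduct_mulVec_eq (A : Matrix m n ℂ) (u : m → ℂ) (w : n → ℂ) :
    star u ⬝ᵥ (A *ᵥ w) = star (Aᴴ *ᵥ u) ⬝ᵥ w := by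
  rw [Matrix.star_mulVec, Matrix.conjTranspose_conjTranspose, Matrix.dotProduct_mulVec]

/-- The subspace generated from `v` by the lowering operators. -/
def loweringSpan (D : Matrix (Fin d) (Fin d) ℂ →ₗ[ℂ] Matrix n n ℂ) (v : n → ℂ) :
    Submodule ℂ (n → ℂ) :=
  sInf {W | v ∈ W ∧ ∀ i j, j < i → ∀ w ∈ W, D (Matrix.single i j 1) *ᵥ w ∈ W}

theorem loweringSpan_le {D : Matrix (Fin d) (Fin d) ℂ →ₗ[ℂ] Matrix n n ℂ} {v : n → ℂ}
    {W : Submodule ℂ (n → ℂ)} (hv : v ∈ W)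
    (hW : ∀ i j, j < i → ∀ w ∈ W, D (Matrix.single i j 1) *ᵥ w ∈ W) : loweringSpan D v ≤ W :=
  sInf_le ⟨hv, hW⟩

theorem mem_loweringSpan (D : Matrix (Fin d) (Fin d) ℂ →ₗ[ℂ] Matrix n n ℂ) (v : n → ℂ) :
    v ∈ loweringSpan D v :=
  (Submodule.mem_sInf).2 fun _ hW => hW.1

theorem lowering_mem_loweringSpan (D : Matrix (Fin d) (Fin d) ℂ →ₗ[ℂ] Matrix n n ℂ)
    {v w : n → ℂ} {i j : Fin d} (hij : j < i) (hw : w ∈ loweringSpan D v) :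
    D (Matrix.single i j 1) *ᵥ w ∈ loweringSpan D v :=
  (Submodule.mem_sInf).2 fun W hW => hW.2 i j hij w ((Submodule.mem_sInf).1 hw W hW)

theorem linearMap_mulVec_mem {D : Matrix (Fin d) (Fin d) ℂ →ₗ[ℂ] Matrix n n ℂ}
    {W : Submodule ℂ (n → ℂ)} {v : n → ℂ} (h : ∀ i j, D (Matrix.single i j 1) *ᵥ v ∈ W)
    (X : Matrix (Fin d) (Fin d) ℂ) : D X *ᵥ v ∈ W := by
  rw [Matrix.matrix_eq_sum_single X]
  simp only [map_sum, Matrix.sum_mulVec]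
  refine W.sum_mem fun i _ => W.sum_mem fun j _ => ?_
  have : Matrix.single i j (X i j) = X i j • Matrix.single i j (1 : ℂ) := by
    rw [Matrix.smul_single, smul_eq_mul, mul_one]
  rw [this, map_smul, Matrix.smul_mulVec]
  exact W.smul_mem _ (h i j)

namespace Differentiates

variable {R : MatRep d n} {D : Matrix (Fin d) (Fin d) ℂ →ₗ[ℂ] Matrix n n ℂ}

theorem map_mul_mulVec (h : Differentiates R D) (X Y : Matrix (Fin d) (Fin d) ℂ) (w : n → ℂ) :
    D X *ᵥ (D Y *ᵥ w) = D Y *ᵥ (D X *ᵥ w) + D (X * Y - Y * X) *ᵥ w := by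
  rw [h.map_commutator, Matrix.sub_mulVec, ← Matrix.mulVec_mulVec, ← Matrix.mulVec_mulVec]
  abel

theorem loweringSpan_stable (h : Differentiates R D) {v : n → ℂ} (hv : IsRaisingKilled D v)
    {γ : Fin d → ℤ} (hγ : HasWeight D γ v) (X : Matrix (Fin d) (Fin d) ℂ) :
    ∀ w ∈ loweringSpan D v, D X *ᵥ w ∈ loweringSpan D v := by
  let S : Submodule ℂ (n → ℂ) :=
    { carrier := {w | w ∈ loweringSpan D v ∧ ∀ X, D X *ᵥ w ∈ loweringSpan D v}
      add_mem' := fun ha hb => ⟨Submodule.add_mem _ ha.1 hb.1, fun X => by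
        rw [Matrix.mulVec_add]; exact Submodule.add_mem _ (ha.2 X) (hb.2 X)⟩
      zero_mem' := ⟨Submodule.zero_mem _, fun X => by
        rw [Matrix.mulVec_zero]; exact Submodule.zero_mem _⟩
      smul_mem' := fun c _ ha => ⟨Submodule.smul_mem _ c ha.1, fun X => by
        rw [Matrix.mulVec_smul]; exact Submodule.smul_mem _ c (ha.2 X)⟩ }
  have hS : loweringSpan D v ≤ S := by
    refine loweringSpan_le ⟨mem_loweringSpan D v, linearMap_mulVec_mem fun i j => ?_⟩ ?_
    · rcases lt_trichotomy i j with hij | rfl | hij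
      · rw [hv i j hij]; exact Submodule.zero_mem _
      · rw [hγ i]; exact Submodule.smul_mem _ _ (mem_loweringSpan D v)
      · exact lowering_mem_loweringSpan D hij (mem_loweringSpan D v)
    · rintro i j hij w ⟨hw, hw'⟩
      refine ⟨hw' _, fun Y => ?_⟩
      rw [h.map_mul_mulVec]
      exact Submodule.add_mem _ (lowering_mem_loweringSpan D hij (hw' Y)) (hw' _)
  exact fun w hw => (hS hw).2 X

/-- In the subrepresentation generated by a highest weight vector, every vector annihilated by the
raising operators is a multiple of it. -/
theorem eq_smul_of_isRaisingKilled (h : Differentiates R D) {v : n → ℂ}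
    (hv : IsRaisingKilled D v) {γ : Fin d → ℤ} (hγ : HasWeight D γ v) {u : n → ℂ}
    (hu : u ∈ Submodule.span ℂ (Set.range fun g => R g *ᵥ v)) (hur : IsRaisingKilled D u) :
    ∃ c : ℂ, u = c • v := by
  have hst := h.stable_of_forall_deriv (h.loweringSpan_stable hv hγ)
  have hle : Submodule.span ℂ (Set.range fun g => R g *ᵥ v) ≤ loweringSpan D v := by
    rw [Submodule.span_le]
    rintro _ ⟨g, rfl⟩
    exact hst g v (mem_loweringSpan D v)
  by_cases hv0 : v = 0
  · refine ⟨0, ?_⟩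
    rw [hv0] at hu
    simpa using hu
  have hvv : star v ⬝ᵥ v ≠ 0 := fun h0 => hv0 (dotProduct_star_self_eq_zero.1 h0)
  refine ⟨(star v ⬝ᵥ u) / (star v ⬝ᵥ v), ?_⟩
  set c : ℂ := (star v ⬝ᵥ u) / (star v ⬝ᵥ v) with hc
  set u' : n → ℂ := u - c • v with hu'
  have hvu' : star v ⬝ᵥ u' = 0 := by
    rw [hu', dotProduct_sub, dotProduct_smul, hc, smul_eq_mul, div_mul_cancel₀ _ hvv, sub_self]
  have hu'r : IsRaisingKilled D u' := fun i j hij => by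
    rw [hu', Matrix.mulVec_sub, Matrix.mulVec_smul, hur i j hij, hv i j hij, smul_zero, sub_zero]
  let P : Submodule ℂ (n → ℂ) :=
    { carrier := {w | star u' ⬝ᵥ w = 0}
      add_mem' := fun {a b} ha hb => by
        simp only [Set.mem_ofPred_eq] at ha hb ⊢
        rw [dotProduct_add, ha, hb, add_zero]
      zero_mem' := dotProduct_zero _
      smul_mem' := fun c a ha => by
        simp only [Set.mem_ofPred_eq] at ha ⊢
        rw [dotProduct_smul, ha, smul_zero] }
  have hP : loweringSpan D v ≤ P := by
    refine loweringSpan_le ?_ fun i j hij w _ => ?_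
    · change star u' ⬝ᵥ v = 0
      rw [← star_star (star u' ⬝ᵥ v), ← Matrix.star_dotProduct, hvu', star_zero]
    · change star u' ⬝ᵥ (D (Matrix.single i j 1) *ᵥ w) = 0
      rw [star_dotProduct_mulVec_eq, ← h.map_conjTranspose, Matrix.conjTranspose_single, star_one,
        hu'r j i hij, star_zero, zero_dotProduct]
  have h0 : star u' ⬝ᵥ u' = 0 := hP (Submodule.sub_mem _ (hle hu)
    (Submodule.smul_mem _ _ (mem_loweringSpan D v)))
  have h1 : u' = 0 := dotProduct_star_self_eq_zero.1 h0
  exact sub_eq_zero.1 h1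

end Differentiates

theorem exists_eigenvector_mem {V : Submodule ℂ (n → ℂ)} (hV : V ≠ ⊥) {A : Matrix n n ℂ}
    (hA : ∀ v ∈ V, A *ᵥ v ∈ V) : ∃ (a : ℂ), ∃ v ∈ V, v ≠ 0 ∧ A *ᵥ v = a • v := by
  have : Nontrivial V := (Submodule.nontrivial_iff_ne_bot).2 hV
  obtain ⟨a, ha⟩ := Module.End.exists_eigenvalue ((Matrix.mulVecLin A).restrict hA)
  obtain ⟨v, hv⟩ := ha.exists_hasEigenvector
  refine ⟨a, v, v.2, fun h => hv.2 (Subtype.ext h), ?_⟩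
  exact congrArg Subtype.val hv.apply_eq_smul

theorem exists_common_eigenvector {ι : Type} [Fintype ι] {V : Submodule ℂ (n → ℂ)} (hV : V ≠ ⊥)
    {A : ι → Matrix n n ℂ} (hA : ∀ i, ∀ v ∈ V, A i *ᵥ v ∈ V)
    (hc : ∀ i j, A i * A j = A j * A i) :
    ∃ v ∈ V, v ≠ 0 ∧ ∀ i, ∃ a : ℂ, A i *ᵥ v = a • v := by
  classical
  have key : ∀ s : Finset ι, ∃ W ≤ V, W ≠ ⊥ ∧ (∀ i, ∀ v ∈ W, A i *ᵥ v ∈ W) ∧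
      ∀ i ∈ s, ∃ a : ℂ, ∀ v ∈ W, A i *ᵥ v = a • v := by
    intro s
    induction s using Finset.induction_on with
    | empty => exact ⟨V, le_rfl, hV, hA, by simp⟩
    | insert k s _ ih =>
      obtain ⟨W, hWV, hW0, hWA, hWs⟩ := ih
      obtain ⟨a, v, hv, hv0, hva⟩ := exists_eigenvector_mem hW0 (hWA k)
      let E : Submodule ℂ (n → ℂ) := W ⊓ Module.End.eigenspace (Matrix.mulVecLin (A k)) a
      have hE : ∀ w, w ∈ E ↔ w ∈ W ∧ A k *ᵥ w = a • w := fun w => by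
        rw [Submodule.mem_inf, Module.End.mem_eigenspace_iff, Matrix.mulVecLin_apply]
      refine ⟨E, inf_le_left.trans hWV, fun h => ?_, fun i w hw => ?_, fun i hi => ?_⟩
      · have : v ∈ E := (hE v).2 ⟨hv, hva⟩
        rw [h] at this
        exact hv0 ((Submodule.mem_bot ℂ).1 this)
      · rw [hE] at hw ⊢
        refine ⟨hWA i w hw.1, ?_⟩
        rw [Matrix.mulVec_mulVec, hc, ← Matrix.mulVec_mulVec, hw.2, Matrix.mulVec_smul]
      · rcases Finset.mem_insert.1 hi with rfl | hi
        · exact ⟨a, fun w hw => ((hE w).1 hw).2⟩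
        · obtain ⟨a', ha'⟩ := hWs i hi
          exact ⟨a', fun w hw => ha' w ((hE w).1 hw).1⟩
  obtain ⟨W, hWV, hW0, _, hW⟩ := key Finset.univ
  obtain ⟨v, hv, hv0⟩ := W.ne_bot_iff.1 hW0
  refine ⟨v, hWV hv, hv0, fun i => ?_⟩
  obtain ⟨a, ha⟩ := hW i (Finset.mem_univ i)
  exact ⟨a, ha v hv⟩

namespace Differentiates

variable {R : MatRep d n} {D : Matrix (Fin d) (Fin d) ℂ →ₗ[ℂ] Matrix n n ℂ}

theorem exists_int_eq_of_eigenvector (h : Differentiates R D) {v : n → ℂ} (hv : v ≠ 0)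
    {i : Fin d} {a : ℂ} (ha : D (Matrix.single i i 1) *ᵥ v = a • v) : ∃ k : ℤ, a = k := by
  have hX : (Complex.I • Matrix.single i i (1 : ℂ))ᴴ =
      -(Complex.I • Matrix.single i i (1 : ℂ)) := by
    rw [Matrix.conjTranspose_smul, Matrix.conjTranspose_single, star_one, ← neg_smul]
    simp
  have h1 : oneParam _ hX (2 * Real.pi) = 1 := by
    apply Subtype.ext
    rw [oneParam_coe]
    have e : ((2 * Real.pi : ℝ) • (Complex.I • Matrix.single i i (1 : ℂ))) =
        Matrix.diagonal (Pi.single i (2 * Real.pi * Complex.I)) := by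
      rw [Matrix.diagonal_single, Matrix.smul_single, Matrix.smul_single]
      congr 1
      simp
    rw [e, Matrix.exp_diagonal]
    have e2 : NormedSpace.exp (Pi.single i (2 * Real.pi * Complex.I) : Fin d → ℂ) = 1 := by
      funext k
      rw [Pi.coe_exp, ← Complex.exp_eq_exp_ℂ]
      by_cases hk : k = i
      · subst hk; simp [Complex.exp_two_pi_mul_I]
      · simp [hk]
    rw [e2]
    exact Matrix.diagonal_one
  have h2 := h.map_oneParam _ hX (2 * Real.pi)
  rw [h1, map_one] at h2
  have h3 : ((2 * Real.pi : ℝ) • D (Complex.I • Matrix.single i i (1 : ℂ))) *ᵥ v =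
      (2 * Real.pi * Complex.I * a) • v := by
    rw [map_smul, Matrix.smul_mulVec, Matrix.smul_mulVec, ha, smul_smul, ← Complex.coe_smul,
      smul_smul]
    congr 1
    push_cast
    ring
  have h4 := exp_mulVec_of_eigenvector h3
  rw [← h2, Matrix.one_mulVec] at h4
  have h5 : Complex.exp (2 * Real.pi * Complex.I * a) = 1 := by
    have : (Complex.exp (2 * Real.pi * Complex.I * a) - 1) • v = 0 := by
      rw [sub_smul, ← h4, one_smul, sub_self]
    rcases smul_eq_zero.1 this with h | h
    · exact sub_eq_zero.1 h
    · exact absurd h hv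
  obtain ⟨k, hk⟩ := Complex.exp_eq_one_iff.1 h5
  refine ⟨k, ?_⟩
  have hpi : (2 * Real.pi * Complex.I : ℂ) ≠ 0 := Complex.two_pi_I_ne_zero
  exact mul_left_cancel₀ hpi (by rw [hk]; ring)

theorem weight_antitone (h : Differentiates R D) {v : n → ℂ} (hv : v ≠ 0)
    (hvr : IsRaisingKilled D v) {γ : Fin d → ℤ} (hγ : HasWeight D γ v) : Antitone γ := by
  intro i j hij
  rcases hij.eq_or_lt with rfl | hij
  · exact le_rfl
  have e : Matrix.single i j (1 : ℂ) * Matrix.single j i 1 -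
      Matrix.single j i 1 * Matrix.single i j (1 : ℂ) =
      Matrix.single i i 1 - Matrix.single j j 1 := by simp
  have h1 : D (Matrix.single i j 1) *ᵥ (D (Matrix.single j i 1) *ᵥ v) =
      ((γ i - γ j : ℤ) : ℂ) • v := by
    rw [h.map_mul_mulVec, hvr i j hij, Matrix.mulVec_zero, zero_add, e, map_sub,
      Matrix.sub_mulVec, hγ i, hγ j, ← sub_smul]
    push_cast
    rfl
  have h2 : star (D (Matrix.single j i 1) *ᵥ v) ⬝ᵥ (D (Matrix.single j i 1) *ᵥ v) =
      ((γ i - γ j : ℤ) : ℂ) * (star v ⬝ᵥ v) := by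
    rw [star_dotProduct_mulVec_eq, ← h.map_conjTranspose, Matrix.conjTranspose_single, star_one,
      h1, star_smul, smul_dotProduct]
    simp
  have h3 : 0 ≤ star (D (Matrix.single j i 1) *ᵥ v) ⬝ᵥ (D (Matrix.single j i 1) *ᵥ v) :=
    dotProduct_star_self_nonneg _
  have h4 : 0 < star v ⬝ᵥ v := by
    exact Matrix.dotProduct_star_self_pos_iff.2 hv
  rw [h2] at h3
  have h5 := (Complex.le_def.1 h3).1
  rw [Complex.mul_re, Complex.intCast_im, zero_mul, sub_zero, Complex.intCast_re,
    Complex.zero_re] at h5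
  have h6 : (0 : ℝ) ≤ ((γ i - γ j : ℤ) : ℝ) := nonneg_of_mul_nonneg_left h5 (Complex.lt_def.1 h4).1
  have h7 : (0 : ℤ) ≤ γ i - γ j := by exact_mod_cast h6
  linarith

/-- Every nonzero subrepresentation contains a highest weight vector. -/
theorem exists_highestWeight (h : Differentiates R D) {V : Submodule ℂ (n → ℂ)} (hV0 : V ≠ ⊥)
    (hV : ∀ g, ∀ v ∈ V, R g *ᵥ v ∈ V) :
    ∃ v ∈ V, v ≠ 0 ∧ IsRaisingKilled D v ∧ ∃ γ : Staircase d, HasWeight D γ.1 v := by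
  have hVD := h.deriv_stable hV
  set H : Matrix (Fin d) (Fin d) ℂ := Matrix.diagonal fun i => -(i : ℂ) with hH
  set S : Set ℂ := {c | ∃ v ∈ V, v ≠ 0 ∧ D H *ᵥ v = c • v} with hS
  have hfin : S.Finite := by
    refine (Module.End.finite_hasEigenvalue (Matrix.mulVecLin (D H))).subset ?_
    rintro c ⟨v, _, hv0, hv⟩
    exact Module.End.hasEigenvalue_of_hasEigenvector
      ⟨Module.End.mem_eigenspace_iff.2 hv, hv0⟩
  have hne : S.Nonempty := exists_eigenvector_mem hV0 (hVD H)
  obtain ⟨c, ⟨v₀, hv₀, hv₀0, hv₀c⟩, hmax⟩ := Set.exists_max_image S Complex.re hfin hne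
  let E : Submodule ℂ (n → ℂ) := V ⊓ Module.End.eigenspace (Matrix.mulVecLin (D H)) c
  have hE : ∀ w, w ∈ E ↔ w ∈ V ∧ D H *ᵥ w = c • w := fun w => by
    rw [Submodule.mem_inf, Module.End.mem_eigenspace_iff, Matrix.mulVecLin_apply]
  have hcomm : ∀ i j : Fin d, H * Matrix.single i j 1 - Matrix.single i j 1 * H =
      ((j : ℂ) - (i : ℂ)) • Matrix.single i j (1 : ℂ) := by
    intro i j
    ext k l
    rw [hH, Matrix.sub_apply, Matrix.diagonal_mul, Matrix.mul_diagonal, Matrix.smul_apply,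
      Matrix.single_apply]
    split_ifs with hc
    · rw [hc.1, hc.2, smul_eq_mul]
      ring
    · simp
  have hE0 : E ≠ ⊥ := fun hb => by
    have : v₀ ∈ E := (hE v₀).2 ⟨hv₀, hv₀c⟩
    rw [hb] at this
    exact hv₀0 ((Submodule.mem_bot ℂ).1 this)
  have hEA : ∀ i : Fin d, ∀ w ∈ E, D (Matrix.single i i 1) *ᵥ w ∈ E := by
    intro i w hw
    rw [hE] at hw ⊢
    refine ⟨hVD _ w hw.1, ?_⟩
    rw [h.map_mul_mulVec, hw.2, hcomm]
    simp [Matrix.mulVec_smul]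
  have hEc : ∀ i j : Fin d, D (Matrix.single i i 1) * D (Matrix.single j j 1) =
      D (Matrix.single j j 1) * D (Matrix.single i i 1) := by
    intro i j
    rw [← sub_eq_zero, ← h.map_commutator]
    have : Matrix.single i i (1 : ℂ) * Matrix.single j j 1 -
        Matrix.single j j 1 * Matrix.single i i (1 : ℂ) = 0 := by
      by_cases hij : i = j
      · subst hij; simp
      · rw [Matrix.single_mul_single_of_ne _ _ _ _ hij,
          Matrix.single_mul_single_of_ne _ _ _ _ (Ne.symm hij), sub_zero]
    rw [this, map_zero]
  obtain ⟨v, hv, hv0, hva⟩ := exists_common_eigenvector hE0 hEA hEc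
  have hvr : IsRaisingKilled D v := by
    intro i j hij
    by_contra hne
    have hmem : c + ((j : ℂ) - (i : ℂ)) ∈ S := by
      refine ⟨_, hVD _ v ((hE v).1 hv).1, hne, ?_⟩
      rw [h.map_mul_mulVec, ((hE v).1 hv).2, hcomm, map_smul, Matrix.smul_mulVec,
        Matrix.mulVec_smul, ← add_smul]
    have := hmax _ hmem
    have hlt : ((i : ℕ) : ℝ) < (j : ℕ) := by exact_mod_cast hij
    simp only [Complex.add_re, Complex.sub_re, Complex.natCast_re] at this
    linarith
  have hk : ∀ i, ∃ k : ℤ, D (Matrix.single i i 1) *ᵥ v = (k : ℂ) • v := by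
    intro i
    obtain ⟨a, ha⟩ := hva i
    obtain ⟨k, rfl⟩ := h.exists_int_eq_of_eigenvector hv0 ha
    exact ⟨k, ha⟩
  choose γ hγ using hk
  exact ⟨v, ((hE v).1 hv).1, hv0, hvr, ⟨γ, h.weight_antitone hv0 hvr hγ⟩, hγ⟩

end Differentiates

/-! ### Schur's lemma and completeness of the labels -/

theorem intertwiner_eq_zero_of_mulVec_hwCoord {b : Bases d} {γ : Staircase d} {R : MatRep d n}
    {M : Matrix n (Fin (dimQ γ)) ℂ} (hM : M ∈ intertwiners (rep b γ) R)
    (h0 : M *ᵥ hwCoord b γ = 0) : M = 0 := by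
  have hle : (⊤ : Submodule ℂ (Fin (dimQ γ) → ℂ)) ≤ LinearMap.ker (Matrix.mulVecLin M) := by
    rw [← span_rep_hwCoord b γ, Submodule.span_le]
    rintro _ ⟨g, rfl⟩
    change M *ᵥ (rep b γ g *ᵥ hwCoord b γ) = 0
    rw [Matrix.mulVec_mulVec, ← hM g, ← Matrix.mulVec_mulVec, h0, Matrix.mulVec_zero]
  refine Matrix.ext_of_mulVec_single fun q => ?_
  rw [Matrix.zero_mulVec]
  exact hle (Submodule.mem_top)

theorem exists_mulVec_hwCoord_eq (b : Bases d) {γ γ' : Staircase d}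
    {M : Matrix (Fin (dimQ γ')) (Fin (dimQ γ)) ℂ} (hM : M ∈ intertwiners (rep b γ) (rep b γ')) :
    ∃ c : ℂ, M *ᵥ hwCoord b γ = c • hwCoord b γ' ∧ (γ ≠ γ' → c = 0) := by
  obtain ⟨D, hD, hr, hw⟩ := exists_differentiates_rep b γ
  obtain ⟨D', hD', hr', hw'⟩ := exists_differentiates_rep b γ'
  have hI := hD.intertwines hD' hM
  obtain ⟨c, hc⟩ := hD'.eq_smul_of_isRaisingKilled hr' hw' (u := M *ᵥ hwCoord b γ)
    (by rw [span_rep_hwCoord]; trivial)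
    (fun i j hij => by
      rw [Matrix.mulVec_mulVec, hI, ← Matrix.mulVec_mulVec, hr i j hij, Matrix.mulVec_zero])
  refine ⟨c, hc, fun hne => ?_⟩
  by_contra hc0
  refine hne (Subtype.ext (funext fun i => ?_))
  have h1 : D' (Matrix.single i i 1) *ᵥ (M *ᵥ hwCoord b γ) =
      (γ.1 i : ℂ) • (M *ᵥ hwCoord b γ) := by
    rw [Matrix.mulVec_mulVec, hI, ← Matrix.mulVec_mulVec, hw i, Matrix.mulVec_smul]
  rw [hc, Matrix.mulVec_smul, hw' i, smul_comm] at h1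
  have h2 : ((γ'.1 i : ℂ) - (γ.1 i : ℂ)) • (c • hwCoord b γ') = 0 := by
    rw [sub_smul, h1, sub_self]
  rcases smul_eq_zero.1 h2 with h3 | h3
  · have := sub_eq_zero.1 h3
    exact_mod_cast this.symm
  · rcases smul_eq_zero.1 h3 with h4 | h4
    · exact absurd h4 hc0
    · exact absurd h4 (hwCoord_ne_zero b γ')

theorem schur_of_ne (b : Bases d) {γ γ' : Staircase d} (hne : γ ≠ γ')
    {M : Matrix (Fin (dimQ γ')) (Fin (dimQ γ)) ℂ} (hM : M ∈ intertwiners (rep b γ) (rep b γ')) :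
    M = 0 := by
  obtain ⟨c, hc, hc0⟩ := exists_mulVec_hwCoord_eq b hM
  exact intertwiner_eq_zero_of_mulVec_hwCoord hM (by rw [hc, hc0 hne, zero_smul])

theorem schur (b : Bases d) {γ : Staircase d} {M : Matrix (Fin (dimQ γ)) (Fin (dimQ γ)) ℂ}
    (hM : M ∈ intertwiners (rep b γ) (rep b γ)) : ∃ c : ℂ, M = c • 1 := by
  obtain ⟨c, hc, _⟩ := exists_mulVec_hwCoord_eq b hM
  refine ⟨c, sub_eq_zero.1 (intertwiner_eq_zero_of_mulVec_hwCoord (b := b) (R := rep b γ) ?_ ?_)⟩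
  · refine Submodule.sub_mem _ hM (Submodule.smul_mem _ _ fun g => ?_)
    rw [Matrix.mul_one, Matrix.one_mul]
  · rw [Matrix.sub_mulVec, hc, Matrix.smul_mulVec, Matrix.one_mulVec, sub_self]

/-- Every nonzero subrepresentation contains a copy of some `Q_γ`. -/
theorem exists_intertwiner_of_stable (b : Bases d) {R : MatRep d n} (hR : IsSmooth R)
    {V : Submodule ℂ (n → ℂ)} (hV0 : V ≠ ⊥) (hV : ∀ g, ∀ v ∈ V, R g *ᵥ v ∈ V) :
    ∃ (γ : Staircase d) (M : Matrix n (Fin (dimQ γ)) ℂ), M ∈ intertwiners (rep b γ) R ∧ M ≠ 0 ∧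
      ∀ x, M *ᵥ x ∈ V := by
  obtain ⟨D, hD⟩ := hR
  obtain ⟨v, hvV, hv0, hvr, γ, hvγ⟩ := hD.exists_highestWeight hV0 hV
  obtain ⟨D', hD', hr', hw'⟩ := exists_differentiates_rep b γ
  obtain ⟨DS, hDS, hS⟩ : ∃ DS, (∀ X, DS X = Matrix.fromBlocks (D X) 0 0 (D' X)) ∧
      Differentiates (directSum R (rep b γ)) DS := ⟨_, fun X => rfl, hD.directSum hD'⟩
  set q := hwCoord b γ with hq
  set p : n ⊕ Fin (dimQ γ) → ℂ := Sum.elim v q with hp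
  have act : ∀ (A : Matrix n n ℂ) (B : Matrix (Fin (dimQ γ)) (Fin (dimQ γ)) ℂ) x y,
      Matrix.fromBlocks A 0 0 B *ᵥ Sum.elim x y = Sum.elim (A *ᵥ x) (B *ᵥ y) := by
    intro A B x y
    rw [Matrix.fromBlocks_mulVec]
    simp
  set W := Submodule.span ℂ (Set.range fun g => directSum R (rep b γ) g *ᵥ p) with hW
  have hpr : IsRaisingKilled DS p := fun i j hij => by
    rw [hDS, hp, act, hvr i j hij, hr' i j hij]
    ext (i | i) <;> rfl
  have hpw : HasWeight DS γ.1 p := fun i => by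
    rw [hDS, hp, act, hvγ i, hw' i]
    ext (i | i) <;> rfl
  have hWst : ∀ g, ∀ w ∈ W, directSum R (rep b γ) g *ᵥ w ∈ W := by
    intro g w hw
    induction hw using Submodule.span_induction with
    | mem w hw =>
      obtain ⟨g', rfl⟩ := hw
      refine Submodule.subset_span ⟨g * g', ?_⟩
      simp only [map_mul, Matrix.mulVec_mulVec]
    | zero => rw [Matrix.mulVec_zero]; exact Submodule.zero_mem _
    | add x y _ _ hx hy => rw [Matrix.mulVec_add]; exact Submodule.add_mem _ hx hy
    | smul c x _ hx => rw [Matrix.mulVec_smul]; exact Submodule.smul_mem _ c hx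
  have hsplit : ∀ w : n ⊕ Fin (dimQ γ) → ℂ, Sum.elim (w ∘ Sum.inl) (w ∘ Sum.inr) = w :=
    fun w => Sum.elim_comp_inl_inr w
  have hactg : ∀ g (w : n ⊕ Fin (dimQ γ) → ℂ), directSum R (rep b γ) g *ᵥ w =
      Sum.elim (R g *ᵥ (w ∘ Sum.inl)) (rep b γ g *ᵥ (w ∘ Sum.inr)) := fun g w => by
    conv_lhs => rw [← hsplit w]
    exact act _ _ _ _
  have hWV : ∀ w ∈ W, w ∘ Sum.inl ∈ V := by
    intro w hw
    induction hw using Submodule.span_induction with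
    | mem w hw =>
      obtain ⟨g', rfl⟩ := hw
      simp only [hactg, Sum.elim_comp_inl]
      exact hV _ _ hvV
    | zero => exact V.zero_mem
    | add x y _ _ hx hy => exact V.add_mem hx hy
    | smul c x _ hx => exact V.smul_mem c hx
  have hker : ∀ w ∈ W, w ∘ Sum.inr = 0 → w = 0 := by
    let K : Submodule ℂ (n ⊕ Fin (dimQ γ) → ℂ) :=
      W ⊓ LinearMap.ker (LinearMap.funLeft ℂ ℂ (Sum.inr : Fin (dimQ γ) → n ⊕ Fin (dimQ γ)))
    have hK : ∀ w, w ∈ K ↔ w ∈ W ∧ w ∘ Sum.inr = 0 := fun w => Iff.rfl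
    have hK0 : K = ⊥ := by
      by_contra hne
      obtain ⟨u, hu, hu0, hur, _⟩ := hS.exists_highestWeight hne (fun g w hw => by
        rw [hK] at hw ⊢
        refine ⟨hWst g w hw.1, ?_⟩
        rw [hactg, Sum.elim_comp_inr, hw.2, Matrix.mulVec_zero])
      rw [hK] at hu
      obtain ⟨c, hc⟩ := hS.eq_smul_of_isRaisingKilled hpr hpw hu.1 hur
      have h1 : c • q = 0 := by
        rw [← hu.2, hc]; rfl
      rcases smul_eq_zero.1 h1 with h2 | h2
      · exact hu0 (by rw [hc, h2, zero_smul])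
      · exact hwCoord_ne_zero b γ h2
    intro w hw hw0
    have : w ∈ K := (hK w).2 ⟨hw, hw0⟩
    rw [hK0] at this
    exact (Submodule.mem_bot ℂ).1 this
  have hsurj : ∀ x : Fin (dimQ γ) → ℂ, ∃ w ∈ W, w ∘ Sum.inr = x := by
    intro x
    have hx : x ∈ Submodule.span ℂ (Set.range fun g : U d => rep b γ g *ᵥ q) := by
      rw [hq, span_rep_hwCoord]; trivial
    induction hx using Submodule.span_induction with
    | mem x hx =>
      obtain ⟨g, rfl⟩ := hx
      exact ⟨_, Submodule.subset_span ⟨g, rfl⟩, by simp only [hactg, Sum.elim_comp_inr]; rfl⟩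
    | zero => exact ⟨0, W.zero_mem, rfl⟩
    | add x y _ _ hx hy =>
      obtain ⟨w, hw, rfl⟩ := hx
      obtain ⟨w', hw', rfl⟩ := hy
      exact ⟨w + w', W.add_mem hw hw', rfl⟩
    | smul c x _ hx =>
      obtain ⟨w, hw, rfl⟩ := hx
      exact ⟨c • w, W.smul_mem c hw, rfl⟩
  choose F hFW hF using hsurj
  have huniq : ∀ w ∈ W, F (w ∘ Sum.inr) = w := by
    intro w hw
    refine sub_eq_zero.1 (hker _ (W.sub_mem (hFW _) hw) ?_)
    change F (w ∘ Sum.inr) ∘ Sum.inr - w ∘ Sum.inr = 0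
    rw [hF, sub_self]
  let L : (Fin (dimQ γ) → ℂ) →ₗ[ℂ] (n → ℂ) :=
    { toFun := fun x => F x ∘ Sum.inl
      map_add' := fun x y => by
        have := huniq (F x + F y) (W.add_mem (hFW x) (hFW y))
        change F (F x ∘ Sum.inr + F y ∘ Sum.inr) = _ at this
        rw [hF, hF] at this
        rw [this]; rfl
      map_smul' := fun c x => by
        have := huniq (c • F x) (W.smul_mem c (hFW x))
        change F (c • (F x ∘ Sum.inr)) = _ at this
        rw [hF] at this
        rw [this]; rfl }
  have hL : ∀ x, LinearMap.toMatrix' L *ᵥ x = F x ∘ Sum.inl := fun x => by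
    rw [LinearMap.toMatrix'_mulVec]; rfl
  refine ⟨γ, LinearMap.toMatrix' L, fun g => ?_, fun h0 => ?_, fun x => ?_⟩
  · refine Matrix.ext_of_mulVec_single fun k => ?_
    rw [← Matrix.mulVec_mulVec, ← Matrix.mulVec_mulVec, hL, hL]
    set x : Fin (dimQ γ) → ℂ := Pi.single k 1
    have := huniq _ (hWst g (F x) (hFW x))
    rw [hactg, Sum.elim_comp_inr, hF] at this
    rw [this, Sum.elim_comp_inl]
  · have h1 := huniq p (Submodule.subset_span ⟨1, by simp⟩)
    have h2 := hL q
    rw [h0, Matrix.zero_mulVec] at h2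
    have h3 : p ∘ Sum.inr = q := Sum.elim_comp_inr _ _
    rw [h3] at h1
    rw [h1] at h2
    exact hv0 h2.symm
  · rw [hL]
    exact hWV _ (hFW x)

/-! ### Orthonormal families of intertwiners -/

theorem IsSmooth.unitary {R : MatRep d n} (hR : IsSmooth R) (g : U d) : (R g)ᴴ * R g = 1 :=
  let ⟨_, h⟩ := hR
  h.unitary g

theorem IsSmooth.unitary' {R : MatRep d n} (hR : IsSmooth R) (g : U d) : R g * (R g)ᴴ = 1 :=
  mul_eq_one_comm.1 (hR.unitary g)

theorem mul_mem_intertwiners {l : Type} [Fintype l] [DecidableEq l] {R : MatRep d m}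
    {S : MatRep d n} {P : MatRep d l} {M : Matrix n m ℂ} {N : Matrix l n ℂ}
    (hN : N ∈ intertwiners S P) (hM : M ∈ intertwiners R S) : N * M ∈ intertwiners R P :=
  fun g => by rw [← Matrix.mul_assoc, hN g, Matrix.mul_assoc, hM g, Matrix.mul_assoc]

theorem conjTranspose_mem_intertwiners {R : MatRep d m} {S : MatRep d n} (hR : IsSmooth R)
    (hS : IsSmooth S) {M : Matrix n m ℂ} (hM : M ∈ intertwiners R S) :
    Mᴴ ∈ intertwiners S R := fun g => by
  have h := congrArg Matrix.conjTranspose (hM g)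
  rw [Matrix.conjTranspose_mul, Matrix.conjTranspose_mul] at h
  calc R g * Mᴴ = R g * (Mᴴ * (S g)ᴴ) * S g := by
        rw [Matrix.mul_assoc, Matrix.mul_assoc, hS.unitary, Matrix.mul_one]
    _ = Mᴴ * S g := by
        rw [h, ← Matrix.mul_assoc, hR.unitary', Matrix.one_mul]

/-- An orthonormal basis of the space of intertwiners from `Q_γ` to `R`. -/
structure IsOrthoBasis (b : Bases d) (R : MatRep d n) (γ : Staircase d) {c : ℕ}
    (J : Fin c → Matrix n (Fin (dimQ γ)) ℂ) : Prop where
  card : c = Module.finrank ℂ (intertwiners (rep b γ) R)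
  mem : ∀ k, J k ∈ intertwiners (rep b γ) R
  ortho : ∀ k l, (J k)ᴴ * J l = if k = l then 1 else 0

theorem one_ne_zero_dimQ (γ : Staircase d) : (1 : Matrix (Fin (dimQ γ)) (Fin (dimQ γ)) ℂ) ≠ 0 := by
  have : Nonempty (Fin (dimQ γ)) := ⟨⟨0, dimQ_pos γ⟩⟩
  exact one_ne_zero

theorem dimQ_ne_zero (γ : Staircase d) : (dimQ γ : ℂ) ≠ 0 :=
  Nat.cast_ne_zero.2 (dimQ_pos γ).ne'

theorem linearIndependent_of_ortho {γ : Staircase d} {c : ℕ}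
    {J : Fin c → Matrix n (Fin (dimQ γ)) ℂ}
    (ho : ∀ k l, (J k)ᴴ * J l = if k = l then 1 else 0) : LinearIndependent ℂ J := by
  rw [Fintype.linearIndependent_iff]
  intro a ha k
  have h := congrArg (fun M => (J k)ᴴ * M) ha
  simp only [Matrix.mul_sum, Matrix.mul_smul, ho, smul_ite, smul_zero, Finset.sum_ite_eq,
    Finset.mem_univ, if_true, Matrix.mul_zero] at h
  exact (smul_eq_zero.1 h).resolve_right (one_ne_zero_dimQ γ)

theorem IsOrthoBasis.expand {b : Bases d} {R : MatRep d n} {γ : Staircase d} {c : ℕ}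
    {J : Fin c → Matrix n (Fin (dimQ γ)) ℂ} (hJ : IsOrthoBasis b R γ J)
    {M : Matrix n (Fin (dimQ γ)) ℂ} (hM : M ∈ intertwiners (rep b γ) R) :
    M = ∑ k, J k * ((J k)ᴴ * M) := by
  let J' : Fin c → intertwiners (rep b γ) R := fun k => ⟨J k, hJ.mem k⟩
  have hli : LinearIndependent ℂ J' :=
    LinearIndependent.of_comp (intertwiners (rep b γ) R).subtype
      (linearIndependent_of_ortho hJ.ortho)
  have hspan := hli.span_eq_top_of_card_eq_finrank' (by rw [Fintype.card_fin]; exact hJ.card)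
  have hmem : (⟨M, hM⟩ : intertwiners (rep b γ) R) ∈ Submodule.span ℂ (Set.range J') := by
    rw [hspan]; trivial
  obtain ⟨a, ha⟩ := (Submodule.mem_span_range_iff_exists_fun ℂ).1 hmem
  have ha' : ∑ k, a k • J k = M := by
    have := congrArg Subtype.val ha
    simpa [J'] using this
  rw [← ha']
  simp only [Matrix.mul_sum, Matrix.mul_smul, hJ.ortho, smul_ite, smul_zero,
    Finset.sum_ite_eq, Finset.mem_univ, if_true, Matrix.mul_one]

theorem eq_trace_div_smul_one (b : Bases d) {γ : Staircase d}
    {M : Matrix (Fin (dimQ γ)) (Fin (dimQ γ)) ℂ} (hM : M ∈ intertwiners (rep b γ) (rep b γ)) :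
    M = (M.trace / dimQ γ) • (1 : Matrix (Fin (dimQ γ)) (Fin (dimQ γ)) ℂ) := by
  obtain ⟨c, rfl⟩ := schur b hM
  rw [Matrix.trace_smul, Matrix.trace_one, Fintype.card_fin, smul_eq_mul,
    mul_div_cancel_right₀ _ (dimQ_ne_zero γ)]

theorem exists_isOrthoBasis (b : Bases d) {R : MatRep d n} (hR : IsSmooth R) (γ : Staircase d) :
    ∃ J : Fin (Module.finrank ℂ (intertwiners (rep b γ) R)) → Matrix n (Fin (dimQ γ)) ℂ,
      IsOrthoBasis b R γ J := by
  let L : Matrix n (Fin (dimQ γ)) ℂ →ₗ[ℂ] EuclideanSpace ℂ (n × Fin (dimQ γ)) :=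
    { toFun := fun M => WithLp.toLp 2 fun x => M x.1 x.2
      map_add' := fun _ _ => rfl
      map_smul' := fun _ _ => rfl }
  have hinj : Function.Injective L := by
    intro M N h
    ext i j
    exact congrFun (congrArg WithLp.ofLp h) (i, j)
  have hinner : ∀ M N, inner ℂ (L M) (L N) = (Mᴴ * N).trace := by
    intro M N
    rw [EuclideanSpace.inner_eq_star_dotProduct, Matrix.trace, dotProduct, Fintype.sum_prod_type,
      Finset.sum_comm]
    refine Finset.sum_congr rfl fun q _ => ?_
    rw [Matrix.diag_apply, Matrix.mul_apply]
    exact Finset.sum_congr rfl fun i _ => mul_comm _ _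
  set E := (intertwiners (rep b γ) R).map L with hE
  have hfr : Module.finrank ℂ E = Module.finrank ℂ (intertwiners (rep b γ) R) :=
    (Submodule.equivMapOfInjective L hinj _).finrank_eq.symm
  let e := (stdOrthonormalBasis ℂ E).reindex (finCongr hfr)
  have hex : ∀ k, ∃ M ∈ intertwiners (rep b γ) R, L M = (e k : EuclideanSpace ℂ _) :=
    fun k => (e k).2
  choose M hM hLM using hex
  have hs : ((Real.sqrt (dimQ γ) : ℝ) : ℂ) * ((Real.sqrt (dimQ γ) : ℝ) : ℂ) = dimQ γ := by
    rw [← Complex.ofReal_mul, Real.mul_self_sqrt (Nat.cast_nonneg _), Complex.ofReal_natCast]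
  refine ⟨fun k => ((Real.sqrt (dimQ γ) : ℝ) : ℂ) • M k, rfl,
    fun k => Submodule.smul_mem _ _ (hM k), fun k l => ?_⟩
  have h1 : (M k)ᴴ * M l ∈ intertwiners (rep b γ) (rep b γ) :=
    mul_mem_intertwiners (conjTranspose_mem_intertwiners (isSmooth_rep b γ) hR (hM k)) (hM l)
  have h2 : ((M k)ᴴ * M l).trace = if k = l then 1 else 0 := by
    rw [← hinner, hLM, hLM, ← Submodule.coe_inner]
    exact orthonormal_iff_ite.1 e.orthonormal k l
  rw [Matrix.conjTranspose_smul, Matrix.smul_mul, Matrix.mul_smul, smul_smul,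
    eq_trace_div_smul_one b h1, h2, smul_smul]
  have hstar : star ((Real.sqrt (dimQ γ) : ℝ) : ℂ) = ((Real.sqrt (dimQ γ) : ℝ) : ℂ) :=
    Complex.conj_ofReal _
  rw [hstar, hs]
  split_ifs
  · rw [mul_one_div_cancel (dimQ_ne_zero γ), one_smul]
  · rw [zero_div, mul_zero, zero_smul]

theorem conjTranspose_mul_eq_zero_of_ne (b : Bases d) {R : MatRep d n} (hR : IsSmooth R)
    {γ γ' : Staircase d} (hne : γ ≠ γ') {M : Matrix n (Fin (dimQ γ)) ℂ}
    {N : Matrix n (Fin (dimQ γ')) ℂ} (hM : M ∈ intertwiners (rep b γ) R)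
    (hN : N ∈ intertwiners (rep b γ') R) : Mᴴ * N = 0 :=
  schur_of_ne b hne.symm
    (mul_mem_intertwiners (conjTranspose_mem_intertwiners (isSmooth_rep b γ) hR hM) hN)

/-! ### Construction of Clebsch-Gordan transforms -/

theorem finite_labels (b : Bases d) {R : MatRep d m} {S : MatRep d n}
    (h : IsSmooth (tensor R S)) : (labels b R S).Finite := by
  choose J hJ using exists_isOrthoBasis b h
  let v : labels b R S → EuclideanSpace ℂ (m × n) := fun γ =>
    WithLp.toLp 2 fun x => J γ.1 ⟨0, γ.2⟩ x ⟨0, dimQ_pos γ.1⟩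
  have hv : Orthonormal ℂ v := by
    rw [orthonormal_iff_ite]
    intro γ γ'
    have e : inner ℂ (v γ) (v γ') = ((J γ.1 ⟨0, γ.2⟩)ᴴ * J γ'.1 ⟨0, γ'.2⟩)
        ⟨0, dimQ_pos γ.1⟩ ⟨0, dimQ_pos γ'.1⟩ := by
      rw [EuclideanSpace.inner_eq_star_dotProduct, dotProduct, Matrix.mul_apply]
      exact Finset.sum_congr rfl fun i _ => mul_comm _ _
    rw [e]
    split_ifs with hγ
    · subst hγ
      rw [(hJ γ.1).ortho, if_pos rfl, Matrix.one_apply_eq]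
    · rw [conjTranspose_mul_eq_zero_of_ne b h (fun h' => hγ (Subtype.ext h')) ((hJ _).mem _)
        ((hJ _).mem _), Matrix.zero_apply]
  have := hv.linearIndependent.finite
  exact Set.toFinite _

/-- The Clebsch-Gordan transform assembled from orthonormal bases of intertwiners. -/
def CGTransform.ofFamily (b : Bases d) {R : MatRep d m} {S : MatRep d n}
    (h : IsSmooth (tensor R S))
    (J : ∀ γ, Fin (mult b R S γ) → Matrix (m × n) (Fin (dimQ γ)) ℂ)
    (hJ : ∀ γ, IsOrthoBasis b (tensor R S) γ (J γ)) : CGTransform b R S :=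
  let supp := (finite_labels b h).toFinset
  let T : Matrix (Σ γ : supp, Fin (dimQ γ.1) × Fin (mult b R S γ.1)) (m × n) ℂ :=
    Matrix.of fun p x => star (J p.1.1 p.2.2 x p.2.1)
  have hTg : ∀ g : U d, T * tensor R S g =
      Matrix.blockDiagonal' (fun γ : supp =>
        rep b γ.1 g ⊗ₖ (1 : Matrix (Fin (mult b R S γ.1)) (Fin (mult b R S γ.1)) ℂ)) * T := by
    intro g
    ext ⟨γ, q, k⟩ x
    have e := congrFun (congrFun (conjTranspose_mem_intertwiners (isSmooth_rep b γ.1) h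
      ((hJ γ.1).mem k) g) q) x
    rw [Matrix.mul_apply, Matrix.mul_apply, Fintype.sum_sigma, Finset.sum_eq_single γ]
    · rw [Fintype.sum_prod_type (f := fun p : Fin (dimQ γ.1) × Fin (mult b R S γ.1) => _)]
      simp only [Matrix.blockDiagonal'_apply_eq, Matrix.kroneckerMap_apply, Matrix.one_apply,
        mul_ite, mul_one, mul_zero, ite_mul, zero_mul, Finset.sum_ite_eq, Finset.mem_univ, if_true]
      rw [Matrix.mul_apply, Matrix.mul_apply] at e
      exact e.symm
    · intro γ' _ hne
      refine Finset.sum_eq_zero fun p _ => ?_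
      rw [Matrix.blockDiagonal'_apply_ne _ _ _ hne.symm, zero_mul]
    · simp
  have h1 : T * Tᴴ = 1 := by
    ext ⟨γ, q, k⟩ ⟨γ', q', k'⟩
    have e : (T * Tᴴ) ⟨γ, q, k⟩ ⟨γ', q', k'⟩ = ((J γ.1 k)ᴴ * J γ'.1 k') q q' := by
      rw [Matrix.mul_apply, Matrix.mul_apply]
      refine Finset.sum_congr rfl fun x _ => ?_
      simp only [T, Matrix.conjTranspose_apply, Matrix.of_apply, star_star]
    rw [e]
    by_cases hγ : γ = γ'
    · subst hγ
      rw [(hJ γ.1).ortho]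
      by_cases hk : k = k'
      · subst hk
        rw [if_pos rfl, Matrix.one_apply, Matrix.one_apply]
        simp
      · rw [if_neg hk, Matrix.zero_apply, Matrix.one_apply_ne]
        intro h'
        simp at h'
        exact hk h'.2
    · rw [conjTranspose_mul_eq_zero_of_ne b h (fun h' => hγ (Subtype.ext h')) ((hJ _).mem _)
        ((hJ _).mem _), Matrix.zero_apply, Matrix.one_apply_ne]
      intro h'
      exact hγ (congrArg Sigma.fst h')
  { support := supp
    mem_support := fun γ => Set.Finite.mem_toFinset _
    mat := T
    mul_conjTranspose := h1
    conjTranspose_mul := by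
      have hker : LinearMap.ker (Matrix.mulVecLin T) = ⊥ := by
        by_contra hne
        obtain ⟨γ, M, hM, hM0, hMV⟩ := exists_intertwiner_of_stable b h hne (fun g v hv => by
          change T *ᵥ _ = 0
          have hv' : T *ᵥ v = 0 := hv
          rw [Matrix.mulVec_mulVec, hTg, ← Matrix.mulVec_mulVec, hv', Matrix.mulVec_zero])
        apply hM0
        rw [(hJ γ).expand hM]
        refine Finset.sum_eq_zero fun k _ => ?_
        have hz : (J γ k)ᴴ * M = 0 := by
          have hγ : γ ∈ supp := (Set.Finite.mem_toFinset _).2 k.pos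
          refine Matrix.ext_of_mulVec_single fun q => ?_
          rw [Matrix.zero_mulVec]
          funext p
          have h2 : T *ᵥ (M *ᵥ Pi.single q 1) = 0 := hMV _
          have h3 := congrFun h2 ⟨⟨γ, hγ⟩, p, k⟩
          rw [← Matrix.mulVec_mulVec]
          exact h3
        rw [hz, Matrix.mul_zero]
      refine Matrix.ext_of_mulVec_single fun x => ?_
      have h4 : (Tᴴ * T) *ᵥ Pi.single x 1 - (1 : Matrix (m × n) (m × n) ℂ) *ᵥ Pi.single x 1 ∈
          LinearMap.ker (Matrix.mulVecLin T) := by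
        change T *ᵥ _ = 0
        rw [Matrix.mulVec_sub, Matrix.mulVec_mulVec, Matrix.mulVec_mulVec, ← Matrix.mul_assoc, h1,
          Matrix.one_mul, Matrix.mul_one, sub_self]
      rw [hker, Submodule.mem_bot] at h4
      exact sub_eq_zero.1 h4
    commutes := fun g => hTg _ }

theorem CGTransform.embed_ofFamily (b : Bases d) {R : MatRep d m} {S : MatRep d n}
    (h : IsSmooth (tensor R S))
    (J : ∀ γ, Fin (mult b R S γ) → Matrix (m × n) (Fin (dimQ γ)) ℂ)
    (hJ : ∀ γ, IsOrthoBasis b (tensor R S) γ (J γ)) (γ : Staircase d)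
    (ψ : Fin (mult b R S γ) → ℂ) :
    (CGTransform.ofFamily b h J hJ).embed γ ψ = ∑ k, ψ k • J γ k := by
  ext x q
  simp [CGTransform.embed, CGTransform.ofFamily, Matrix.sum_apply, mul_comm]

theorem exists_CGTransform (b : Bases d) {R : MatRep d m} {S : MatRep d n}
    (h : IsSmooth (tensor R S)) : Nonempty (CGTransform b R S) := by
  choose J hJ using exists_isOrthoBasis b h
  exact ⟨CGTransform.ofFamily b h J hJ⟩

theorem exists_CGTransform_embed_eq (b : Bases d) {R : MatRep d m} {S : MatRep d n}
    (h : IsSmooth (tensor R S)) (γ : Staircase d)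
    {K : Fin (mult b R S γ) → Matrix (m × n) (Fin (dimQ γ)) ℂ}
    (hK : IsOrthoBasis b (tensor R S) γ K) :
    ∃ T : CGTransform b R S, ∀ ψ, T.embed γ ψ = ∑ k, ψ k • K k := by
  choose J hJ using exists_isOrthoBasis b h
  let J' : ∀ γ, Fin (mult b R S γ) → Matrix (m × n) (Fin (dimQ γ)) ℂ := J
  refine ⟨CGTransform.ofFamily b h (Function.update J' γ K) fun γ' => ?_, fun ψ => ?_⟩
  · by_cases hγ : γ' = γ
    · subst hγ
      rw [Function.update_self]
      exact hK
    · rw [Function.update_of_ne hγ]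
      exact hJ γ'
  · rw [CGTransform.embed_ofFamily, Function.update_self]

/-! ### From `SU(d)` to `U(d)` -/

/-- Scalar matrices act by scalars. -/
def HasScalarCenter (R : MatRep d n) : Prop :=
  ∀ (g : U d) (z : ℂ), (g : Matrix (Fin d) (Fin d) ℂ) = z • 1 → ∃ c : ℂ, R g = c • 1

theorem exists_center_mul_incl (g : U d) :
    ∃ (u : U d) (s : SU d) (z : ℂ), (u : Matrix (Fin d) (Fin d) ℂ) = z • 1 ∧
      g = u * SU.incl s := by
  have hdet : ‖(g : Matrix (Fin d) (Fin d) ℂ).det‖ = 1 := by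
    have h := Matrix.det_of_mem_unitary g.2
    exact CStarRing.norm_of_mem_unitary h
  have hz : ∃ z : ℂ, ‖z‖ = 1 ∧ z ^ d = (g : Matrix (Fin d) (Fin d) ℂ).det := by
    rcases Nat.eq_zero_or_pos d with rfl | hd
    · exact ⟨1, norm_one, by simp⟩
    · obtain ⟨z, hz⟩ := IsAlgClosed.exists_pow_nat_eq (g : Matrix (Fin d) (Fin d) ℂ).det hd
      refine ⟨z, ?_, hz⟩
      rw [← hz, norm_pow] at hdet
      exact (pow_eq_one_iff_of_nonneg (norm_nonneg z) hd.ne').1 hdet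
  obtain ⟨z, hz1, hz⟩ := hz
  have hz0 : z ≠ 0 := fun h => by simp [h] at hz1
  have hzs : z * star z = 1 := by
    rw [Complex.star_def, Complex.mul_conj, Complex.normSq_eq_norm_sq, hz1]
    simp
  have hgg : (g : Matrix (Fin d) (Fin d) ℂ) * (g : Matrix (Fin d) (Fin d) ℂ)ᴴ = 1 :=
    Matrix.mem_unitaryGroup_iff.1 g.2
  let u : U d := ⟨z • 1, by
    rw [Matrix.mem_unitaryGroup_iff, star_smul, star_one, smul_mul_smul_comm, hzs, one_smul,
      one_mul]⟩
  let s : SU d := ⟨star z • (g : Matrix (Fin d) (Fin d) ℂ), by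
    rw [Matrix.mem_specialUnitaryGroup_iff]
    constructor
    · rw [Matrix.mem_unitaryGroup_iff, star_smul, star_star, smul_mul_smul_comm, mul_comm, hzs,
        one_smul]
      exact hgg
    · rw [Matrix.det_smul, Fintype.card_fin, ← hz, ← mul_pow, mul_comm, hzs, one_pow]⟩
  refine ⟨u, s, z, rfl, Subtype.ext ?_⟩
  change (g : Matrix (Fin d) (Fin d) ℂ) = (z • 1) * (star z • (g : Matrix (Fin d) (Fin d) ℂ))
  rw [smul_mul_smul_comm, hzs, one_smul, one_mul]

theorem hasScalarCenter_tensorMat (γ : Staircase d) : HasScalarCenter (tensorMat γ) := by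
  intro g z hg
  refine ⟨(g : Matrix (Fin d) (Fin d) ℂ).det ^ γ.last * z ^ Fintype.card (Box γ), ?_⟩
  ext f f'
  change (g : Matrix (Fin d) (Fin d) ℂ).det ^ γ.last *
    ∏ x, (g : Matrix (Fin d) (Fin d) ℂ) (f x) (f' x) = _
  rw [Matrix.smul_apply, Matrix.one_apply, smul_eq_mul]
  split_ifs with h
  · subst h
    rw [mul_one]
    congr 1
    rw [hg]
    simp
  · obtain ⟨x, hx⟩ := Function.ne_iff.1 h
    rw [Finset.prod_eq_zero (Finset.mem_univ x), mul_zero, mul_zero]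
    rw [hg]
    simp [Matrix.one_apply_ne hx]

theorem hasScalarCenter_rep (b : Bases d) (γ : Staircase d) : HasScalarCenter (rep b γ) := by
  intro g z hg
  obtain ⟨c, hc⟩ := hasScalarCenter_tensorMat γ g z hg
  refine ⟨c, ?_⟩
  have h := tensorMat_mul_basisMat b γ g
  have h2 := congrArg (fun M => (basisMat b γ)ᴴ * M) h
  simp only [← Matrix.mul_assoc, basisMat_isometry, Matrix.one_mul] at h2
  rw [← h2, hc, Matrix.mul_smul, Matrix.mul_one, Matrix.smul_mul, basisMat_isometry]

theorem HasScalarCenter.conjRep {R : MatRep d n} (h : HasScalarCenter R) :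
    HasScalarCenter (conjRep R) := by
  intro g z hg
  obtain ⟨c, hc⟩ := h g z hg
  refine ⟨star c, ?_⟩
  change (R g).map star = _
  rw [hc]
  ext i j
  by_cases h : i = j <;> simp [h]

theorem HasScalarCenter.tensor {R : MatRep d m} {S : MatRep d n} (h : HasScalarCenter R)
    (h' : HasScalarCenter S) : HasScalarCenter (tensor R S) := by
  intro g z hg
  obtain ⟨c, hc⟩ := h g z hg
  obtain ⟨c', hc'⟩ := h' g z hg
  refine ⟨c * c', ?_⟩
  change R g ⊗ₖ S g = _
  rw [hc, hc', Matrix.smul_kronecker, Matrix.kronecker_smul, Matrix.one_kronecker_one, smul_smul]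

theorem mem_intertwiners_of_SU {R : MatRep d m} {S : MatRep d n} (hR : HasScalarCenter R)
    (hS : HasScalarCenter S) {N : Matrix n m ℂ} (hN : N ∈ intertwiners R S) (hN0 : N ≠ 0)
    {M : Matrix n m ℂ} (hM : ∀ s : SU d, S (SU.incl s) * M = M * R (SU.incl s)) :
    M ∈ intertwiners R S := by
  intro g
  obtain ⟨u, s, z, hu, rfl⟩ := exists_center_mul_incl g
  obtain ⟨c, hc⟩ := hR u z hu
  obtain ⟨c', hc'⟩ := hS u z hu
  have h := hN u
  rw [hc, hc', Matrix.smul_mul, Matrix.one_mul, Matrix.mul_smul, Matrix.mul_one] at h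
  have hcc : c' = c := by
    have : (c' - c) • N = 0 := by rw [sub_smul, h, sub_self]
    exact sub_eq_zero.1 ((smul_eq_zero.1 this).resolve_right hN0)
  simp only [map_mul, hc, hc', hcc, Matrix.smul_mul, Matrix.one_mul, Matrix.mul_smul, hM]

theorem commutes_of_SU {R : MatRep d n} (hR : HasScalarCenter R) {M : Matrix n n ℂ}
    (hM : ∀ s : SU d, R (SU.incl s) * M = M * R (SU.incl s)) : M ∈ intertwiners R R := by
  intro g
  obtain ⟨u, s, z, hu, rfl⟩ := exists_center_mul_incl g
  obtain ⟨c, hc⟩ := hR u z hu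
  rw [map_mul, hc, Matrix.smul_mul, Matrix.one_mul, Matrix.smul_mul, Matrix.mul_smul, hM]

/-! ### The intertwiners carried by a Clebsch-Gordan transform -/

namespace CGTransform

variable {b : Bases d} {R : MatRep d m} {S : MatRep d n} (T : CGTransform b R S)

/-- The embeddings along the standard basis of the multiplicity space. -/
def family (γ : Staircase d) (k : Fin (mult b R S γ)) : Matrix (m × n) (Fin (dimQ γ)) ℂ :=
  Matrix.of fun x q => T.matᴴ x ⟨⟨γ, (T.mem_support γ).2 k.pos⟩, (q, k)⟩

theorem embed_eq_sum (γ : Staircase d) (ψ : Fin (mult b R S γ) → ℂ) :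
    T.embed γ ψ = ∑ k, ψ k • T.family γ k := by
  ext x q
  simp [embed, family, Matrix.sum_apply, mul_comm]

theorem family_conjTranspose_mul (γ γ' : Staircase d) (k : Fin (mult b R S γ))
    (k' : Fin (mult b R S γ')) (q : Fin (dimQ γ)) (q' : Fin (dimQ γ')) :
    ((T.family γ k)ᴴ * T.family γ' k') q q' =
      (1 : Matrix (Σ γ : T.support, Fin (dimQ γ.1) × Fin (mult b R S γ.1))
        (Σ γ : T.support, Fin (dimQ γ.1) × Fin (mult b R S γ.1)) ℂ)
        ⟨⟨γ, (T.mem_support γ).2 k.pos⟩, (q, k)⟩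
        ⟨⟨γ', (T.mem_support γ').2 k'.pos⟩, (q', k')⟩ := by
  rw [← T.mul_conjTranspose, Matrix.mul_apply, Matrix.mul_apply]
  simp [family]

theorem family_ortho (γ : Staircase d) (k l : Fin (mult b R S γ)) :
    (T.family γ k)ᴴ * T.family γ l = if k = l then 1 else 0 := by
  ext q q'
  rw [family_conjTranspose_mul, Matrix.one_apply]
  by_cases h : k = l
  · subst h
    rw [if_pos rfl, Matrix.one_apply]
    simp
  · rw [if_neg h, if_neg, Matrix.zero_apply]
    intro h'
    simp at h'
    exact h h'.2

theorem family_mem (hR : HasScalarCenter (tensor R S)) (γ : Staircase d)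
    (k : Fin (mult b R S γ)) : T.family γ k ∈ intertwiners (rep b γ) (tensor R S) := by
  have hpos : 0 < Module.finrank ℂ (intertwiners (rep b γ) (tensor R S)) := k.pos
  have := Module.nontrivial_of_finrank_pos hpos
  obtain ⟨N, hN⟩ := exists_ne (0 : intertwiners (rep b γ) (tensor R S))
  refine mem_intertwiners_of_SU (hasScalarCenter_rep b γ) hR N.2 (fun h => hN (Subtype.ext h)) ?_
  intro s
  have h1 := T.commutes s
  set B := Matrix.blockDiagonal' (fun γ : T.support =>
        rep b γ.1 (SU.incl s) ⊗ₖ (1 : Matrix (Fin (mult b R S γ.1)) (Fin (mult b R S γ.1)) ℂ))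
    with hB
  have h2 : tensor R S (SU.incl s) * T.matᴴ = T.matᴴ * B := by
    calc tensor R S (SU.incl s) * T.matᴴ
        = T.matᴴ * (T.mat * tensor R S (SU.incl s)) * T.matᴴ := by
          rw [← Matrix.mul_assoc, T.conjTranspose_mul, Matrix.one_mul]
      _ = T.matᴴ * B := by
          rw [h1, Matrix.mul_assoc, Matrix.mul_assoc, T.mul_conjTranspose, Matrix.mul_one]
  ext x q
  have h3 := congrFun (congrFun h2 x) ⟨⟨γ, (T.mem_support γ).2 k.pos⟩, (q, k)⟩
  rw [Matrix.mul_apply] at h3 ⊢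
  refine h3.trans ?_
  rw [Matrix.mul_apply, Matrix.mul_apply, Fintype.sum_sigma,
    Finset.sum_eq_single ⟨γ, (T.mem_support γ).2 k.pos⟩]
  · rw [Fintype.sum_prod_type]
    simp [hB, Matrix.one_apply, family]
  · intro γ' _ hne
    refine Finset.sum_eq_zero fun p _ => ?_
    rw [hB, Matrix.blockDiagonal'_apply_ne _ _ _ hne, mul_zero]
  · simp

end CGTransform

/-! ### Extreme points of the set of normalized families of positive matrices -/

open scoped MatrixOrder in
theorem _root_.Matrix.PosSemidef.exists_eq_conjTranspose_mul_self {A : Matrix n n ℂ}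
    (hA : A.PosSemidef) : ∃ B : Matrix n n ℂ, A = Bᴴ * B :=
  CStarAlgebra.nonneg_iff_eq_star_mul_self.mp hA.nonneg

theorem star_dotProduct_self_eq_sum (ψ : n → ℂ) :
    star ψ ⬝ᵥ ψ = ((∑ k, ‖ψ k‖ ^ 2 : ℝ) : ℂ) := by
  rw [dotProduct, Complex.ofReal_sum]
  refine Finset.sum_congr rfl fun k _ => ?_
  rw [Pi.star_apply, mul_comm, Complex.star_def, Complex.mul_conj, Complex.normSq_eq_norm_sq]

theorem unit_iff (ψ : n → ℂ) : ∑ k, ‖ψ k‖ ^ 2 = 1 ↔ star ψ ⬝ᵥ ψ = 1 := by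
  rw [star_dotProduct_self_eq_sum]
  norm_cast

theorem exists_spectral_decomposition {A : Matrix n n ℂ} (hA : A.PosSemidef) :
    ∃ (e : n → ℝ) (u : n → n → ℂ), (∀ k, 0 ≤ e k) ∧ (∀ k, star (u k) ⬝ᵥ u k = 1) ∧
      A = ∑ k, (e k : ℂ) • Matrix.vecMulVec (u k) (star (u k)) := by
  have hH := hA.isHermitian
  set V : Matrix n n ℂ := (hH.eigenvectorUnitary : Matrix n n ℂ) with hV
  have hVV : Vᴴ * V = 1 := Matrix.mem_unitaryGroup_iff'.1 hH.eigenvectorUnitary.2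
  refine ⟨hH.eigenvalues, fun k i => V i k, hA.eigenvalues_nonneg, fun k => ?_, ?_⟩
  · have := congrFun (congrFun hVV k) k
    rwa [Matrix.mul_apply, Matrix.one_apply_eq] at this
  · have h := hH.spectral_theorem
    rw [Unitary.conjStarAlgAut_apply] at h
    conv_lhs => rw [h]
    ext i j
    rw [Matrix.mul_apply, Matrix.sum_apply]
    refine Finset.sum_congr rfl fun k _ => ?_
    rw [Matrix.mul_diagonal, Matrix.smul_apply, Matrix.vecMulVec_apply, smul_eq_mul]
    change V i k * (hH.eigenvalues k : ℂ) * star (V j k) = _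
    rw [Pi.star_apply]
    ring

theorem trace_vecMulVec_star (ψ : n → ℂ) :
    (Matrix.vecMulVec ψ (star ψ)).trace = star ψ ⬝ᵥ ψ := by
  rw [Matrix.trace_vecMulVec, dotProduct_comm]

theorem mulVec_eq_zero_of_convex_combination {y z : Matrix n n ℂ} (hy : y.PosSemidef)
    (hz : z.PosSemidef) {a b : ℝ} (ha : 0 < a) (hb : 0 < b) {φ : n → ℂ}
    (h : (a • y + b • z) *ᵥ φ = 0) : y *ᵥ φ = 0 := by
  rw [← hy.dotProduct_mulVec_zero_iff]
  have h1 := congrArg (fun v => star φ ⬝ᵥ v) h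
  simp only [Matrix.add_mulVec, Matrix.smul_mulVec, dotProduct_add, dotProduct_smul,
    dotProduct_zero] at h1
  have hy0 := hy.dotProduct_mulVec_nonneg φ
  have hz0 := hz.dotProduct_mulVec_nonneg φ
  have h2 : a • (star φ ⬝ᵥ y *ᵥ φ) = 0 := by
    refine le_antisymm ?_ (smul_nonneg ha.le hy0)
    rw [← h1]
    exact le_add_of_nonneg_right (smul_nonneg hb.le hz0)
  exact (smul_eq_zero.1 h2).resolve_left ha.ne'

theorem eq_smul_vecMulVec {y : Matrix n n ℂ} (hy : y.IsHermitian) {ψ : n → ℂ}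
    (hψ : star ψ ⬝ᵥ ψ = 1) (h : ∀ φ, star ψ ⬝ᵥ φ = 0 → y *ᵥ φ = 0) :
    ∃ t : ℂ, y = t • Matrix.vecMulVec ψ (star ψ) := by
  have h1 : y = Matrix.vecMulVec (y *ᵥ ψ) (star ψ) := by
    refine Matrix.ext_of_mulVec_single fun k => ?_
    set φ : n → ℂ := Pi.single k 1
    have h2 := h (φ - (star ψ ⬝ᵥ φ) • ψ) (by
      rw [dotProduct_sub, dotProduct_smul, hψ, smul_eq_mul, mul_one, sub_self])
    rw [Matrix.mulVec_sub, Matrix.mulVec_smul, sub_eq_zero] at h2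
    rw [h2, Matrix.vecMulVec_mulVec]
    simp
  have h3 : y = Matrix.vecMulVec ψ (star (y *ᵥ ψ)) := by
    conv_lhs => rw [← hy.eq, h1, Matrix.conjTranspose_vecMulVec, star_star]
  refine ⟨star (y *ᵥ ψ) ⬝ᵥ ψ, ?_⟩
  have h4 : y *ᵥ ψ = (star (y *ᵥ ψ) ⬝ᵥ ψ) • ψ := by
    conv_lhs => rw [h3, Matrix.vecMulVec_mulVec]
    simp
  conv_lhs => rw [h1, h4, Matrix.smul_vecMulVec]

section NormalizedFamilies

variable {ι : Type} [Fintype ι] [DecidableEq ι] (c : ι → ℕ) (w : ι → ℕ) (W : ℕ)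

/-- Families of positive semidefinite matrices with fixed weighted trace. -/
def normalizedFamilies : Set (∀ i, Matrix (Fin (c i)) (Fin (c i)) ℂ) :=
  {P | (∀ i, (P i).PosSemidef) ∧ ∑ i, (w i : ℂ) * (P i).trace = W}

variable {c w W}

/-- The family concentrated at `i` with a rank one matrix there. -/
def rankOneFamily (c w : ι → ℕ) (W : ℕ) (i : ι) (ψ : Fin (c i) → ℂ) :
    ∀ i, Matrix (Fin (c i)) (Fin (c i)) ℂ :=
  Pi.single i (((W : ℂ) / (w i : ℂ)) • Matrix.vecMulVec ψ (star ψ))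

theorem rankOneFamily_mem (hw : ∀ i, 0 < w i) (i : ι) {ψ : Fin (c i) → ℂ}
    (hψ : star ψ ⬝ᵥ ψ = 1) : rankOneFamily c w W i ψ ∈ normalizedFamilies c w W := by
  constructor
  · intro j
    by_cases h : j = i
    · subst h
      rw [rankOneFamily, Pi.single_eq_same]
      refine (Matrix.posSemidef_vecMulVec_self_star ψ).smul ?_
      exact div_nonneg (Nat.cast_nonneg _) (Nat.cast_nonneg _)
    · rw [rankOneFamily, Pi.single_eq_of_ne h]
      exact Matrix.PosSemidef.zero
  · rw [Finset.sum_eq_single i]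
    · rw [rankOneFamily, Pi.single_eq_same, Matrix.trace_smul, trace_vecMulVec_star, hψ,
        smul_eq_mul, mul_one, mul_div_cancel₀]
      exact Nat.cast_ne_zero.2 (hw i).ne'
    · intro j _ h
      rw [rankOneFamily, Pi.single_eq_of_ne h, Matrix.trace_zero, mul_zero]
    · simp

theorem convex_normalizedFamilies : Convex ℝ (normalizedFamilies c w W) := by
  intro P hP Q hQ a b ha hb hab
  constructor
  · intro i
    exact ((hP.1 i).smul ha).add ((hQ.1 i).smul hb)
  · have e : ∀ i, (w i : ℂ) * ((a • P + b • Q) i).trace =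
        (a : ℂ) * ((w i : ℂ) * (P i).trace) + (b : ℂ) * ((w i : ℂ) * (Q i).trace) := by
      intro i
      rw [Pi.add_apply, Pi.smul_apply, Pi.smul_apply, Matrix.trace_add, Matrix.trace_smul,
        Matrix.trace_smul, Complex.real_smul, Complex.real_smul]
      ring
    simp only [e, Finset.sum_add_distrib, ← Finset.mul_sum, hP.2, hQ.2]
    rw [← add_mul, ← Complex.ofReal_add, hab, Complex.ofReal_one, one_mul]

theorem mem_convexHull_rankOne (hw : ∀ i, 0 < w i) (hW : 0 < W)
    {P : ∀ i, Matrix (Fin (c i)) (Fin (c i)) ℂ} (hP : P ∈ normalizedFamilies c w W) :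
    P ∈ convexHull ℝ {Q | ∃ (i : ι) (ψ : Fin (c i) → ℂ), star ψ ⬝ᵥ ψ = 1 ∧
      Q = rankOneFamily c w W i ψ} := by
  choose e u he hu hdec using fun i => exists_spectral_decomposition (hP.1 i)
  have hw' : ∀ i, (w i : ℝ) ≠ 0 := fun i => Nat.cast_ne_zero.2 (hw i).ne'
  have hW' : (W : ℝ) ≠ 0 := Nat.cast_ne_zero.2 hW.ne'
  have hsum : P = ∑ x : (Σ i, Fin (c i)), ((w x.1 : ℝ) * e x.1 x.2 / W) •
      rankOneFamily c w W x.1 (u x.1 x.2) := by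
    rw [Fintype.sum_sigma]
    funext j
    rw [Finset.sum_apply, Finset.sum_eq_single j]
    · rw [Finset.sum_apply]
      conv_lhs => rw [hdec j]
      refine Finset.sum_congr rfl fun k _ => ?_
      rw [Pi.smul_apply, rankOneFamily, Pi.single_eq_same, ← Complex.coe_smul, smul_smul]
      congr 1
      have h1 : (w j : ℂ) ≠ 0 := Nat.cast_ne_zero.2 (hw j).ne'
      have h2 : (W : ℂ) ≠ 0 := Nat.cast_ne_zero.2 hW.ne'
      push_cast
      field_simp
    · intro i _ hij
      rw [Finset.sum_apply]
      refine Finset.sum_eq_zero fun k _ => ?_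
      rw [Pi.smul_apply, rankOneFamily, Pi.single_eq_of_ne hij.symm, smul_zero]
    · simp
  have hone : ∑ x : (Σ i, Fin (c i)), ((w x.1 : ℝ) * e x.1 x.2 / W) = 1 := by
    have h1 := hP.2
    have h2 : ∀ i, (P i).trace = ((∑ k, e i k : ℝ) : ℂ) := by
      intro i
      rw [hdec i, Matrix.trace_sum, Complex.ofReal_sum]
      refine Finset.sum_congr rfl fun k _ => ?_
      rw [Matrix.trace_smul, trace_vecMulVec_star, hu, smul_eq_mul, mul_one]
    simp only [h2] at h1
    have h3 : ∑ i, (w i : ℝ) * ∑ k, e i k = W := by exact_mod_cast h1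
    rw [Fintype.sum_sigma]
    simp only [← Finset.sum_div, ← Finset.mul_sum]
    rw [h3, div_self hW']
  rw [hsum]
  refine (convex_convexHull ℝ _).sum_mem (fun x _ => ?_) hone fun x _ => ?_
  · exact div_nonneg (mul_nonneg (Nat.cast_nonneg _) (he _ _)) (Nat.cast_nonneg _)
  · exact subset_convexHull ℝ _ ⟨x.1, u x.1 x.2, hu _ _, rfl⟩

theorem extremePoints_normalizedFamilies (hw : ∀ i, 0 < w i) (hW : 0 < W) :
    Set.extremePoints ℝ (normalizedFamilies c w W) =
      {Q | ∃ (i : ι) (ψ : Fin (c i) → ℂ), star ψ ⬝ᵥ ψ = 1 ∧ Q = rankOneFamily c w W i ψ} := by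
  apply Set.Subset.antisymm
  · have hK : normalizedFamilies c w W = convexHull ℝ {Q | ∃ (i : ι) (ψ : Fin (c i) → ℂ),
        star ψ ⬝ᵥ ψ = 1 ∧ Q = rankOneFamily c w W i ψ} := by
      refine Set.Subset.antisymm (fun P hP => mem_convexHull_rankOne hw hW hP) ?_
      refine convexHull_min ?_ convex_normalizedFamilies
      rintro _ ⟨i, ψ, hψ, rfl⟩
      exact rankOneFamily_mem hw i hψ
    rw [hK]
    exact extremePoints_convexHull_subset
  · rintro _ ⟨i, ψ, hψ, rfl⟩
    refine ⟨rankOneFamily_mem hw i hψ, fun y hy z hz hx => ?_⟩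
    obtain ⟨a, b, ha, hb, -, hab⟩ := hx
    have hker : ∀ j φ, rankOneFamily c w W i ψ j *ᵥ φ = 0 → y j *ᵥ φ = 0 := by
      intro j φ h
      rw [← hab] at h
      exact mulVec_eq_zero_of_convex_combination (hy.1 j) (hz.1 j) ha hb h
    have hoff : ∀ j, j ≠ i → y j = 0 := by
      intro j hj
      refine Matrix.ext_of_mulVec_single fun k => ?_
      rw [Matrix.zero_mulVec]
      refine hker j _ ?_
      rw [rankOneFamily, Pi.single_eq_of_ne hj, Matrix.zero_mulVec]
    obtain ⟨t, ht⟩ := eq_smul_vecMulVec (hy.1 i).isHermitian hψ fun φ hφ => hker i φ (by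
      rw [rankOneFamily, Pi.single_eq_same, Matrix.smul_mulVec, Matrix.vecMulVec_mulVec, hφ]
      simp)
    have hw' : (w i : ℂ) ≠ 0 := Nat.cast_ne_zero.2 (hw i).ne'
    have htr := hy.2
    rw [Finset.sum_eq_single i (fun j _ hj => by rw [hoff j hj, Matrix.trace_zero, mul_zero])
      (by simp), ht, Matrix.trace_smul, trace_vecMulVec_star, hψ, smul_eq_mul, mul_one] at htr
    funext j
    by_cases hj : j = i
    · subst hj
      rw [ht, rankOneFamily, Pi.single_eq_same, ← htr, mul_div_cancel_left₀ _ hw']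
    · rw [hoff j hj, rankOneFamily, Pi.single_eq_of_ne hj]

end NormalizedFamilies

theorem extremePoints_image_of_injective {E F : Type*} [AddCommGroup E] [Module ℝ E]
    [AddCommGroup F] [Module ℝ F] (f : E →ₗ[ℝ] F) (hf : Function.Injective f) (s : Set E) :
    Set.extremePoints ℝ (f '' s) = f '' Set.extremePoints ℝ s := by
  ext x
  constructor
  · rintro ⟨⟨y, hy, rfl⟩, h⟩
    refine ⟨y, ⟨hy, fun x₁ h₁ x₂ h₂ hx => ?_⟩, rfl⟩
    refine hf (h ⟨x₁, h₁, rfl⟩ ⟨x₂, h₂, rfl⟩ ?_)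
    have := Set.mem_image_of_mem f.toAffineMap hx
    rwa [image_openSegment] at this
  · rintro ⟨y, ⟨hy, h⟩, rfl⟩
    refine ⟨⟨y, hy, rfl⟩, ?_⟩
    rintro _ ⟨x₁, h₁, rfl⟩ _ ⟨x₂, h₂, rfl⟩ hx
    have : f y ∈ f.toAffineMap '' openSegment ℝ x₁ x₂ := by
      rw [image_openSegment]; exact hx
    obtain ⟨y', hy', he⟩ := this
    have : y' = y := hf he
    subst this
    rw [h h₁ h₂ hy']

/-! ### Choi matrices of equivariant channels -/

theorem choi_apply (Φ : Matrix m m ℂ →ₗ[ℂ] Matrix n n ℂ) (i j : m) (a a' : n) :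
    choi Φ (i, a) (j, a') = Φ (Matrix.single i j 1) a a' := by
  simp [choi, Matrix.sum_apply, Matrix.single_apply, ite_and]

theorem ofChoi_apply (C : Matrix (m × n) (m × n) ℂ) (A : Matrix m m ℂ) (a a' : n) :
    ofChoi C A a a' = ∑ i, ∑ j, A i j * C (i, a) (j, a') := rfl

theorem isCP_ofChoi {C : Matrix (m × n) (m × n) ℂ} (hC : C.PosSemidef) : IsCP (ofChoi C) := by
  intro k X hX
  obtain ⟨L, rfl⟩ := hX.exists_eq_conjTranspose_mul_self
  obtain ⟨N, rfl⟩ := hC.exists_eq_conjTranspose_mul_self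
  let Z : Matrix ((Fin k × m) × (m × n)) (Fin k × n) ℂ :=
    Matrix.of fun st p => ∑ i, L st.1 (p.1, i) * N st.2 (i, p.2)
  have e : (Matrix.of fun p q : Fin k × n =>
      ofChoi (Nᴴ * N) (Matrix.of fun i j => (Lᴴ * L) (p.1, i) (q.1, j)) p.2 q.2) = Zᴴ * Z := by
    ext p q
    rw [Matrix.of_apply, ofChoi_apply, Matrix.mul_apply, Fintype.sum_prod_type]
    simp only [Matrix.of_apply, Matrix.mul_apply, Matrix.conjTranspose_apply, Z, star_sum,
      Finset.sum_mul_sum, star_mul']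
    rw [Finset.sum_congr rfl fun s _ => Finset.sum_comm]
    rw [Finset.sum_comm]
    refine Finset.sum_congr rfl fun i _ => ?_
    rw [Finset.sum_congr rfl fun s _ => Finset.sum_comm]
    rw [Finset.sum_comm]
    refine Finset.sum_congr rfl fun j _ => Finset.sum_congr rfl fun s _ =>
      Finset.sum_congr rfl fun t _ => ?_
    ring
  rw [e]
  exact Matrix.posSemidef_conjTranspose_mul_self Z

theorem posSemidef_choi_of_isCP {k : ℕ} {Φ : Matrix (Fin k) (Fin k) ℂ →ₗ[ℂ] Matrix n n ℂ}
    (h : IsCP Φ) : (choi Φ).PosSemidef := by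
  let ω : Fin k × Fin k → ℂ := fun p => if p.1 = p.2 then 1 else 0
  have h1 := h k (Matrix.vecMulVec ω (star ω)) (Matrix.posSemidef_vecMulVec_self_star ω)
  convert h1 using 1
  ext ⟨p, a⟩ ⟨q, a'⟩
  rw [choi_apply, Matrix.of_apply]
  have e : Matrix.single p q (1 : ℂ) =
      Matrix.of fun i j => Matrix.vecMulVec ω (star ω) (p, i) (q, j) := by
    ext i j
    rw [Matrix.single_apply, Matrix.of_apply, Matrix.vecMulVec_apply]
    by_cases h1 : p = i <;> by_cases h2 : q = j <;> simp [ω, h1, h2]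
  rw [e]

theorem trace_ofChoi (C : Matrix (m × n) (m × n) ℂ) (A : Matrix m m ℂ) :
    (ofChoi C A).trace = ∑ i, ∑ j, A i j * traceSnd C i j := by
  simp only [Matrix.trace, Matrix.diag_apply, ofChoi_apply, traceSnd, Matrix.of_apply,
    Finset.mul_sum]
  rw [Finset.sum_comm]
  exact Finset.sum_congr rfl fun i _ => Finset.sum_comm

theorem trace_ofChoi_eq_iff (C : Matrix (m × n) (m × n) ℂ) :
    (∀ A, (ofChoi C A).trace = A.trace) ↔ traceSnd C = 1 := by
  constructor
  · intro h
    ext i j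
    have := h (Matrix.single i j 1)
    rw [trace_ofChoi, Finset.sum_eq_single i (fun k _ hk => Finset.sum_eq_zero fun l _ => by
        rw [Matrix.single_apply_of_row_ne hk.symm, zero_mul]) (by simp),
      Finset.sum_eq_single j (fun l _ hl => by
        rw [Matrix.single_apply_of_col_ne _ _ hl.symm, zero_mul]) (by simp),
      Matrix.single_apply_same, one_mul] at this
    rw [this, Matrix.one_apply]
    split_ifs with hij
    · subst hij; simp
    · simp [Matrix.trace_single_eq_of_ne _ _ _ hij]
  · intro h A
    rw [trace_ofChoi, h]
    simp [Matrix.one_apply, Matrix.trace]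

theorem ofChoi_eq_traceFst (C : Matrix (m × n) (m × n) ℂ) (A : Matrix m m ℂ) :
    ofChoi C A = traceFst (C * (Aᵀ ⊗ₖ (1 : Matrix n n ℂ))) := by
  ext a a'
  simp only [ofChoi_apply, traceFst, Matrix.of_apply, Matrix.mul_apply, Fintype.sum_prod_type,
    Matrix.kroneckerMap_apply, Matrix.transpose_apply, Matrix.one_apply, mul_ite, mul_one, mul_zero,
    Finset.sum_ite_eq', Finset.mem_univ, if_true]
  exact Finset.sum_congr rfl fun i _ => Finset.sum_congr rfl fun j _ => mul_comm _ _

theorem traceFst_one_kronecker_mul (s : Matrix n n ℂ) (X : Matrix (m × n) (m × n) ℂ) :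
    traceFst (((1 : Matrix m m ℂ) ⊗ₖ s) * X) = s * traceFst X := by
  ext a a'
  have e : ∀ i, (((1 : Matrix m m ℂ) ⊗ₖ s) * X) (i, a) (i, a') =
      ∑ b, s a b * X (i, b) (i, a') := by
    intro i
    rw [Matrix.mul_apply, Fintype.sum_prod_type,
      Finset.sum_eq_single i (fun j _ hj => by simp [Matrix.one_apply_ne hj.symm]) (by simp)]
    simp
  simp only [traceFst, Matrix.of_apply, e]
  rw [Matrix.mul_apply]
  simp only [Matrix.of_apply, Finset.mul_sum]
  exact Finset.sum_comm

theorem traceFst_mul_one_kronecker (s : Matrix n n ℂ) (X : Matrix (m × n) (m × n) ℂ) :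
    traceFst (X * ((1 : Matrix m m ℂ) ⊗ₖ s)) = traceFst X * s := by
  ext a a'
  have e : ∀ i, (X * ((1 : Matrix m m ℂ) ⊗ₖ s)) (i, a) (i, a') =
      ∑ b, X (i, a) (i, b) * s b a' := by
    intro i
    rw [Matrix.mul_apply, Fintype.sum_prod_type,
      Finset.sum_eq_single i (fun j _ hj => by simp [Matrix.one_apply_ne hj]) (by simp)]
    simp
  simp only [traceFst, Matrix.of_apply, e]
  rw [Matrix.mul_apply]
  simp only [Matrix.of_apply, Finset.sum_mul]
  exact Finset.sum_comm

theorem traceFst_kronecker_one_mul (r : Matrix m m ℂ) (X : Matrix (m × n) (m × n) ℂ) :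
    traceFst ((r ⊗ₖ (1 : Matrix n n ℂ)) * X) = traceFst (X * (r ⊗ₖ (1 : Matrix n n ℂ))) := by
  ext a a'
  simp only [traceFst, Matrix.of_apply, Matrix.mul_apply, Fintype.sum_prod_type,
    Matrix.kroneckerMap_apply, Matrix.one_apply, mul_ite, ite_mul, mul_one, zero_mul, mul_zero,
    Finset.sum_ite_eq', Finset.sum_ite_eq, Finset.mem_univ, if_true]
  rw [Finset.sum_comm]
  exact Finset.sum_congr rfl fun i _ => Finset.sum_congr rfl fun j _ => mul_comm _ _

theorem conj_ofChoi (C : Matrix (m × n) (m × n) ℂ) (r A : Matrix m m ℂ) (s : Matrix n n ℂ) :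
    ofChoi (((r.map star) ⊗ₖ s) * C * ((r.map star) ⊗ₖ s)ᴴ) A =
      s * ofChoi C (rᴴ * A * r) * sᴴ := by
  have hK : (r.map star) ⊗ₖ s = (1 ⊗ₖ s) * ((r.map star) ⊗ₖ 1) := by
    rw [← Matrix.mul_kronecker_mul, Matrix.one_mul, Matrix.mul_one]
  have hK' : ((r.map star) ⊗ₖ s)ᴴ = (rᵀ ⊗ₖ 1) * (1 ⊗ₖ sᴴ) := by
    rw [← Matrix.mul_kronecker_mul, Matrix.one_mul, Matrix.mul_one, Matrix.conjTranspose_kronecker]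
    congr 1
    ext i j
    simp
  have hcomm : ((1 : Matrix m m ℂ) ⊗ₖ sᴴ) * (Aᵀ ⊗ₖ (1 : Matrix n n ℂ)) =
      (Aᵀ ⊗ₖ (1 : Matrix n n ℂ)) * ((1 : Matrix m m ℂ) ⊗ₖ sᴴ) := by
    rw [← Matrix.mul_kronecker_mul, ← Matrix.mul_kronecker_mul, Matrix.one_mul, Matrix.mul_one,
      Matrix.one_mul, Matrix.mul_one]
  have hA : rᵀ * Aᵀ * r.map star = (rᴴ * A * r)ᵀ := by
    rw [Matrix.transpose_mul, Matrix.transpose_mul, Matrix.mul_assoc]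
    rfl
  rw [ofChoi_eq_traceFst, ofChoi_eq_traceFst, hK', hK]
  calc traceFst (1 ⊗ₖ s * (r.map star) ⊗ₖ 1 * C * (rᵀ ⊗ₖ 1 * 1 ⊗ₖ sᴴ) * Aᵀ ⊗ₖ 1)
      = traceFst (1 ⊗ₖ s * ((r.map star) ⊗ₖ 1 * (C * (rᵀ ⊗ₖ 1 * Aᵀ ⊗ₖ 1))) * 1 ⊗ₖ sᴴ) := by
        congr 1
        simp only [Matrix.mul_assoc]
        rw [hcomm]
    _ = s * traceFst (C * (rᵀ ⊗ₖ 1 * Aᵀ ⊗ₖ 1) * (r.map star) ⊗ₖ 1) * sᴴ := by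
        rw [traceFst_mul_one_kronecker, traceFst_one_kronecker_mul, traceFst_kronecker_one_mul]
    _ = s * traceFst (C * (rᴴ * A * r)ᵀ ⊗ₖ 1) * sᴴ := by
        rw [Matrix.mul_assoc C, ← Matrix.mul_kronecker_mul, ← Matrix.mul_kronecker_mul, hA,
          Matrix.one_mul, Matrix.one_mul]

theorem ofChoi_injective : Function.Injective
    (ofChoi : Matrix (m × n) (m × n) ℂ → (Matrix m m ℂ →ₗ[ℂ] Matrix n n ℂ)) :=
  Function.LeftInverse.injective choi_ofChoi

theorem equivariant_iff {r : Matrix m m ℂ} {s : Matrix n n ℂ} (hr : rᴴ * r = 1)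
    (hs : sᴴ * s = 1) (C : Matrix (m × n) (m × n) ℂ) :
    (∀ A, ofChoi C (r * A * rᴴ) = s * ofChoi C A * sᴴ) ↔
      ((r.map star) ⊗ₖ s) * C = C * ((r.map star) ⊗ₖ s) := by
  have hr' : r * rᴴ = 1 := mul_eq_one_comm.1 hr
  set K := (r.map star) ⊗ₖ s with hKdef
  have hK : Kᴴ * K = 1 := by
    rw [hKdef, Matrix.conjTranspose_kronecker, ← Matrix.mul_kronecker_mul, hs]
    have : (r.map star)ᴴ * r.map star = 1 := by
      have h1 : (r.map star)ᴴ * r.map star = (rᴴ * r)ᵀ := by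
        rw [Matrix.transpose_mul]
        congr 1
        ext i j
        simp
      rw [h1, hr, Matrix.transpose_one]
    rw [this, Matrix.one_kronecker_one]
  have hK' : K * Kᴴ = 1 := mul_eq_one_comm.1 hK
  constructor
  · intro h
    have h1 : K * C * Kᴴ = C := by
      have h2 : ofChoi (K * C * Kᴴ) = ofChoi C := by
        refine LinearMap.ext fun A => ?_
        rw [hKdef, conj_ofChoi, ← h]
        congr 1
        calc r * (rᴴ * A * r) * rᴴ = (r * rᴴ) * A * (r * rᴴ) := by simp only [Matrix.mul_assoc]
          _ = A := by rw [hr', Matrix.one_mul, Matrix.mul_one]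
      exact ofChoi_injective h2
    calc K * C = K * C * Kᴴ * K := by rw [Matrix.mul_assoc _ Kᴴ, hK, Matrix.mul_one]
      _ = C * K := by rw [h1]
  · intro h A
    have h1 : K * C * Kᴴ = C := by rw [h, Matrix.mul_assoc, hK', Matrix.mul_one]
    conv_lhs => rw [← h1, hKdef, conj_ofChoi]
    congr 3
    calc rᴴ * (r * A * rᴴ) * r = (rᴴ * r) * A * (rᴴ * r) := by simp only [Matrix.mul_assoc]
      _ = A := by rw [hr, Matrix.one_mul, Matrix.mul_one]

/-! ### Block decomposition of equivariant Choi matrices -/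

theorem traceSnd_kronecker_one_mul (r : Matrix m m ℂ) (X : Matrix (m × n) (m × n) ℂ) :
    traceSnd ((r ⊗ₖ (1 : Matrix n n ℂ)) * X) = r * traceSnd X := by
  ext i i'
  simp only [traceSnd, Matrix.of_apply, Matrix.mul_apply, Fintype.sum_prod_type,
    Matrix.kroneckerMap_apply, Matrix.one_apply, mul_ite, ite_mul, mul_one, zero_mul, mul_zero,
    Finset.sum_ite_eq, Finset.mem_univ, if_true, Finset.mul_sum]
  exact Finset.sum_comm

theorem traceSnd_mul_kronecker_one (r : Matrix m m ℂ) (X : Matrix (m × n) (m × n) ℂ) :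
    traceSnd (X * (r ⊗ₖ (1 : Matrix n n ℂ))) = traceSnd X * r := by
  ext i i'
  simp only [traceSnd, Matrix.of_apply, Matrix.mul_apply, Fintype.sum_prod_type,
    Matrix.kroneckerMap_apply, Matrix.one_apply, mul_ite, mul_one, mul_zero,
    Finset.sum_ite_eq', Finset.mem_univ, if_true, Finset.sum_mul]
  exact Finset.sum_comm

theorem traceSnd_one_kronecker_mul (s : Matrix n n ℂ) (X : Matrix (m × n) (m × n) ℂ) :
    traceSnd (((1 : Matrix m m ℂ) ⊗ₖ s) * X) = traceSnd (X * ((1 : Matrix m m ℂ) ⊗ₖ s)) := by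
  ext i i'
  have e1 : ∀ a, (((1 : Matrix m m ℂ) ⊗ₖ s) * X) (i, a) (i', a) =
      ∑ b, s a b * X (i, b) (i', a) := by
    intro a
    rw [Matrix.mul_apply, Fintype.sum_prod_type,
      Finset.sum_eq_single i (fun j _ hj => by simp [Matrix.one_apply_ne hj.symm]) (by simp)]
    simp
  have e2 : ∀ a, (X * ((1 : Matrix m m ℂ) ⊗ₖ s)) (i, a) (i', a) =
      ∑ b, X (i, a) (i', b) * s b a := by
    intro a
    rw [Matrix.mul_apply, Fintype.sum_prod_type,
      Finset.sum_eq_single i' (fun j _ hj => by simp [Matrix.one_apply_ne hj]) (by simp)]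
    simp
  simp only [traceSnd, Matrix.of_apply, e1, e2]
  rw [Finset.sum_comm]
  exact Finset.sum_congr rfl fun a _ => Finset.sum_congr rfl fun b _ => mul_comm _ _

theorem trace_traceSnd (X : Matrix (m × n) (m × n) ℂ) : (traceSnd X).trace = X.trace := by
  simp [traceSnd, Matrix.trace, Fintype.sum_prod_type]

theorem traceSnd_mem_intertwiners {R : MatRep d m} {S : MatRep d n} (hS : IsSmooth S)
    {C : Matrix (m × n) (m × n) ℂ} (hC : C ∈ intertwiners (tensor R S) (tensor R S)) :
    traceSnd C ∈ intertwiners R R := by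
  intro g
  have hC' : (R g ⊗ₖ S g) * C = C * (R g ⊗ₖ S g) := hC g
  have e1 : R g ⊗ₖ (1 : Matrix n n ℂ) = (1 ⊗ₖ (S g)ᴴ) * (R g ⊗ₖ S g) := by
    rw [← Matrix.mul_kronecker_mul, Matrix.one_mul, hS.unitary]
  have e2 : R g ⊗ₖ (1 : Matrix n n ℂ) = (R g ⊗ₖ S g) * (1 ⊗ₖ (S g)ᴴ) := by
    rw [← Matrix.mul_kronecker_mul, Matrix.mul_one, hS.unitary']
  rw [← traceSnd_kronecker_one_mul, e1, Matrix.mul_assoc, traceSnd_one_kronecker_mul, hC',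
    Matrix.mul_assoc, ← e2, traceSnd_mul_kronecker_one]

theorem schur_conjRep (b : Bases d) {γ : Staircase d}
    {M : Matrix (Fin (dimQ γ)) (Fin (dimQ γ)) ℂ}
    (hM : M ∈ intertwiners (conjRep (rep b γ)) (conjRep (rep b γ))) :
    M = (M.trace / dimQ γ) • (1 : Matrix (Fin (dimQ γ)) (Fin (dimQ γ)) ℂ) := by
  have h1 : M.map star ∈ intertwiners (rep b γ) (rep b γ) := by
    intro g
    have h := congrArg (fun N : Matrix (Fin (dimQ γ)) (Fin (dimQ γ)) ℂ => N.map star) (hM g)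
    ext i j
    have h2 := congrFun (congrFun h i) j
    simpa [conjRep, Matrix.mul_apply] using h2
  obtain ⟨c, hc⟩ := schur b h1
  have h2 : M = star c • (1 : Matrix (Fin (dimQ γ)) (Fin (dimQ γ)) ℂ) := by
    ext i j
    have h3 := congrArg star (congrFun (congrFun hc i) j)
    rw [Matrix.map_apply, star_star] at h3
    rw [h3]
    by_cases h : i = j <;> simp [h]
  rw [h2, Matrix.trace_smul, Matrix.trace_one, Fintype.card_fin, smul_eq_mul,
    mul_div_cancel_right₀ _ (dimQ_ne_zero γ)]

namespace CGTransform

variable {b : Bases d} {R : MatRep d m} {S : MatRep d n} (T : CGTransform b R S)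

/-- The operator `⨁_γ 1 ⊗ P_γ` on `⨁_γ Q_γ ⊗ ℂ^{c_γ}`. -/
def blocks (P : ∀ γ : T.support, Matrix (Fin (mult b R S γ.1)) (Fin (mult b R S γ.1)) ℂ) :
    Matrix (Σ γ : T.support, Fin (dimQ γ.1) × Fin (mult b R S γ.1))
      (Σ γ : T.support, Fin (dimQ γ.1) × Fin (mult b R S γ.1)) ℂ :=
  Matrix.blockDiagonal' fun γ : T.support =>
    (1 : Matrix (Fin (dimQ γ.1)) (Fin (dimQ γ.1)) ℂ) ⊗ₖ P γ

theorem blocks_submatrix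
    (P : ∀ γ : T.support, Matrix (Fin (mult b R S γ.1)) (Fin (mult b R S γ.1)) ℂ)
    (γ : T.support) :
    (T.blocks P).submatrix (fun k => ⟨γ, (⟨0, dimQ_pos γ.1⟩, k)⟩)
      (fun k => ⟨γ, (⟨0, dimQ_pos γ.1⟩, k)⟩) = P γ := by
  ext k l
  simp [blocks]

theorem blocks_injective : Function.Injective T.blocks := by
  intro P Q h
  funext γ
  rw [← T.blocks_submatrix P γ, h, T.blocks_submatrix]

theorem posSemidef_blocks_iff
    (P : ∀ γ : T.support, Matrix (Fin (mult b R S γ.1)) (Fin (mult b R S γ.1)) ℂ) :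
    (T.blocks P).PosSemidef ↔ ∀ γ, (P γ).PosSemidef := by
  constructor
  · intro h γ
    rw [← T.blocks_submatrix P γ]
    exact h.submatrix _
  · intro h
    choose N hN using fun γ => (h γ).exists_eq_conjTranspose_mul_self
    have e : T.blocks P = (T.blocks N)ᴴ * T.blocks N := by
      rw [blocks, blocks, Matrix.blockDiagonal'_conjTranspose, ← Matrix.blockDiagonal'_mul]
      congr 1
      funext γ
      rw [Matrix.conjTranspose_kronecker, ← Matrix.mul_kronecker_mul, Matrix.conjTranspose_one,
        Matrix.one_mul, ← hN]
    rw [e]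
    exact Matrix.posSemidef_conjTranspose_mul_self _

/-- The operator on `R ⊗ S` with the given blocks. -/
def ofBlocks (P : ∀ γ : T.support, Matrix (Fin (mult b R S γ.1)) (Fin (mult b R S γ.1)) ℂ) :
    Matrix (m × n) (m × n) ℂ :=
  T.matᴴ * T.blocks P * T.mat

theorem mat_mul_ofBlocks_mul
    (P : ∀ γ : T.support, Matrix (Fin (mult b R S γ.1)) (Fin (mult b R S γ.1)) ℂ) :
    T.mat * T.ofBlocks P * T.matᴴ = T.blocks P := by
  calc T.mat * T.ofBlocks P * T.matᴴ
      = (T.mat * T.matᴴ) * T.blocks P * (T.mat * T.matᴴ) := by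
        simp only [ofBlocks, Matrix.mul_assoc]
    _ = T.blocks P := by rw [T.mul_conjTranspose, Matrix.one_mul, Matrix.mul_one]

theorem ofBlocks_injective : Function.Injective T.ofBlocks := by
  intro P Q h
  apply T.blocks_injective
  rw [← T.mat_mul_ofBlocks_mul P, h, T.mat_mul_ofBlocks_mul]

theorem posSemidef_ofBlocks_iff
    (P : ∀ γ : T.support, Matrix (Fin (mult b R S γ.1)) (Fin (mult b R S γ.1)) ℂ) :
    (T.ofBlocks P).PosSemidef ↔ ∀ γ, (P γ).PosSemidef := by
  rw [← T.posSemidef_blocks_iff]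
  constructor
  · intro h
    rw [← T.mat_mul_ofBlocks_mul P]
    exact h.mul_mul_conjTranspose_same T.mat
  · intro h
    exact h.conjTranspose_mul_mul_same T.mat

theorem trace_ofBlocks
    (P : ∀ γ : T.support, Matrix (Fin (mult b R S γ.1)) (Fin (mult b R S γ.1)) ℂ) :
    (T.ofBlocks P).trace = ∑ γ : T.support, (dimQ γ.1 : ℂ) * (P γ).trace := by
  rw [ofBlocks, Matrix.mul_assoc, Matrix.trace_mul_comm, Matrix.mul_assoc, T.mul_conjTranspose,
    Matrix.mul_one, blocks, Matrix.trace_blockDiagonal']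
  refine Finset.sum_congr rfl fun γ _ => ?_
  rw [Matrix.trace_kronecker, Matrix.trace_one, Fintype.card_fin]

theorem ofBlocks_commutes
    (P : ∀ γ : T.support, Matrix (Fin (mult b R S γ.1)) (Fin (mult b R S γ.1)) ℂ) (g : SU d) :
    tensor R S (SU.incl g) * T.ofBlocks P = T.ofBlocks P * tensor R S (SU.incl g) := by
  have h1 := T.commutes g
  set B := Matrix.blockDiagonal' (fun γ : T.support =>
        rep b γ.1 (SU.incl g) ⊗ₖ (1 : Matrix (Fin (mult b R S γ.1)) (Fin (mult b R S γ.1)) ℂ))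
    with hB
  have h2 : tensor R S (SU.incl g) * T.matᴴ = T.matᴴ * B := by
    calc tensor R S (SU.incl g) * T.matᴴ
        = T.matᴴ * (T.mat * tensor R S (SU.incl g)) * T.matᴴ := by
          rw [← Matrix.mul_assoc, T.conjTranspose_mul, Matrix.one_mul]
      _ = T.matᴴ * B := by
          rw [h1, Matrix.mul_assoc, Matrix.mul_assoc, T.mul_conjTranspose, Matrix.mul_one]
  have h3 : B * T.blocks P = T.blocks P * B := by
    rw [hB, blocks, ← Matrix.blockDiagonal'_mul, ← Matrix.blockDiagonal'_mul]
    congr 1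
    funext γ
    rw [← Matrix.mul_kronecker_mul, ← Matrix.mul_kronecker_mul, Matrix.mul_one, Matrix.one_mul,
      Matrix.one_mul, Matrix.mul_one]
  rw [ofBlocks, ← Matrix.mul_assoc, ← Matrix.mul_assoc, h2, Matrix.mul_assoc T.matᴴ B, h3,
    Matrix.mul_assoc _ T.mat, h1]
  simp only [Matrix.mul_assoc]

theorem exists_eq_ofBlocks (hc : HasScalarCenter (tensor R S)) (hs : IsSmooth (tensor R S))
    {C : Matrix (m × n) (m × n) ℂ} (hC : C ∈ intertwiners (tensor R S) (tensor R S)) :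
    ∃ P, C = T.ofBlocks P := by
  have hent : ∀ (γ γ' : T.support) q k q' k', (T.mat * C * T.matᴴ) ⟨γ, (q, k)⟩ ⟨γ', (q', k')⟩ =
      ((T.family γ.1 k)ᴴ * C * T.family γ'.1 k') q q' := by
    intro γ γ' q k q' k'
    rw [Matrix.mul_apply, Matrix.mul_apply]
    refine Finset.sum_congr rfl fun x _ => ?_
    congr 1
    rw [Matrix.mul_apply, Matrix.mul_apply]
    refine Finset.sum_congr rfl fun y _ => ?_
    congr 1
    simp [family]
  have hmem : ∀ (γ γ' : T.support) k k', (T.family γ.1 k)ᴴ * C * T.family γ'.1 k' ∈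
      intertwiners (rep b γ'.1) (rep b γ.1) := fun γ γ' k k' =>
    mul_mem_intertwiners (mul_mem_intertwiners (conjTranspose_mem_intertwiners (isSmooth_rep b _)
      hs (T.family_mem hc γ.1 k)) hC) (T.family_mem hc γ'.1 k')
  let P : ∀ γ : T.support, Matrix (Fin (mult b R S γ.1)) (Fin (mult b R S γ.1)) ℂ := fun γ =>
    Matrix.of fun k k' => ((T.family γ.1 k)ᴴ * C * T.family γ.1 k').trace / dimQ γ.1
  have hP : T.mat * C * T.matᴴ = T.blocks P := by
    ext ⟨γ, q, k⟩ ⟨γ', q', k'⟩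
    rw [hent]
    by_cases hγ : γ = γ'
    · subst hγ
      rw [eq_trace_div_smul_one b (hmem γ γ k k'), blocks, Matrix.blockDiagonal'_apply_eq,
        Matrix.kroneckerMap_apply, Matrix.smul_apply, smul_eq_mul, mul_comm]
      rfl
    · rw [schur_of_ne b (fun h => hγ (Subtype.ext h.symm)) (hmem γ γ' k k'), blocks,
        Matrix.blockDiagonal'_apply_ne _ _ _ hγ, Matrix.zero_apply]
  refine ⟨P, ?_⟩
  rw [ofBlocks, ← hP]
  calc C = (T.matᴴ * T.mat) * C * (T.matᴴ * T.mat) := by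
        rw [T.conjTranspose_mul, Matrix.one_mul, Matrix.mul_one]
    _ = _ := by simp only [Matrix.mul_assoc]

theorem ofBlocks_add
    (P Q : ∀ γ : T.support, Matrix (Fin (mult b R S γ.1)) (Fin (mult b R S γ.1)) ℂ) :
    T.ofBlocks (P + Q) = T.ofBlocks P + T.ofBlocks Q := by
  have : T.blocks (P + Q) = T.blocks P + T.blocks Q := by
    rw [blocks, blocks, blocks, ← Matrix.blockDiagonal'_add]
    congr 1
    funext γ
    exact Matrix.kronecker_add _ _ _
  rw [ofBlocks, this, Matrix.mul_add, Matrix.add_mul, ofBlocks, ofBlocks]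

theorem ofBlocks_smul (c : ℂ)
    (P : ∀ γ : T.support, Matrix (Fin (mult b R S γ.1)) (Fin (mult b R S γ.1)) ℂ) :
    T.ofBlocks (c • P) = c • T.ofBlocks P := by
  have : T.blocks (c • P) = c • T.blocks P := by
    rw [blocks, blocks, ← Matrix.blockDiagonal'_smul]
    congr 1
    funext γ
    rw [Pi.smul_apply, Pi.smul_apply, Matrix.kronecker_smul]
  rw [ofBlocks, this, Matrix.mul_smul, Matrix.smul_mul, ofBlocks]

/-- The linear map with Choi matrix `T.ofBlocks P`, as a function of `P`. -/
def ofBlocksMap :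
    (∀ γ : T.support, Matrix (Fin (mult b R S γ.1)) (Fin (mult b R S γ.1)) ℂ) →ₗ[ℝ]
      (Matrix m m ℂ →ₗ[ℂ] Matrix n n ℂ) where
  toFun P := ofChoi (T.ofBlocks P)
  map_add' P Q := by
    rw [ofBlocks_add]
    refine LinearMap.ext fun A => ?_
    ext a a'
    simp [ofChoi_apply, mul_add, Finset.sum_add_distrib]
  map_smul' c P := by
    have : c • P = (c : ℂ) • P := by
      funext γ
      exact (Complex.coe_smul c (P γ)).symm
    rw [this, ofBlocks_smul]
    refine LinearMap.ext fun A => ?_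
    ext a a'
    simp only [ofChoi_apply, RingHom.id_apply, LinearMap.smul_apply, Matrix.smul_apply,
      smul_eq_mul, Complex.real_smul, Finset.mul_sum]
    exact Finset.sum_congr rfl fun i _ => Finset.sum_congr rfl fun j _ => by ring

theorem ofBlocksMap_injective : Function.Injective T.ofBlocksMap :=
  ofChoi_injective.comp T.ofBlocks_injective

theorem mat_mul_block_mul (γ : Staircase d) (hγ : γ ∈ labels b R S)
    (ψ : Fin (mult b R S γ) → ℂ) :
    T.matᴴ * T.block γ hγ ψ * T.mat = T.embed γ ψ * (T.embed γ ψ)ᴴ := by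
  have hs := (T.mem_support γ).2 hγ
  have h1 : ∀ x (p : Fin (dimQ γ) × Fin (mult b R S γ)),
      (T.matᴴ * T.block γ hγ ψ) x ⟨⟨γ, hs⟩, p⟩ = T.embed γ ψ x p.1 * star (ψ p.2) := by
    rintro x ⟨q, k⟩
    rw [Matrix.mul_apply, Fintype.sum_sigma, Finset.sum_eq_single ⟨γ, hs⟩]
    · rw [Fintype.sum_prod_type]
      simp [block, Matrix.one_apply, Matrix.vecMulVec_apply, embed, Finset.sum_mul, mul_assoc]
    · intro γ' _ hne
      refine Finset.sum_eq_zero fun p _ => ?_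
      rw [block, Matrix.blockDiagonal'_apply_ne _ _ _ hne, mul_zero]
    · simp
  have h2 : ∀ x (γ' : T.support) p, γ' ≠ ⟨γ, hs⟩ →
      (T.matᴴ * T.block γ hγ ψ) x ⟨γ', p⟩ = 0 := by
    intro x γ' p hne
    rw [Matrix.mul_apply, Fintype.sum_sigma]
    refine Finset.sum_eq_zero fun γ'' _ => Finset.sum_eq_zero fun p' _ => ?_
    rw [block]
    by_cases h : γ'' = γ'
    · subst h
      rw [Matrix.blockDiagonal'_apply_eq, Pi.single_eq_of_ne hne, Matrix.zero_apply, mul_zero]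
    · rw [Matrix.blockDiagonal'_apply_ne _ _ _ h, mul_zero]
  ext x y
  rw [Matrix.mul_apply, Fintype.sum_sigma, Finset.sum_eq_single ⟨γ, hs⟩]
  · simp only [h1]
    rw [Fintype.sum_prod_type, Matrix.mul_apply]
    refine Finset.sum_congr rfl fun q _ => ?_
    simp [embed, Finset.mul_sum, mul_comm, mul_left_comm, mul_assoc]
  · intro γ' _ hne
    exact Finset.sum_eq_zero fun p _ => by rw [h2 x γ' p hne, zero_mul]
  · simp

end CGTransform

/-! ### The extreme points of the set of equivariant channels -/

section Extreme

variable {b : Bases d} {lam mu : Staircase d}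
  (T : CGTransform b (conjRep (rep b lam)) (rep b mu))

theorem isSmooth_conj_tensor (b : Bases d) (lam mu : Staircase d) :
    IsSmooth (tensor (conjRep (rep b lam)) (rep b mu)) :=
  (isSmooth_rep b lam).conjRep.tensor (isSmooth_rep b mu)

theorem hasScalarCenter_conj_tensor (b : Bases d) (lam mu : Staircase d) :
    HasScalarCenter (tensor (conjRep (rep b lam)) (rep b mu)) :=
  (hasScalarCenter_rep b lam).conjRep.tensor (hasScalarCenter_rep b mu)

theorem traceSnd_eq_one_iff {C : Matrix (Fin (dimQ lam) × Fin (dimQ mu))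
      (Fin (dimQ lam) × Fin (dimQ mu)) ℂ}
    (hC : C ∈ intertwiners (tensor (conjRep (rep b lam)) (rep b mu))
      (tensor (conjRep (rep b lam)) (rep b mu))) :
    traceSnd C = 1 ↔ C.trace = dimQ lam := by
  have h1 := schur_conjRep b (traceSnd_mem_intertwiners (isSmooth_rep b mu) hC)
  rw [trace_traceSnd] at h1
  constructor
  · intro h
    rw [← trace_traceSnd, h, Matrix.trace_one, Fintype.card_fin]
  · intro h
    rw [h1, h, div_self (dimQ_ne_zero lam), one_smul]

theorem equivariantChannels_eq_image :
    equivariantChannels (rep b lam) (rep b mu) = T.ofBlocksMap ''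
      normalizedFamilies (fun γ : T.support => mult b (conjRep (rep b lam)) (rep b mu) γ.1)
        (fun γ => dimQ γ.1) (dimQ lam) := by
  have hc := hasScalarCenter_conj_tensor b lam mu
  have hs := isSmooth_conj_tensor b lam mu
  ext Φ
  constructor
  · rintro ⟨⟨hCP, hTP⟩, hE⟩
    have hC : choi Φ ∈ intertwiners (tensor (conjRep (rep b lam)) (rep b mu))
        (tensor (conjRep (rep b lam)) (rep b mu)) := by
      refine commutes_of_SU hc fun g => ?_
      refine (equivariant_iff ((isSmooth_rep b lam).unitary _) ((isSmooth_rep b mu).unitary _)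
        (choi Φ)).1 fun A => ?_
      rw [ofChoi_choi]
      exact hE g A
    obtain ⟨P, hP⟩ := T.exists_eq_ofBlocks hc hs hC
    refine ⟨P, ⟨?_, ?_⟩, ?_⟩
    · rw [← T.posSemidef_ofBlocks_iff, ← hP]
      exact posSemidef_choi_of_isCP hCP
    · rw [← T.trace_ofBlocks, ← hP, ← traceSnd_eq_one_iff hC, ← trace_ofChoi_eq_iff, ofChoi_choi]
      exact hTP
    · change ofChoi (T.ofBlocks P) = Φ
      rw [← hP, ofChoi_choi]
  · rintro ⟨P, ⟨hP, htr⟩, rfl⟩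
    have hC : T.ofBlocks P ∈ intertwiners (tensor (conjRep (rep b lam)) (rep b mu))
        (tensor (conjRep (rep b lam)) (rep b mu)) := commutes_of_SU hc (T.ofBlocks_commutes P)
    refine ⟨⟨isCP_ofChoi ((T.posSemidef_ofBlocks_iff P).2 hP), ?_⟩, fun g => ?_⟩
    · refine (trace_ofChoi_eq_iff _).2 ((traceSnd_eq_one_iff hC).2 ?_)
      rw [T.trace_ofBlocks]
      exact htr
    · exact (equivariant_iff ((isSmooth_rep b lam).unitary _) ((isSmooth_rep b mu).unitary _)
        _).2 (hC (SU.incl g))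

theorem extremalMap_eq (γ : Staircase d)
    (hγ : γ ∈ labels b (conjRep (rep b lam)) (rep b mu))
    (ψ : Fin (mult b (conjRep (rep b lam)) (rep b mu) γ) → ℂ) :
    extremalMap T γ hγ ψ = T.ofBlocksMap
      (rankOneFamily (fun γ : T.support => mult b (conjRep (rep b lam)) (rep b mu) γ.1)
        (fun γ => dimQ γ.1) (dimQ lam) ⟨γ, (T.mem_support γ).2 hγ⟩ ψ) := by
  change ofChoi _ = ofChoi _
  congr 1
  rw [rankOneFamily, Pi.single_smul, CGTransform.ofBlocks_smul, CGTransform.ofBlocks]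
  congr 3
  rw [CGTransform.block, CGTransform.blocks]
  congr 1
  funext γ'
  by_cases h : γ' = ⟨γ, (T.mem_support γ).2 hγ⟩
  · subst h
    rw [Pi.single_eq_same, Pi.single_eq_same]
  · rw [Pi.single_eq_of_ne h, Pi.single_eq_of_ne h, Matrix.kronecker_zero]

theorem extremePoints_equivariantChannels :
    Set.extremePoints ℝ (equivariantChannels (rep b lam) (rep b mu)) =
      {Φ | ∃ (γ : Staircase d) (hγ : γ ∈ labels b (conjRep (rep b lam)) (rep b mu))
        (ψ : Fin (mult b (conjRep (rep b lam)) (rep b mu) γ) → ℂ),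
        ∑ k, ‖ψ k‖ ^ 2 = 1 ∧ Φ = extremalMap T γ hγ ψ} := by
  rw [equivariantChannels_eq_image T, extremePoints_image_of_injective _ T.ofBlocksMap_injective,
    extremePoints_normalizedFamilies (w := fun γ : T.support => dimQ γ.1)
      (fun γ => dimQ_pos γ.1) (dimQ_pos lam)]
  ext Φ
  constructor
  · rintro ⟨_, ⟨γ, ψ, hψ, rfl⟩, rfl⟩
    exact ⟨γ.1, (T.mem_support γ.1).1 γ.2, ψ, (unit_iff ψ).2 hψ, (extremalMap_eq T _ _ ψ).symm⟩
  · rintro ⟨γ, hγ, ψ, hψ, rfl⟩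
    exact ⟨_, ⟨⟨γ, (T.mem_support γ).2 hγ⟩, ψ, (unit_iff ψ).1 hψ, rfl⟩,
      (extremalMap_eq T γ hγ ψ).symm⟩

end Extreme

variable {l : Type} [Fintype l] [DecidableEq l]

/-! ### Invariant tensors with three legs -/

theorem mem_intertwiners_tensor_iff {P : MatRep d l} (hP : IsSmooth P) (R : MatRep d m)
    (S : MatRep d n) (M : Matrix (m × n) l ℂ) :
    M ∈ intertwiners P (tensor R S) ↔ ∀ g i a q, M (i, a) q =
      ∑ i', ∑ a', ∑ q', R g i i' * S g a a' * star (P g q q') * M (i', a') q' := by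
  have h1 : M ∈ intertwiners P (tensor R S) ↔ ∀ g, M = tensor R S g * M * (P g)ᴴ := by
    constructor
    · intro h g
      rw [h g, Matrix.mul_assoc, hP.unitary', Matrix.mul_one]
    · intro h g
      conv_rhs => rw [h g, Matrix.mul_assoc, hP.unitary, Matrix.mul_one]
  have h2 : ∀ g i a q, (tensor R S g * M * (P g)ᴴ) (i, a) q =
      ∑ i', ∑ a', ∑ q', R g i i' * S g a a' * star (P g q q') * M (i', a') q' := by
    intro g i a q
    rw [Matrix.mul_assoc, Matrix.mul_apply, Fintype.sum_prod_type]
    refine Finset.sum_congr rfl fun i' _ => Finset.sum_congr rfl fun a' _ => ?_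
    rw [Matrix.mul_apply, Finset.mul_sum]
    refine Finset.sum_congr rfl fun q' _ => ?_
    change R g i i' * S g a a' * (M (i', a') q' * star (P g q q')) = _
    ring
  rw [h1]
  constructor
  · intro h g i a q
    rw [← h2, ← h g]
  · intro h g
    ext ⟨i, a⟩ q
    rw [h2, ← h g]

/-- Move the first leg of a tensor to the input. -/
def rotate (M : Matrix (m × n) l ℂ) : Matrix (n × l) m ℂ :=
  Matrix.of fun x i => M (i, x.1) x.2

/-- Exchange the second leg of a tensor with the input, with complex conjugation. -/
def conjSwap (M : Matrix (m × n) l ℂ) : Matrix (m × l) n ℂ :=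
  Matrix.of fun x a => star (M (x.1, a) x.2)

theorem rotate_mem_iff {A : MatRep d m} {S : MatRep d n} {P : MatRep d l} (hA : IsSmooth A)
    (hP : IsSmooth P) (M : Matrix (m × n) l ℂ) :
    rotate M ∈ intertwiners A (tensor S (conjRep P)) ↔
      M ∈ intertwiners P (tensor (conjRep A) S) := by
  rw [mem_intertwiners_tensor_iff hA, mem_intertwiners_tensor_iff hP]
  have e : ∀ g i a q, (∑ a', ∑ q', ∑ i', S g a a' * conjRep P g q q' * star (A g i i') *
      rotate M (a', q') i') =
      ∑ i', ∑ a', ∑ q', conjRep A g i i' * S g a a' * star (P g q q') * M (i', a') q' := by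
    intro g i a q
    rw [Finset.sum_congr rfl fun a' _ => Finset.sum_comm, Finset.sum_comm]
    refine Finset.sum_congr rfl fun i' _ => Finset.sum_congr rfl fun a' _ =>
      Finset.sum_congr rfl fun q' _ => ?_
    change S g a a' * star (P g q q') * star (A g i i') * M (i', a') q' =
      star (A g i i') * S g a a' * star (P g q q') * M (i', a') q'
    ring
  constructor
  · intro h g i a q
    rw [← e]
    exact h g a q i
  · intro h g a q i
    rw [e]
    exact h g i a q

theorem conjSwap_mem_iff {A : MatRep d m} {S : MatRep d n} {P : MatRep d l} (hS : IsSmooth S)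
    (hP : IsSmooth P) (M : Matrix (m × n) l ℂ) :
    conjSwap M ∈ intertwiners S (tensor A P) ↔
      M ∈ intertwiners P (tensor (conjRep A) S) := by
  rw [mem_intertwiners_tensor_iff hS, mem_intertwiners_tensor_iff hP]
  have e : ∀ g i a q, (∑ i', ∑ q', ∑ a', A g i i' * P g q q' * star (S g a a') *
      conjSwap M (i', q') a') =
      star (∑ i', ∑ a', ∑ q', conjRep A g i i' * S g a a' * star (P g q q') * M (i', a') q') := by
    intro g i a q
    simp only [star_sum]
    rw [Finset.sum_congr rfl fun i' _ => Finset.sum_comm]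
    refine Finset.sum_congr rfl fun i' _ => Finset.sum_congr rfl fun a' _ =>
      Finset.sum_congr rfl fun q' _ => ?_
    change A g i i' * P g q q' * star (S g a a') * star (M (i', a') q') =
      star (star (A g i i') * S g a a' * star (P g q q') * M (i', a') q')
    simp only [star_mul', star_star]
    ring
  constructor
  · intro h g i a q
    have := h g i q a
    rw [e] at this
    exact star_injective this
  · intro h g i q a
    rw [e]
    exact congrArg star (h g i a q)

theorem finrank_intertwiners_rotate {A : MatRep d m} {S : MatRep d n} {P : MatRep d l}
    (hA : IsSmooth A) (hP : IsSmooth P) :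
    Module.finrank ℂ (intertwiners A (tensor S (conjRep P))) =
      Module.finrank ℂ (intertwiners P (tensor (conjRep A) S)) := by
  let e : intertwiners A (tensor S (conjRep P)) ≃ₗ[ℂ] intertwiners P (tensor (conjRep A) S) :=
    { toFun := fun N => ⟨Matrix.of fun x q => N.1 (x.2, q) x.1, (rotate_mem_iff hA hP _).1 N.2⟩
      invFun := fun M => ⟨rotate M.1, (rotate_mem_iff hA hP _).2 M.2⟩
      map_add' := fun _ _ => rfl
      map_smul' := fun _ _ => rfl
      left_inv := fun _ => rfl
      right_inv := fun _ => rfl }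
  exact e.finrank_eq

theorem finrank_intertwiners_conjSwap {A : MatRep d m} {S : MatRep d n} {P : MatRep d l}
    (hS : IsSmooth S) (hP : IsSmooth P) :
    Module.finrank ℂ (intertwiners S (tensor A P)) =
      Module.finrank ℂ (intertwiners P (tensor (conjRep A) S)) := by
  have hinv : ∀ N : Matrix (m × l) n ℂ,
      conjSwap (Matrix.of fun x q => star (N (x.1, q) x.2) : Matrix (m × n) l ℂ) = N := by
    intro N
    ext ⟨i, q⟩ a
    exact star_star _
  let e : intertwiners S (tensor A P) ≃ₗ[ℝ] intertwiners P (tensor (conjRep A) S) :=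
    { toFun := fun N => ⟨Matrix.of fun x q => star (N.1 (x.1, q) x.2),
        (conjSwap_mem_iff hS hP _).1 (by rw [hinv]; exact N.2)⟩
      invFun := fun M => ⟨conjSwap M.1, (conjSwap_mem_iff hS hP _).2 M.2⟩
      map_add' := fun N N' => by
        apply Subtype.ext
        ext x q
        exact star_add _ _
      map_smul' := fun c N => by
        apply Subtype.ext
        ext x q
        change star (c • N.1 (x.1, q) x.2) = c • star (N.1 (x.1, q) x.2)
        rw [star_smul, star_trivial]
      left_inv := fun N => Subtype.ext (hinv N.1)
      right_inv := fun M => by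
        apply Subtype.ext
        ext ⟨i, a⟩ q
        exact star_star _ }
  have h := e.finrank_eq
  rw [finrank_real_of_complex, finrank_real_of_complex] at h
  omega

theorem trace_conjTranspose_mul (M N : Matrix m n ℂ) :
    (Mᴴ * N).trace = ∑ i, ∑ j, star (M i j) * N i j := by
  rw [Finset.sum_comm]
  simp [Matrix.trace, Matrix.mul_apply]

theorem trace_rotate (M N : Matrix (m × n) l ℂ) :
    ((rotate M)ᴴ * rotate N).trace = (Mᴴ * N).trace := by
  simp only [trace_conjTranspose_mul, Fintype.sum_prod_type, rotate, Matrix.of_apply]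
  rw [Finset.sum_congr rfl fun a _ => Finset.sum_comm, Finset.sum_comm]

theorem trace_conjSwap (M N : Matrix (m × n) l ℂ) :
    ((conjSwap M)ᴴ * conjSwap N).trace = star ((Mᴴ * N).trace) := by
  simp only [trace_conjTranspose_mul, Fintype.sum_prod_type, conjSwap, Matrix.of_apply, star_sum,
    star_mul', star_star]
  exact Finset.sum_congr rfl fun i _ => Finset.sum_comm

theorem sqrt_mul_sqrt_div (p q : ℕ) :
    ((Real.sqrt (p / q) : ℝ) : ℂ) * ((Real.sqrt (p / q) : ℝ) : ℂ) = (p : ℂ) / q := by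
  rw [← Complex.ofReal_mul, Real.mul_self_sqrt (by positivity)]
  push_cast
  rfl

theorem isOrthoBasis_of_trace (b : Bases d) {R : MatRep d n} (hR : IsSmooth R)
    {γ : Staircase d} {c : ℕ} {J : Fin c → Matrix n (Fin (dimQ γ)) ℂ} {s : ℝ}
    (hc : c = Module.finrank ℂ (intertwiners (rep b γ) R))
    (hJ : ∀ k, J k ∈ intertwiners (rep b γ) R)
    (htr : ∀ k k', (s : ℂ) * (s : ℂ) * ((J k)ᴴ * J k').trace = if k = k' then (dimQ γ : ℂ) else 0) :
    IsOrthoBasis b R γ fun k => (s : ℂ) • J k := by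
  refine ⟨hc, fun k => Submodule.smul_mem _ _ (hJ k), fun k k' => ?_⟩
  have h1 : (J k)ᴴ * J k' ∈ intertwiners (rep b γ) (rep b γ) :=
    mul_mem_intertwiners (conjTranspose_mem_intertwiners (isSmooth_rep b γ) hR (hJ k)) (hJ k')
  have hs : star (s : ℂ) = s := Complex.conj_ofReal s
  rw [Matrix.conjTranspose_smul, Matrix.smul_mul, Matrix.mul_smul, smul_smul, hs,
    eq_trace_div_smul_one b h1, smul_smul, ← mul_div_assoc, htr]
  split_ifs
  · rw [div_self (dimQ_ne_zero γ), one_smul]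
  · rw [zero_div, zero_smul]

/-! ### The three descriptions of the extremal channels -/

section Formulas

variable {b : Bases d} {lam mu : Staircase d}
  (T : CGTransform b (conjRep (rep b lam)) (rep b mu))

theorem trace_family (γ : Staircase d)
    (k k' : Fin (mult b (conjRep (rep b lam)) (rep b mu) γ)) :
    ((T.family γ k)ᴴ * T.family γ k').trace = if k = k' then (dimQ γ : ℂ) else 0 := by
  rw [T.family_ortho]
  split_ifs
  · rw [Matrix.trace_one, Fintype.card_fin]
  · exact Matrix.trace_zero _ _

theorem mult_rotate (b : Bases d) (lam mu γ : Staircase d) :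
    mult b (rep b mu) (conjRep (rep b γ)) lam = mult b (conjRep (rep b lam)) (rep b mu) γ :=
  finrank_intertwiners_rotate (isSmooth_rep b lam) (isSmooth_rep b γ)

theorem mult_conjSwap (b : Bases d) (lam mu γ : Staircase d) :
    mult b (rep b lam) (rep b γ) mu = mult b (conjRep (rep b lam)) (rep b mu) γ :=
  finrank_intertwiners_conjSwap (isSmooth_rep b mu) (isSmooth_rep b γ)

theorem extremalMap_apply (γ : Staircase d)
    (hγ : γ ∈ labels b (conjRep (rep b lam)) (rep b mu))
    (ψ : Fin (mult b (conjRep (rep b lam)) (rep b mu) γ) → ℂ)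
    (A : Matrix (Fin (dimQ lam)) (Fin (dimQ lam)) ℂ) (a a' : Fin (dimQ mu)) :
    extremalMap T γ hγ ψ A a a' = ((dimQ lam : ℂ) / (dimQ γ : ℂ)) *
      ∑ i, ∑ j, ∑ q, A i j * (T.embed γ ψ (i, a) q * star (T.embed γ ψ (j, a') q)) := by
  rw [extremalMap, T.mat_mul_block_mul, ofChoi_apply, Finset.mul_sum]
  refine Finset.sum_congr rfl fun i _ => ?_
  rw [Finset.mul_sum]
  refine Finset.sum_congr rfl fun j _ => ?_
  rw [Matrix.smul_apply, Matrix.mul_apply, smul_eq_mul, Finset.mul_sum, Finset.mul_sum,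
    Finset.mul_sum]
  refine Finset.sum_congr rfl fun q _ => ?_
  rw [Matrix.conjTranspose_apply]
  ring

theorem extremalMap_eq_traceFst (γ : Staircase d)
    (hγ : γ ∈ labels b (conjRep (rep b lam)) (rep b mu))
    (ψ : Fin (mult b (conjRep (rep b lam)) (rep b mu) γ) → ℂ)
    (A : Matrix (Fin (dimQ lam)) (Fin (dimQ lam)) ℂ) :
    extremalMap T γ hγ ψ A = ((dimQ lam : ℂ) / (dimQ γ : ℂ)) •
      traceFst (T.embed γ ψ * (T.embed γ ψ)ᴴ *
        (Aᵀ ⊗ₖ (1 : Matrix (Fin (dimQ mu)) (Fin (dimQ mu)) ℂ))) := by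
  rw [← ofChoi_eq_traceFst]
  ext a a'
  rw [extremalMap_apply, Matrix.smul_apply, smul_eq_mul, ofChoi_apply]
  congr 1
  refine Finset.sum_congr rfl fun i _ => Finset.sum_congr rfl fun j _ => ?_
  rw [Matrix.mul_apply, Finset.mul_sum]
  rfl

theorem exists_CGTransform_rotate (γ : Staircase d) :
    ∃ T₂ : CGTransform b (rep b mu) (conjRep (rep b γ)), ∀ ψ,
      T₂.embed lam (fun k => ψ (Fin.cast (mult_rotate b lam mu γ) k)) =
        ((Real.sqrt (dimQ lam / dimQ γ) : ℝ) : ℂ) • rotate (T.embed γ ψ) := by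
  have hs : IsSmooth (tensor (rep b mu) (conjRep (rep b γ))) :=
    (isSmooth_rep b mu).tensor (isSmooth_rep b γ).conjRep
  have hK : IsOrthoBasis b (tensor (rep b mu) (conjRep (rep b γ))) lam
      fun k : Fin (mult b (rep b mu) (conjRep (rep b γ)) lam) =>
        ((Real.sqrt (dimQ lam / dimQ γ) : ℝ) : ℂ) •
          rotate (T.family γ (Fin.cast (mult_rotate b lam mu γ) k)) := by
    refine isOrthoBasis_of_trace b hs rfl (fun k => ?_) fun k k' => ?_
    · exact (rotate_mem_iff (isSmooth_rep b lam) (isSmooth_rep b γ) _).2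
        (T.family_mem (hasScalarCenter_conj_tensor b lam mu) γ _)
    · rw [trace_rotate, trace_family, sqrt_mul_sqrt_div]
      simp only [Fin.cast_inj]
      split_ifs
      · exact div_mul_cancel₀ _ (dimQ_ne_zero γ)
      · exact mul_zero _
  obtain ⟨T₂, hT₂⟩ := exists_CGTransform_embed_eq b hs lam hK
  refine ⟨T₂, fun ψ => ?_⟩
  rw [hT₂, T.embed_eq_sum]
  refine (Fintype.sum_equiv (finCongr (mult_rotate b lam mu γ)) _ (fun k => ψ k •
    (((Real.sqrt (dimQ lam / dimQ γ) : ℝ) : ℂ) • rotate (T.family γ k))) fun k => rfl).trans ?_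
  ext x i
  simp only [Matrix.sum_apply, Matrix.smul_apply, rotate, Matrix.of_apply, smul_eq_mul,
    Finset.mul_sum, mul_left_comm]

theorem exists_CGTransform_conjSwap (γ : Staircase d) :
    ∃ T₃ : CGTransform b (rep b lam) (rep b γ), ∀ ψ : _ → ℂ,
      T₃.embed mu (fun k => star (ψ (Fin.cast (mult_conjSwap b lam mu γ) k))) =
        ((Real.sqrt (dimQ mu / dimQ γ) : ℝ) : ℂ) • conjSwap (T.embed γ ψ) := by
  have hs : IsSmooth (tensor (rep b lam) (rep b γ)) :=
    (isSmooth_rep b lam).tensor (isSmooth_rep b γ)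
  have hK : IsOrthoBasis b (tensor (rep b lam) (rep b γ)) mu
      fun k : Fin (mult b (rep b lam) (rep b γ) mu) =>
        ((Real.sqrt (dimQ mu / dimQ γ) : ℝ) : ℂ) •
          conjSwap (T.family γ (Fin.cast (mult_conjSwap b lam mu γ) k)) := by
    refine isOrthoBasis_of_trace b hs rfl (fun k => ?_) fun k k' => ?_
    · exact (conjSwap_mem_iff (isSmooth_rep b mu) (isSmooth_rep b γ) _).2
        (T.family_mem (hasScalarCenter_conj_tensor b lam mu) γ _)
    · rw [trace_conjSwap, trace_family, sqrt_mul_sqrt_div]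
      simp only [Fin.cast_inj]
      split_ifs
      · rw [star_natCast]
        exact div_mul_cancel₀ _ (dimQ_ne_zero γ)
      · rw [star_zero, mul_zero]
  obtain ⟨T₃, hT₃⟩ := exists_CGTransform_embed_eq b hs mu hK
  refine ⟨T₃, fun ψ => ?_⟩
  rw [hT₃, T.embed_eq_sum]
  refine (Fintype.sum_equiv (finCongr (mult_conjSwap b lam mu γ)) _ (fun k => star (ψ k) •
    (((Real.sqrt (dimQ mu / dimQ γ) : ℝ) : ℂ) • conjSwap (T.family γ k))) fun k => rfl).trans ?_
  ext x i
  simp only [Matrix.sum_apply, Matrix.smul_apply, conjSwap, Matrix.of_apply, smul_eq_mul,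
    Finset.mul_sum, mul_left_comm, star_sum, star_mul']

theorem extremalMap_eq_traceSnd (γ : Staircase d)
    (hγ : γ ∈ labels b (conjRep (rep b lam)) (rep b mu))
    (ψ : Fin (mult b (conjRep (rep b lam)) (rep b mu) γ) → ℂ)
    (A : Matrix (Fin (dimQ lam)) (Fin (dimQ lam)) ℂ)
    {E : Matrix (Fin (dimQ mu) × Fin (dimQ γ)) (Fin (dimQ lam)) ℂ}
    (hE : E = ((Real.sqrt (dimQ lam / dimQ γ) : ℝ) : ℂ) • rotate (T.embed γ ψ)) :
    extremalMap T γ hγ ψ A = traceSnd (E * A * Eᴴ) := by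
  ext a a'
  have hs : star ((Real.sqrt (dimQ lam / dimQ γ) : ℝ) : ℂ) =
      ((Real.sqrt (dimQ lam / dimQ γ) : ℝ) : ℂ) := Complex.conj_ofReal _
  rw [extremalMap_apply, ← sqrt_mul_sqrt_div, hE]
  simp only [traceSnd, Matrix.of_apply, Matrix.mul_apply, Matrix.conjTranspose_apply,
    Matrix.smul_apply, rotate, smul_eq_mul, star_mul', hs, Finset.mul_sum, Finset.sum_mul]
  rw [Finset.sum_congr rfl fun i _ => Finset.sum_comm, Finset.sum_comm]
  refine Finset.sum_congr rfl fun q _ => ?_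
  rw [Finset.sum_comm]
  refine Finset.sum_congr rfl fun j _ => Finset.sum_congr rfl fun i _ => ?_
  ring

theorem extremalMap_eq_compress (γ : Staircase d)
    (hγ : γ ∈ labels b (conjRep (rep b lam)) (rep b mu))
    (ψ : Fin (mult b (conjRep (rep b lam)) (rep b mu) γ) → ℂ)
    (A : Matrix (Fin (dimQ lam)) (Fin (dimQ lam)) ℂ)
    {F : Matrix (Fin (dimQ lam) × Fin (dimQ γ)) (Fin (dimQ mu)) ℂ}
    (hF : F = ((Real.sqrt (dimQ mu / dimQ γ) : ℝ) : ℂ) • conjSwap (T.embed γ ψ)) :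
    extremalMap T γ hγ ψ A = ((dimQ lam : ℂ) / (dimQ mu : ℂ)) •
      (Fᴴ * (A ⊗ₖ (1 : Matrix (Fin (dimQ γ)) (Fin (dimQ γ)) ℂ)) * F) := by
  ext a a'
  have hs : star ((Real.sqrt (dimQ mu / dimQ γ) : ℝ) : ℂ) =
      ((Real.sqrt (dimQ mu / dimQ γ) : ℝ) : ℂ) := Complex.conj_ofReal _
  have hc : (dimQ lam : ℂ) / (dimQ γ : ℂ) = ((dimQ lam : ℂ) / (dimQ mu : ℂ)) *
      (((Real.sqrt (dimQ mu / dimQ γ) : ℝ) : ℂ) * ((Real.sqrt (dimQ mu / dimQ γ) : ℝ) : ℂ)) := by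
    rw [sqrt_mul_sqrt_div]
    field_simp [dimQ_ne_zero γ, dimQ_ne_zero mu]
  rw [extremalMap_apply, hc, Matrix.smul_apply, smul_eq_mul, mul_assoc, hF]
  congr 1
  simp only [Matrix.mul_apply, Fintype.sum_prod_type, Matrix.conjTranspose_apply,
    Matrix.smul_apply, conjSwap, Matrix.of_apply, Matrix.kroneckerMap_apply, Matrix.one_apply,
    smul_eq_mul, star_mul', star_star, hs, mul_ite, mul_one, mul_zero, Finset.sum_ite_eq',
    Finset.mem_univ, if_true, Finset.mul_sum, Finset.sum_mul]
  rw [Finset.sum_comm]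
  refine Finset.sum_congr rfl fun j _ => ?_
  rw [Finset.sum_comm]
  refine Finset.sum_congr rfl fun q _ => Finset.sum_congr rfl fun i _ => ?_
  ring

end Formulas

end EquivChannel

end

open EquivChannel in
theorem mainTheorem4 (d : ℕ) (b : Bases d) (lam mu : Staircase d) :
    Nonempty (CGTransform b (conjRep (rep b lam)) (rep b mu)) ∧
    ∀ T : CGTransform b (conjRep (rep b lam)) (rep b mu),
      Set.extremePoints ℝ (equivariantChannels (rep b lam) (rep b mu)) =
        {Φ | ∃ (γ : Staircase d) (hγ : γ ∈ labels b (conjRep (rep b lam)) (rep b mu))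
          (ψ : Fin (mult b (conjRep (rep b lam)) (rep b mu) γ) → ℂ),
          ∑ k, ‖ψ k‖ ^ 2 = 1 ∧ Φ = extremalMap T γ hγ ψ} ∧
      ∀ (γ : Staircase d) (hγ : γ ∈ labels b (conjRep (rep b lam)) (rep b mu)),
        ∃ (h₂ : mult b (rep b mu) (conjRep (rep b γ)) lam =
              mult b (conjRep (rep b lam)) (rep b mu) γ)
          (h₃ : mult b (rep b lam) (rep b γ) mu =
              mult b (conjRep (rep b lam)) (rep b mu) γ)
          (T₂ : CGTransform b (rep b mu) (conjRep (rep b γ)))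
          (T₃ : CGTransform b (rep b lam) (rep b γ)),
          ∀ ψ : Fin (mult b (conjRep (rep b lam)) (rep b mu) γ) → ℂ, ∑ k, ‖ψ k‖ ^ 2 = 1 →
          ∀ A : Matrix (Fin (dimQ lam)) (Fin (dimQ lam)) ℂ,
            extremalMap T γ hγ ψ A =
              ((dimQ lam : ℂ) / (dimQ γ : ℂ)) •
                traceFst (T.embed γ ψ * (T.embed γ ψ)ᴴ *
                  (Aᵀ ⊗ₖ (1 : Matrix (Fin (dimQ mu)) (Fin (dimQ mu)) ℂ))) ∧
            extremalMap T γ hγ ψ A =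
              traceSnd (T₂.embed lam (fun k => ψ (Fin.cast h₂ k)) * A *
                (T₂.embed lam (fun k => ψ (Fin.cast h₂ k)))ᴴ) ∧
            extremalMap T γ hγ ψ A =
              ((dimQ lam : ℂ) / (dimQ mu : ℂ)) •
                ((T₃.embed mu (fun k => star (ψ (Fin.cast h₃ k))))ᴴ *
                  (A ⊗ₖ (1 : Matrix (Fin (dimQ γ)) (Fin (dimQ γ)) ℂ)) *
                  T₃.embed mu (fun k => star (ψ (Fin.cast h₃ k)))) := by
  refine ⟨exists_CGTransform b (isSmooth_conj_tensor b lam mu), fun T =>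
    ⟨extremePoints_equivariantChannels T, fun γ hγ => ?_⟩⟩
  obtain ⟨T₂, hT₂⟩ := exists_CGTransform_rotate T γ
  obtain ⟨T₃, hT₃⟩ := exists_CGTransform_conjSwap T γ
  exact ⟨mult_rotate b lam mu γ, mult_conjSwap b lam mu γ, T₂, T₃, fun ψ _ A =>
    ⟨extremalMap_eq_traceFst T γ hγ ψ A, extremalMap_eq_traceSnd T γ hγ ψ A (hT₂ ψ),
      extremalMap_eq_compress T γ hγ ψ A (hT₃ ψ)⟩⟩
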